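/- Let $X,Y$ be real separable Hilbert spaces, $(\Omega,\mathcal F,\mathbb P)$ a probability space, $r,b>0$, $\alpha\in(\tfrac12,1]$ and $H\in(\tfrac12,1)$. Let $(e_n)$ be a countable complete orthonormal system of $Y$, $Q\in\mathcal L(Y,Y)$ with $Qe_n=\lambda_ne_n$, $\lambda_n\ge 0$, $\sum_n\lambda_n<\infty$, and let $B^H(t)=\sum_n\sqrt{\lambda_n}\,\beta_n(t)e_n$, where the $\beta_n$ are mutually independent standard one-dimensional fractional Brownian motions of Hurst index $H$ (centered continuous Gaussian processes with $\mathbb E[\beta_n(t)\beta_n(s)]=\tfrac12(t^{2H}+s^{2H}-|t-s|^{2H})$). For $\varphi\in\mathcal L(Y,X)$ put $\|\varphi\|_{\mathcal L_2^0}^2=\sum_n\|\sqrt{\lambda_n}\varphi e_n\|^2$. For deterministic $\Phi$, let $\int_0^t\Phi\,dB^H=\sum_n\int_0^t\sqrt{\lambda_n}\Phi(s)e_n\,d\beta_n(s)$ (convergence in $L^2(\Omega;X)$), where the Wiener integral $\int_0^t\psi\,d\beta_n$ is the $L^2(\Omega;X)$-limit of the elementary integrals ($\mathbf 1_{[0,\tau]}c\mapsto\beta_n(\tau)c$)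 of step functions on $[0,t]$ that converge to $\psi$ in the norm given by $\|\psi\|^2=H(2H-1)\int_0^t\!\int_0^t\|\psi(u)\|\,\|\psi(v)\|\,|u-v|^{2H-2}\,du\,dv$. Let $A$ be the infinitesimal generator of a $C_0$-semigroup $(T(t))_{t\ge0}$ on $X$ with $\|T(t)\|\le Me^{\omega t}$, $M\ge1$, $\omega\ge0$. For $\alpha<1$ let $M_\alpha(z)=\sum_{n\ge0}\frac{(-z)^n}{n!\,\Gamma(-\alpha n+1-\alpha)}$ be Mainardi's function and $$T_\alpha(t)\eta=\int_0^\infty M_\alpha(\rho)T(t^\alpha\rho)\eta\,d\rho,\qquad S_\alpha(t)\eta=\int_0^\infty\alpha\rho M_\alpha(\rho)T(t^\alpha\rho)\eta\,d\rho\qquad(t\ge0,\ \eta\in X);$$ for $\alpha=1$ let $T_1(t)=S_1(t)=T(t)$. Write $x_s(\theta)=x(s+\theta)$, $\theta\in[-r,0]$. Let $f:[0,b]\times C([-r,0];X)\to X$ be such that $s\mapsto f(s,\zeta)$ is Lebesgue measurable for every $\zeta\in C([-r,0];X)$, $s\mapsto f(s,x_s)$ is Lebesgue measurable for every $x\in C([-r,b];X)$,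 $\int_0^b\|f(s,0)\|^2ds<\infty$, and, for some $C_f>0$, $$\int_0^t\|f(s,x_s)-f(s,y_s)\|^2ds\le C_f\int_{-r}^t\|x(s)-y(s)\|^2ds\qquad\text{for all }x,y\in C([-r,b];X),\ t\in[0,b].$$ Let $h:[0,b]\to\mathcal L(Y,X)$ be such that $s\mapsto h(s)y$ is measurable for every $y\in Y$ and $\int_0^b\|h(s)\|_{\mathcal L_2^0}^{2p}ds<\infty$ for some $p>\frac1{2\alpha-1}$. By the Lipschitz condition, the map $x\mapsto f(\cdot,x_\cdot)$ from $C([-r,b];X)$ to $L^2(0,b;X)$ extends uniquely to a continuous map $L^2(-r,b;X)\to L^2(0,b;X)$; for $x\in C([-r,b];L^2(\Omega;X))$, $f(s,x_s)$ denotes this extension applied to the paths (almost surely in $L^2(-r,b;X)$) of a jointly measurable modification of $x$. Then for every $\phi\in C([-r,0];L^2(\Omega;X))$ the stochastic delay fractional evolution equation $$d[J_t^{1-\alpha}(x(t)-x(0))]=Ax(t)\,dt+f(t,x_t)\,dt+h(t)\,dB^H(t),\ t\in[0,b],\qquad x=\phi\text{ on }[-r,0],$$ where $J_t^{1-\alpha}$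 is the Riemann–Liouville fractional integral of order $1-\alpha$, has exactly one mild solution, i.e. there is exactly one $x\in C([-r,b];L^2(\Omega;X))$ with $x(t)=\phi(t)$ for $t\in[-r,0]$ and, for all $t\in[0,b]$, almost surely $$x(t)=T_\alpha(t)\phi(0)+\int_0^t(t-s)^{\alpha-1}S_\alpha(t-s)f(s,x_s)\,ds+\int_0^t(t-s)^{\alpha-1}S_\alpha(t-s)h(s)\,dB^H(s).$$ -/

import Mathlib

open MeasureTheory ProbabilityTheory Filter Topology Set
open scoped NNReal ENNReal

noncomputable section

namespace FracDelay

/-! ### Strongly continuous semigroups and their generators -/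

/-- `T` (only its values at `t ≥ 0` matter) is a strongly continuous semigroup of bounded
linear operators. -/
structure IsC0Semigroup {X : Type*} [NormedAddCommGroup X] [NormedSpace ℝ X]
    (T : ℝ → X →L[ℝ] X) : Prop where
  zero : T 0 = ContinuousLinearMap.id ℝ X
  add : ∀ s t : ℝ, 0 ≤ s → 0 ≤ t → T (s + t) = (T s).comp (T t)
  cont : ∀ x : X, Tendsto (fun t => T t x) (𝓝[>] 0) (𝓝 x)

/-- The (in general unbounded) operator `A` is the infinitesimal generator of `T`: `x ∈ D(A)` and
`A x = y` exactly when `(T(t) x - x) / t → y` as `t ↓ 0`. -/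
def IsGenerator {X : Type*} [NormedAddCommGroup X] [NormedSpace ℝ X]
    (A : X →ₗ.[ℝ] X) (T : ℝ → X →L[ℝ] X) : Prop :=
  ∀ x y : X, (x, y) ∈ A.graph ↔
    Tendsto (fun t : ℝ => t⁻¹ • (T t x - x)) (𝓝[>] 0) (𝓝 y)

/-! ### Mainardi's function and the operators `T_α`, `S_α` -/

/-- Mainardi's function `M_α(z) = ∑ (-z)^n / (n! Γ(-α n + 1 - α))`, `0 < α < 1`. At the poles of
`Γ` Mathlib has `Γ = 0`, and division by zero gives `0`, which is the usual `1 / Γ = 0`. -/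
def mainardi (α z : ℝ) : ℝ :=
  ∑' n : ℕ, (-z) ^ n / ((n.factorial : ℝ) * Real.Gamma (-α * n + 1 - α))

/-- `T_α(t) η = ∫_0^∞ M_α(r) T(t^α r) η dr` for `α < 1`; for `α = 1`, where `M_1` is the Dirac
mass at `1`, `T_1(t) = T(t)`. -/
def opT {X : Type*} [NormedAddCommGroup X] [NormedSpace ℝ X]
    (T : ℝ → X →L[ℝ] X) (α t : ℝ) (η : X) : X :=
  if α = 1 then T t η else ∫ ρ in Ioi (0 : ℝ), mainardi α ρ • T (t ^ α * ρ) η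

/-- `S_α(t) η = ∫_0^∞ α r M_α(r) T(t^α r) η dr` for `α < 1`; for `α = 1`, where `M_1` is the Dirac
mass at `1`, `S_1(t) = T(t)`. -/
def opS {X : Type*} [NormedAddCommGroup X] [NormedSpace ℝ X]
    (T : ℝ → X →L[ℝ] X) (α t : ℝ) (η : X) : X :=
  if α = 1 then T t η else ∫ ρ in Ioi (0 : ℝ), (α * ρ * mainardi α ρ) • T (t ^ α * ρ) η

/-! ### Fractional Brownian motion -/

/-- One-dimensional standard fractional Brownian motion of Hurst index `H`: a centered Gaussian
process with (a.s.) continuous paths and `E[β(t) β(s)] = (t^{2H} + s^{2H} - |t - s|^{2H}) / 2`. -/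
structure IsFBM {Ω : Type*} [MeasurableSpace Ω] (H : ℝ) (β : ℝ≥0 → Ω → ℝ) (P : Measure Ω) :
    Prop where
  measurable : ∀ t, Measurable (β t)
  gaussian : IsGaussianProcess β P
  centered : ∀ t, ∫ ω, β t ω ∂P = 0
  cov : ∀ t s : ℝ≥0, ∫ ω, β t ω * β s ω ∂P =
    ((t : ℝ) ^ (2 * H) + (s : ℝ) ^ (2 * H) - |(t : ℝ) - s| ^ (2 * H)) / 2
  cont : ∀ᵐ ω ∂P, Continuous fun t => β t ω

/-- `B` is the `Y`-valued `Q`-fractional Brownian motion `B(t) = ∑ₙ √λₙ βₙ(t) eₙ` with mutually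
independent one-dimensional standard fractional Brownian motions `βₙ`. The operator `Q` has the
complete orthonormal system `eₙ` of eigenvectors, with eigenvalues `λₙ ≥ 0` and finite trace. -/
structure IsQFBM {Ω Y ι : Type*} [MeasurableSpace Ω] [NormedAddCommGroup Y]
    [InnerProductSpace ℝ Y] (H : ℝ) (Q : Y →L[ℝ] Y) (e : HilbertBasis ι ℝ Y) (lam : ι → ℝ)
    (β : ι → ℝ≥0 → Ω → ℝ) (B : ℝ≥0 → Ω → Y) (P : Measure Ω) : Prop where
  eigen : ∀ n, Q (e n) = lam n • e n
  nonneg : ∀ n, 0 ≤ lam n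
  trace : Summable lam
  fbm : ∀ n, IsFBM H (β n) P
  indep : iIndepFun (fun n ω (t : ℝ≥0) => β n t ω) P
  expansion : ∀ t, ∀ᵐ ω ∂P, HasSum (fun n => (Real.sqrt (lam n) * β n t ω) • e n) (B t ω)

/-- The norm `‖φ‖_{L₂⁰} = (∑ₙ ‖√λₙ φ eₙ‖²)^{1/2}` of a `Q`-Hilbert-Schmidt operator. -/
def qHSNorm {X Y ι : Type*} [NormedAddCommGroup X] [NormedSpace ℝ X] [NormedAddCommGroup Y]
    [InnerProductSpace ℝ Y] (e : HilbertBasis ι ℝ Y) (lam : ι → ℝ) (φ : Y →L[ℝ] X) : ℝ≥0∞ :=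
  (∑' n, ‖Real.sqrt (lam n) • φ (e n)‖ₑ ^ 2) ^ (1 / 2 : ℝ)

/-! ### Wiener integrals with respect to fractional Brownian motion -/

/-- The squared norm `H(2H-1) ∫_0^t ∫_0^t ‖ψ(u)‖ ‖ψ(v)‖ |u - v|^{2H-2} du dv` of `|𝓗|`
on `[0,t]`. -/
def absHNormSq {X : Type*} [NormedAddCommGroup X] (H t : ℝ) (ψ : ℝ → X) : ℝ≥0∞ :=
  ENNReal.ofReal (H * (2 * H - 1)) *
    ∫⁻ u in Icc 0 t, ∫⁻ v in Icc 0 t,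
      ‖ψ u‖ₑ * ‖ψ v‖ₑ * ENNReal.ofReal (|u - v| ^ (2 * H - 2))

/-- An `X`-valued step function `∑ᵢ 1_{[0,τᵢ]} cᵢ`. -/
structure StepFun (X : Type*) where
  n : ℕ
  τ : Fin n → ℝ≥0
  c : Fin n → X

/-- The function on the line that a step function represents. -/
def StepFun.toFun {X : Type*} [NormedAddCommGroup X] (σ : StepFun X) (s : ℝ) : X :=
  ∑ i, (Icc (0 : ℝ) (σ.τ i)).indicator (fun _ => σ.c i) s

/-- The elementary integral `∑ᵢ β(τᵢ) cᵢ` of a step function. -/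
def StepFun.integral {X Ω : Type*} [NormedAddCommGroup X] [NormedSpace ℝ X] (σ : StepFun X)
    (β : ℝ≥0 → Ω → ℝ) (ω : Ω) : X :=
  ∑ i, β (σ.τ i) ω • σ.c i

/-- `I = ∫_0^t ψ(s) dβ(s)` (Wiener integral of a deterministic `X`-valued function with respect to
a fractional Brownian motion of index `H > 1/2`): `I` is the `L²`-limit of the elementary integrals
of step functions on `[0,t]` that converge to `ψ` in `|𝓗|`. -/
def IsWienerIntegral {X Ω : Type*} [NormedAddCommGroup X] [NormedSpace ℝ X] [MeasurableSpace Ω]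
    {P : Measure Ω} (H : ℝ) (β : ℝ≥0 → Ω → ℝ) (t : ℝ) (ψ : ℝ → X) (I : Lp X 2 P) : Prop :=
  AEStronglyMeasurable ψ (volume.restrict (Icc 0 t)) ∧
  ∃ σ : ℕ → StepFun X,
    (∀ k i, ((σ k).τ i : ℝ) ≤ t) ∧
    Tendsto (fun k => absHNormSq H t (fun s => (σ k).toFun s - ψ s)) atTop (𝓝 0) ∧
    Tendsto (fun k => eLpNorm (fun ω => (σ k).integral β ω - I ω) 2 P) atTop (𝓝 0)

/-- `I = ∫_0^t Φ(s) dB(s) = ∑ₙ ∫_0^t √λₙ Φ(s) eₙ dβₙ(s)`, the series converging in `L²(Ω; X)`. -/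
def IsStochIntegral {X Y Ω ι : Type*} [NormedAddCommGroup X] [NormedSpace ℝ X]
    [NormedAddCommGroup Y] [InnerProductSpace ℝ Y] [MeasurableSpace Ω] {P : Measure Ω}
    (H : ℝ) (e : HilbertBasis ι ℝ Y) (lam : ι → ℝ) (β : ι → ℝ≥0 → Ω → ℝ)
    (t : ℝ) (Φ : ℝ → Y → X) (I : Lp X 2 P) : Prop :=
  ∃ J : ι → Lp X 2 P,
    (∀ n, IsWienerIntegral H (β n) t (fun s => Real.sqrt (lam n) • Φ s (e n)) (J n)) ∧
    HasSum J I

/-! ### The delay term -/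

/-- The segment `x_s ∈ C([-r,0]; X)`, `x_s(θ) = x(s + θ)`, of `x ∈ C([-r,b]; X)`; for `s ∈ [0,b]`
the point `s + θ` lies in `[-r,b]` and the projection does nothing. -/
def segment {X : Type*} [TopologicalSpace X] {r b : ℝ} (hrb : -r ≤ b) (x : C(Icc (-r) b, X))
    (s : ℝ) : C(Icc (-r) 0, X) where
  toFun θ := x (projIcc (-r) b hrb (s + θ))
  continuous_toFun := by fun_prop

/-- `g = f(·, u_·)` for `u ∈ L²(-r,b; X)`: the pair `(u, g)` lies in the closure in
`L²(-r,b; X) × L²(0,b; X)` of the graph of the map `z ↦ f(·, z_·)`, `z ∈ C([-r,b]; X)`. When this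
map is Lipschitz for the `L²` norms, this is its unique continuous extension to `L²(-r,b; X)`. -/
def IsDelayTerm {X : Type*} [NormedAddCommGroup X] {r b : ℝ} (hrb : -r ≤ b)
    (f : ℝ → C(Icc (-r) 0, X) → X) (u g : ℝ → X) : Prop :=
  MemLp u 2 (volume.restrict (Icc (-r) b)) ∧ MemLp g 2 (volume.restrict (Icc 0 b)) ∧
  ∃ z : ℕ → C(Icc (-r) b, X),
    Tendsto (fun k => eLpNorm (fun s => z k (projIcc (-r) b hrb s) - u s) 2
      (volume.restrict (Icc (-r) b))) atTop (𝓝 0) ∧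
    Tendsto (fun k => eLpNorm (fun s => f s (segment hrb (z k) s) - g s) 2
      (volume.restrict (Icc 0 b))) atTop (𝓝 0)

/-! ### Mild solutions -/

/-- `x ∈ C([-r,b]; L²(Ω; X))` is a mild solution: `x = φ` on `[-r,0]`, and for all `t ∈ [0,b]`,
almost surely,
`x(t) = T_α(t) φ(0) + ∫_0^t (t-s)^{α-1} S_α(t-s) f(s,x_s) ds`
`+ ∫_0^t (t-s)^{α-1} S_α(t-s) h(s) dB(s)`.
The paths of `x` need not be continuous; `f(s,x_s)` is formed along the paths of a jointly
measurable modification `ξ` of `x`, whose paths are a.s. in `L²(-r,b; X)`. -/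
def IsMildSolution {X Y Ω ι : Type*} [NormedAddCommGroup X] [NormedSpace ℝ X]
    [NormedAddCommGroup Y] [InnerProductSpace ℝ Y] [MeasurableSpace Ω] {P : Measure Ω}
    {r b : ℝ} (hr : 0 < r) (hb : 0 < b) (α H : ℝ) (T : ℝ → X →L[ℝ] X)
    (f : ℝ → C(Icc (-r) 0, X) → X) (h : ℝ → Y →L[ℝ] X)
    (e : HilbertBasis ι ℝ Y) (lam : ι → ℝ) (β : ι → ℝ≥0 → Ω → ℝ)
    (φ : C(Icc (-r) 0, Lp X 2 P)) (x : C(Icc (-r) b, Lp X 2 P)) : Prop :=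
  (∀ (t : ℝ) (ht : t ∈ Icc (-r) 0), x ⟨t, ht.1, ht.2.trans hb.le⟩ = φ ⟨t, ht⟩) ∧
  ∃ (ξ : ℝ → Ω → X) (g : Ω → ℝ → X),
    StronglyMeasurable (Function.uncurry ξ) ∧
    (∀ s : Icc (-r) b, ξ s =ᵐ[P] x s) ∧
    (∀ᵐ ω ∂P, IsDelayTerm (by linarith : -r ≤ b) f (fun s => ξ s ω) (g ω)) ∧
    ∀ (t : ℝ) (ht : t ∈ Icc 0 b), ∃ I : Lp X 2 P,
      IsStochIntegral H e lam β t (fun s y => (t - s) ^ (α - 1) • opS T α (t - s) (h s y)) I ∧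
      ∀ᵐ ω ∂P, x ⟨t, by linarith [ht.1], ht.2⟩ ω =
        opT T α t (φ ⟨0, by linarith, le_rfl⟩ ω)
          + (∫ s in (0 : ℝ)..t, (t - s) ^ (α - 1) • opS T α (t - s) (g ω s))
          + I ω

end FracDelay

end

noncomputable section

namespace FracDelay


/-! ### Mainardi's function: contour representation, decay and total mass -/

/-! The mild formula is a fixed point equation for a map `Ψ` on C([-r,b]; L²(Ω;X)), and this map is
of Volterra type. The initial and noise terms do not depend on the unknown, so only the drift
distinguishes `Ψ x` from `Ψ y`. Since α > 1/2, the kernel (t-s)^(α-1) is square integrable;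
Cauchy–Schwarz and the integrated Lipschitz condition give E‖Ψx(t) - Ψy(t)‖² ≤ C ∫_{-r}^t E‖x(s) -
y(s)‖² ds. Iterating yields the factor (C(t+r))^n / n!, so some iterate of `Ψ` is a contraction
(`existsUnique_fixedPoint_of_volterra`). The work lies in showing that `Ψ` is well defined.

The operators T_α and S_α are bounded and strongly continuous on [0,b] because Mainardi's function
beats the exponential growth of the semigroup (`exists_mainardi_le`), and T_α(0) is the identity
because the function has mass one (`integral_mainardi`). Both facts come from a Hankel
representation: M_α(z) is 1/π times the imaginary part of the integral of σ^(α-1) exp(σ - zσ^α)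
along a ray of angle ψ with π/2 < ψ and αψ < π/2, and that imaginary part does not change when the
starting point of the ray moves along the positive axis.

For the noise, the |𝓗| norm is dominated by the L² norm (`exists_absHNormSq_le`), so square
integrable integrands suffice. Independence makes the terms of the series orthogonal, and Hölder's
inequality with p > 1/(2α-1) absorbs the singular kernel; this gives a mean square continuous
stochastic convolution (`exists_stochConv`). Wiener integrals are unique
(`IsFBM.isWienerIntegral_unique`), so the noise term in the definition of a mild solution is
determined.

The delay map extends to a Lipschitz map between L² spaces. Composing it with the paths of a jointly
measurable modification, seen as a random element of L², gives a drift integrand in L²(Ω; L²(0,b;X))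
that does not depend on the modification (`IsModification.delay_ae_eq`). -/

lemma integrableOn_rpow_mul_exp_neg {x c : ℝ} (hx : 0 < x) (hc : 0 < c) :
    IntegrableOn (fun u : ℝ => u ^ (x - 1) * Real.exp (-c * u)) (Ioi 0) := by
  have := integrableOn_rpow_mul_exp_neg_mul_rpow (p := 1) (s := x - 1) (by linarith) one_pos hc
  simpa using this

lemma norm_exp_ofReal_mul_I_mul (ψ x : ℝ) :
    ‖Complex.exp (ψ * x * Complex.I)‖ = 1 := by
  rw [← Complex.ofReal_mul]; exact Complex.norm_exp_ofReal_mul_I _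

/-- The integrand of the Gamma integral along the ray of argument `ψ - π`. -/
def rayGamma (x ψ u : ℝ) : ℂ :=
  Complex.exp (ψ * x * Complex.I) * (u ^ (x - 1) : ℝ) *
    Complex.exp (u * Complex.exp (ψ * Complex.I))

lemma norm_rayGamma (x ψ : ℝ) {u : ℝ} (hu : 0 < u) :
    ‖rayGamma x ψ u‖ = u ^ (x - 1) * Real.exp (Real.cos ψ * u) := by
  rw [rayGamma, norm_mul, norm_mul, norm_exp_ofReal_mul_I_mul, Complex.norm_real,
    Complex.norm_exp, Complex.re_ofReal_mul, Complex.exp_ofReal_mul_I_re, Real.norm_of_nonneg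
    (by positivity)]
  ring_nf

lemma measurable_rayGamma (x ψ : ℝ) : Measurable (rayGamma x ψ) := by
  unfold rayGamma; fun_prop

lemma hasDerivAt_rayGamma (x ψ u : ℝ) :
    HasDerivAt (fun ψ => rayGamma x ψ u)
      (rayGamma x ψ u * (Complex.I * (x + u * Complex.exp (ψ * Complex.I)))) ψ := by
  unfold rayGamma
  have h0 : HasDerivAt (fun ψ : ℝ => (ψ : ℂ)) 1 ψ := Complex.ofRealCLM.hasDerivAt
  have h1 := ((h0.mul_const (x : ℂ)).mul_const Complex.I).cexp
  have h2 := (((h0.mul_const Complex.I).cexp).const_mul (u : ℂ)).cexp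
  refine ((h1.mul_const ((u ^ (x - 1) : ℝ) : ℂ)).fun_mul h2).congr_deriv ?_
  ring

/-- The derivative equals the one in `hasDerivAt_rayGamma`: this is the Cauchy–Riemann equation in
polar coordinates. The angular derivative of the integrand is therefore an exact derivative in u. -/
lemma hasDerivAt_rayGamma_primitive (x ψ : ℝ) {u : ℝ} (hu : 0 < u) :
    HasDerivAt (fun u : ℝ => Complex.I * (u : ℂ) * rayGamma x ψ u)
      (rayGamma x ψ u * (Complex.I * (x + u * Complex.exp (ψ * Complex.I)))) u := by
  unfold rayGamma
  have h0 : HasDerivAt (fun u : ℝ => (u : ℂ)) 1 u := Complex.ofRealCLM.hasDerivAt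
  have h1 : HasDerivAt (fun u : ℝ => ((u ^ (x - 1) : ℝ) : ℂ)) (((x - 1) * u ^ (x - 2) : ℝ)) u := by
    have := Real.hasDerivAt_rpow_const (x := u) (p := x - 1) (Or.inl hu.ne')
    rw [show x - 1 - 1 = x - 2 by ring] at this
    exact this.ofReal_comp
  have h2 := (h0.mul_const (Complex.exp (ψ * Complex.I))).cexp
  have e : u ^ (x - 1) = u ^ (x - 2) * u := by
    rw [← Real.rpow_add_one hu.ne']; ring_nf
  refine ((h0.const_mul Complex.I).fun_mul
    ((h1.const_mul (Complex.exp (ψ * x * Complex.I))).fun_mul h2)).congr_deriv ?_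
  rw [e]; push_cast; ring

lemma cos_neg_of_mem {ψ : ℝ} (h1 : Real.pi / 2 < ψ) (h2 : ψ ≤ Real.pi) : Real.cos ψ < 0 :=
  Real.cos_neg_of_pi_div_two_lt_of_lt h1 (by linarith [Real.pi_pos])

lemma integrable_rayGamma {x ψ : ℝ} (hx : 0 < x) (hψ : Real.cos ψ < 0) :
    IntegrableOn (rayGamma x ψ) (Ioi 0) := by
  have := integrableOn_rpow_mul_exp_neg hx (c := -Real.cos ψ) (by linarith)
  refine Integrable.mono' this (measurable_rayGamma x ψ).aestronglyMeasurable ?_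
  filter_upwards [ae_restrict_mem measurableSet_Ioi] with u hu
  rw [norm_rayGamma x ψ hu]; simp

/-- The bound depends on ψ only through c, so it dominates the derivative uniformly for angles near
a given one. -/
lemma norm_deriv_rayGamma_le {x ψ c u : ℝ} (hx : 0 < x) (hψ : Real.cos ψ ≤ -c) (hu : 0 < u) :
    ‖rayGamma x ψ u * (Complex.I * (x + u * Complex.exp (ψ * Complex.I)))‖ ≤
      x * (u ^ (x - 1) * Real.exp (-c * u)) + u ^ (x + 1 - 1) * Real.exp (-c * u) := by
  rw [norm_mul, norm_mul, Complex.norm_I, one_mul, norm_rayGamma x ψ hu]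
  have h1 : ‖(x : ℂ) + u * Complex.exp (ψ * Complex.I)‖ ≤ x + u := by
    refine (norm_add_le _ _).trans ?_
    rw [norm_mul, Complex.norm_exp_ofReal_mul_I, Complex.norm_real, Complex.norm_real,
      Real.norm_of_nonneg hx.le, Real.norm_of_nonneg hu.le, mul_one]
  have h2 : Real.exp (Real.cos ψ * u) ≤ Real.exp (-c * u) := by gcongr
  have e : u ^ (x + 1 - 1) = u ^ (x - 1) * u := by
    rw [← Real.rpow_add_one hu.ne']; ring_nf
  rw [e]
  calc _ ≤ u ^ (x - 1) * Real.exp (-c * u) * (x + u) := by gcongr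
    _ = _ := by ring

/-- Only boundary terms of the primitive remain. They vanish at 0 because x > 0 and at infinity
because cos ψ < 0. -/
lemma integral_deriv_rayGamma {x ψ : ℝ} (hx : 0 < x) (hψ : Real.cos ψ < 0) :
    ∫ u in Ioi (0:ℝ), rayGamma x ψ u * (Complex.I * (x + u * Complex.exp (ψ * Complex.I))) = 0 := by
  have hn : ∀ u : ℝ, 0 < u → ‖Complex.I * (u : ℂ) * rayGamma x ψ u‖
      = u ^ x * Real.exp (-(-Real.cos ψ) * u) := by
    intro u hu
    rw [norm_mul, norm_mul, Complex.norm_I, norm_rayGamma x ψ hu, Complex.norm_real,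
      Real.norm_of_nonneg hu.le, one_mul, neg_neg, ← mul_assoc]
    congr 1
    rw [mul_comm, ← Real.rpow_add_one hu.ne']; ring_nf
  have h := integral_Ioi_of_hasDerivAt_of_tendsto (a := 0) (m := 0)
    (f := fun u : ℝ => Complex.I * (u : ℂ) * rayGamma x ψ u) ?_
    (fun u hu => hasDerivAt_rayGamma_primitive x ψ hu) ?_ ?_
  · rw [h]; simp
  · rw [← continuousWithinAt_Ioi_iff_Ici]
    rw [ContinuousWithinAt, tendsto_iff_norm_sub_tendsto_zero]
    have : Tendsto (fun u : ℝ => u ^ x * Real.exp (-(-Real.cos ψ) * u)) (𝓝[>] 0) (𝓝 0) := by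
      have : ContinuousAt (fun u : ℝ => u ^ x * Real.exp (-(-Real.cos ψ) * u)) 0 :=
        (Real.continuousAt_rpow_const _ _ (Or.inr hx.le)).mul (by fun_prop)
      have := this.tendsto.mono_left (nhdsWithin_le_nhds (s := Ioi 0))
      simpa [Real.zero_rpow hx.ne'] using this
    refine this.congr' ?_
    filter_upwards [self_mem_nhdsWithin] with u hu
    rw [← hn u hu]; simp
  · refine Integrable.mono' (((integrableOn_rpow_mul_exp_neg hx (c := -Real.cos ψ)
      (by linarith)).const_mul x).add (integrableOn_rpow_mul_exp_neg (x := x + 1) (by linarith)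
      (c := -Real.cos ψ) (by linarith))) ?_ ?_
    · have := measurable_rayGamma x ψ
      exact Measurable.aestronglyMeasurable (by fun_prop)
    · filter_upwards [ae_restrict_mem measurableSet_Ioi] with u hu
      exact norm_deriv_rayGamma_le hx (by simp) hu
  · rw [tendsto_zero_iff_norm_tendsto_zero]
    refine (tendsto_rpow_mul_exp_neg_mul_atTop_nhds_zero x (-Real.cos ψ) (by linarith)).congr' ?_
    filter_upwards [eventually_gt_atTop 0] with u hu
    rw [hn u hu]

lemma hasDerivAt_integral_rayGamma {x ψ : ℝ} (hx : 0 < x) (hψ : Real.cos ψ < 0) :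
    HasDerivAt (fun ψ => ∫ u in Ioi (0:ℝ), rayGamma x ψ u) 0 ψ := by
  rw [← integral_deriv_rayGamma hx hψ]
  set c := -Real.cos ψ / 2 with hc
  have hc0 : 0 < c := by rw [hc]; linarith
  have hs : {y : ℝ | Real.cos y < -c} ∈ 𝓝 ψ :=
    (isOpen_lt Real.continuous_cos continuous_const).mem_nhds (by simp [hc]; linarith)
  refine (hasDerivAt_integral_of_dominated_loc_of_deriv_le hs (F' := fun ψ u =>
      rayGamma x ψ u * (Complex.I * (x + u * Complex.exp (ψ * Complex.I)))) (bound := fun u =>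
      x * (u ^ (x - 1) * Real.exp (-c * u)) + u ^ (x + 1 - 1) * Real.exp (-c * u)) ?_
      (integrable_rayGamma hx hψ) ?_ ?_ ?_ ?_).2
  · exact Eventually.of_forall fun y => (measurable_rayGamma x y).aestronglyMeasurable
  · have := measurable_rayGamma x ψ
    exact Measurable.aestronglyMeasurable (by fun_prop)
  · filter_upwards [ae_restrict_mem measurableSet_Ioi] with u hu y hy
    exact norm_deriv_rayGamma_le hx (le_of_lt hy) hu
  · exact ((integrableOn_rpow_mul_exp_neg hx hc0).const_mul x).add
      (integrableOn_rpow_mul_exp_neg (by linarith) hc0)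
  · exact Eventually.of_forall fun u y _ => hasDerivAt_rayGamma x y u

/-- The Gamma integral may be rotated to any ray in the right half-plane. -/
lemma integral_rayGamma {x ψ : ℝ} (hx : 0 < x) (h1 : Real.pi / 2 < ψ) (h2 : ψ ≤ Real.pi) :
    ∫ u in Ioi (0:ℝ), rayGamma x ψ u = Complex.exp (Real.pi * x * Complex.I) * Real.Gamma x := by
  have hd : ∀ y ∈ Icc ψ Real.pi,
      HasDerivAt (fun ψ => ∫ u in Ioi (0:ℝ), rayGamma x ψ u) 0 y := fun y hy =>
    hasDerivAt_integral_rayGamma hx (cos_neg_of_mem (h1.trans_le hy.1) hy.2)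
  have := constant_of_has_deriv_right_zero
    (fun y hy => (hd y hy).continuousAt.continuousWithinAt)
    (fun y hy => (hd y ⟨hy.1, hy.2.le⟩).hasDerivWithinAt) Real.pi ⟨h2, le_rfl⟩
  -- At ψ = π the exponential factor is exp(-u), so up to a constant phase the integral is Euler's.
  rw [← this, Real.Gamma_eq_integral hx, ← integral_complex_ofReal, ← integral_const_mul]
  refine setIntegral_congr_fun measurableSet_Ioi fun u _ => ?_
  simp only [rayGamma, Complex.exp_pi_mul_I]
  push_cast
  ring_nf

/-! ### Geometry of rays in the complex plane -/

/-- The ray that starts at `a ≥ 0` in direction `exp (i ψ)`. -/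
def ray (ψ a u : ℝ) : ℂ := a + u * Complex.exp (ψ * Complex.I)

lemma ray_re (ψ a u : ℝ) : (ray ψ a u).re = a + u * Real.cos ψ := by
  rw [ray, Complex.add_re, Complex.re_ofReal_mul, Complex.exp_ofReal_mul_I_re, Complex.ofReal_re]

lemma ray_im (ψ a u : ℝ) : (ray ψ a u).im = u * Real.sin ψ := by
  rw [ray, Complex.add_im, Complex.im_ofReal_mul, Complex.exp_ofReal_mul_I_im, Complex.ofReal_im,
    zero_add]

lemma sin_pos_of_mem {ψ : ℝ} (hψ : ψ ∈ Ioo (Real.pi / 2) Real.pi) : 0 < Real.sin ψ :=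
  Real.sin_pos_of_pos_of_lt_pi (by linarith [hψ.1, Real.pi_pos]) hψ.2

lemma ray_mem_slitPlane {ψ a u : ℝ} (hψ : ψ ∈ Ioo (Real.pi / 2) Real.pi) (hu : 0 ≤ u)
    (hau : 0 < a ∨ 0 < u) : ray ψ a u ∈ Complex.slitPlane := by
  rw [Complex.mem_slitPlane_iff, ray_re, ray_im]
  rcases hu.eq_or_lt with rfl | hu
  · left; simpa using hau
  · right; exact (mul_pos hu (sin_pos_of_mem hψ)).ne'

lemma le_norm_ray_right {ψ : ℝ} (a u : ℝ) : u * Real.sin ψ ≤ ‖ray ψ a u‖ := by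
  rw [← ray_im ψ a u]; exact (le_abs_self _).trans (Complex.abs_im_le_norm _)

/-- After rotation by -ψ the ray becomes horizontal at height -a sin ψ. This gives its distance from
the origin in `le_norm_ray_left` and the bound on its argument in `arg_ray_mem`. -/
lemma ray_rotate_im (ψ a u : ℝ) :
    (ray ψ a u).im * Real.cos ψ - (ray ψ a u).re * Real.sin ψ = - (a * Real.sin ψ) := by
  rw [ray_re, ray_im]; ring

lemma le_norm_ray_left {ψ : ℝ} (a u : ℝ) : a * Real.sin ψ ≤ ‖ray ψ a u‖ := by
  have h := ray_rotate_im ψ a u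
  have h1 : (ray ψ a u).re ^ 2 + (ray ψ a u).im ^ 2 = ‖ray ψ a u‖ ^ 2 := by
    rw [Complex.sq_norm, Complex.normSq_apply]; ring
  have h2 := Real.sin_sq_add_cos_sq ψ
  refine (le_abs_self _).trans (abs_le_of_sq_le_sq ?_ (norm_nonneg _))
  rw [← h1]
  have h3 : (a * Real.sin ψ) ^ 2 =
      ((ray ψ a u).im * Real.cos ψ - (ray ψ a u).re * Real.sin ψ) ^ 2 := by rw [h]; ring
  have h4 : (ray ψ a u).re ^ 2 + (ray ψ a u).im ^ 2 =
      ((ray ψ a u).im * Real.cos ψ - (ray ψ a u).re * Real.sin ψ) ^ 2 +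
      ((ray ψ a u).re * Real.cos ψ + (ray ψ a u).im * Real.sin ψ) ^ 2 := by
    linear_combination -((ray ψ a u).re ^ 2 + (ray ψ a u).im ^ 2) * h2
  rw [h3, h4]
  exact le_add_of_nonneg_right (sq_nonneg _)

lemma arg_ray_mem {ψ a u : ℝ} (hψ : ψ ∈ Ioo (Real.pi / 2) Real.pi) (ha : 0 ≤ a) (hu : 0 ≤ u)
    (hau : 0 < a ∨ 0 < u) : (ray ψ a u).arg ∈ Icc 0 ψ := by
  have hs := sin_pos_of_mem hψ
  have h0 : 0 ≤ (ray ψ a u).arg := Complex.arg_nonneg_iff.2 (by rw [ray_im]; positivity)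
  have hne : ray ψ a u ≠ 0 := Complex.slitPlane_ne_zero (ray_mem_slitPlane hψ hu hau)
  refine ⟨h0, ?_⟩
  by_contra! hlt
  -- An argument above ψ would make the rotated imaginary part ‖ray‖ · sin(arg - ψ) positive,
  -- whereas it equals -a sin ψ ≤ 0.
  have hsin : 0 < Real.sin ((ray ψ a u).arg - ψ) :=
    Real.sin_pos_of_pos_of_lt_pi (by linarith) (by
      linarith [Complex.arg_le_pi (ray ψ a u), hψ.1, Real.pi_pos])
  have h := ray_rotate_im ψ a u
  rw [← Complex.norm_mul_cos_arg (ray ψ a u), ← Complex.norm_mul_sin_arg (ray ψ a u)] at h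
  rw [Real.sin_sub] at hsin
  have h3 : 0 < ‖ray ψ a u‖ := norm_pos_iff.2 hne
  nlinarith [mul_pos h3 hsin, mul_nonneg ha hs.le]

/-- The argument of σ^α lies in [0, αψ], where the cosine decreases. As αψ < π/2 the bound is
positive, and exp(-zσ^α) decays in z. -/
lemma re_cpow_ray_ge {α ψ a u : ℝ} (hα : 0 < α) (hψ : ψ ∈ Ioo (Real.pi / 2) Real.pi)
    (hαψ : α * ψ < Real.pi / 2) (ha : 0 ≤ a) (hu : 0 ≤ u) (hau : 0 < a ∨ 0 < u) :
    Real.cos (α * ψ) * ‖ray ψ a u‖ ^ α ≤ (ray ψ a u ^ (α : ℂ)).re := by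
  have hne : ray ψ a u ≠ 0 := Complex.slitPlane_ne_zero (ray_mem_slitPlane hψ hu hau)
  have harg := arg_ray_mem hψ ha hu hau
  have h3 : 0 < ‖ray ψ a u‖ := norm_pos_iff.2 hne
  have h : (ray ψ a u ^ (α : ℂ)).re = ‖ray ψ a u‖ ^ α * Real.cos (α * (ray ψ a u).arg) := by
    rw [Complex.cpow_def_of_ne_zero hne, Complex.exp_re]
    have e1 : (Complex.log (ray ψ a u) * α).re = Real.log ‖ray ψ a u‖ * α := by
      simp [Complex.log_re]
    have e2 : (Complex.log (ray ψ a u) * α).im = α * (ray ψ a u).arg := by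
      simp [Complex.log_im, mul_comm]
    rw [e1, e2, Real.rpow_def_of_pos h3]
  rw [h, mul_comm]
  gcongr
  refine Real.cos_le_cos_of_nonneg_of_le_pi (mul_nonneg hα.le harg.1)
    (by linarith [Real.pi_pos]) ?_
  gcongr
  exact harg.2

lemma cos_mul_pos {α ψ : ℝ} (hα : 0 < α) (hψ : ψ ∈ Ioo (Real.pi / 2) Real.pi)
    (hαψ : α * ψ < Real.pi / 2) : 0 < Real.cos (α * ψ) :=
  Real.cos_pos_of_mem_Ioo ⟨by nlinarith [hψ.1, Real.pi_pos, mul_pos hα (Real.pi_pos.trans_le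
    (by linarith [hψ.1, hψ.2] : Real.pi ≤ 2 * ψ))], hαψ⟩

/-! ### The Wright integrand and its integrals along rays -/

/-- The integrand `σ ^ (-s) * exp (σ - z σ ^ α)` of the Wright function. -/
def wrightFun (α s z : ℝ) (σ : ℂ) : ℂ :=
  Complex.exp (σ - z * σ ^ (α : ℂ)) * σ ^ (-s : ℂ)

/-- The parameter m is any positive lower bound of |σ|: a sin ψ gives decay in z uniformly in u,
while u sin ψ still works when the ray starts at 0. -/
lemma norm_wrightFun_le {α ψ a u s z m : ℝ} (hα : 0 < α) (hψ : ψ ∈ Ioo (Real.pi / 2) Real.pi)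
    (hαψ : α * ψ < Real.pi / 2) (ha : 0 ≤ a) (hu : 0 ≤ u) (hs : 0 ≤ s) (hz : 0 ≤ z)
    (hm : 0 < m) (hmr : m ≤ ‖ray ψ a u‖) (hau : 0 < a ∨ 0 < u) :
    ‖wrightFun α s z (ray ψ a u)‖ ≤
      Real.exp a * Real.exp (-(z * (Real.cos (α * ψ) * m ^ α))) * m ^ (-s) *
        Real.exp (-(-Real.cos ψ) * u) := by
  have hc := cos_mul_pos hα hψ hαψ
  have h1 := re_cpow_ray_ge hα hψ hαψ ha hu hau
  have h2 : Real.cos (α * ψ) * m ^ α ≤ Real.cos (α * ψ) * ‖ray ψ a u‖ ^ α := by gcongr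
  rw [wrightFun, norm_mul, Complex.norm_exp, Complex.sub_re, Complex.re_ofReal_mul, ray_re,
    ← Complex.ofReal_neg, Complex.norm_cpow_real]
  have h3 : ‖ray ψ a u‖ ^ (-s) ≤ m ^ (-s) :=
    Real.rpow_le_rpow_of_nonpos hm hmr (by linarith)
  have h4 : Real.exp (a + u * Real.cos ψ - z * (ray ψ a u ^ (α : ℂ)).re) ≤
      Real.exp a * Real.exp (-(z * (Real.cos (α * ψ) * m ^ α))) * Real.exp (-(-Real.cos ψ) * u) := by
    rw [← Real.exp_add, ← Real.exp_add]
    refine Real.exp_le_exp.2 ?_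
    nlinarith [mul_le_mul_of_nonneg_left (h2.trans h1) hz]
  calc _ ≤ _ := mul_le_mul h4 h3 (by positivity) (by positivity)
    _ = _ := by ring

lemma hasDerivAt_wrightFun {α s z : ℝ} {σ : ℂ} (hσ : σ ∈ Complex.slitPlane) :
    HasDerivAt (wrightFun α s z)
      (wrightFun α s z σ * (1 - z * α * σ ^ ((α : ℂ) - 1)) -
        s * wrightFun α (s + 1) z σ) σ := by
  unfold wrightFun
  have h1 : HasDerivAt (fun σ : ℂ => σ ^ (α : ℂ)) (α * σ ^ ((α : ℂ) - 1) * 1) σ :=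
    (hasDerivAt_id σ).cpow_const hσ
  have h2 : HasDerivAt (fun σ : ℂ => σ ^ (-s : ℂ)) (-s * σ ^ ((-s : ℂ) - 1) * 1) σ :=
    (hasDerivAt_id σ).cpow_const hσ
  refine ((((hasDerivAt_id σ).sub (h1.const_mul (z : ℂ))).cexp).mul h2).congr_deriv ?_
  push_cast
  rw [show (-s : ℂ) - 1 = -(s + 1) by ring]
  simp only [id, Pi.sub_apply]
  ring

lemma continuousAt_wrightFun_ray {α s z ψ a u : ℝ} (hψ : ψ ∈ Ioo (Real.pi / 2) Real.pi)
    (hu : 0 ≤ u) (hau : 0 < a ∨ 0 < u) : ContinuousAt (wrightFun α s z) (ray ψ a u) :=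
  (hasDerivAt_wrightFun (ray_mem_slitPlane hψ hu hau)).continuousAt

lemma measurable_wrightFun (α s z : ℝ) : Measurable (wrightFun α s z) := by
  unfold wrightFun; fun_prop

lemma continuous_ray (ψ a : ℝ) : Continuous (ray ψ a) := by unfold ray; fun_prop

/-- An angle beyond π/2 makes exp(σ) decay along the ray, and αψ < π/2 keeps exp(-zσ^α) bounded.
Both are possible exactly because α < 1. -/
lemma exists_angle {α : ℝ} (hα : 0 < α) (hα1 : α < 1) :
    ∃ ψ ∈ Ioo (Real.pi / 2) Real.pi, α * ψ < Real.pi / 2 := by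
  have hpi := Real.pi_pos
  obtain ⟨ψ, h1, h2⟩ := exists_between (show Real.pi / 2 < min Real.pi (Real.pi / 2 / α) by
    refine lt_min (by linarith) ?_
    rw [lt_div_iff₀ hα]; nlinarith)
  refine ⟨ψ, ⟨h1, h2.trans_le (min_le_left _ _)⟩, ?_⟩
  have := h2.trans_le (min_le_right _ _)
  rw [lt_div_iff₀ hα] at this
  linarith

/-- The Hankel-type integral of `wrightFun` along the ray from `a`. -/
def rayIntegral (α s z ψ a : ℝ) : ℂ :=
  ∫ u in Ioi (0 : ℝ), wrightFun α s z (ray ψ a u) * Complex.exp (ψ * Complex.I)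

lemma norm_mul_exp_ofReal_mul_I (w : ℂ) (ψ : ℝ) : ‖w * Complex.exp (ψ * Complex.I)‖ = ‖w‖ := by
  rw [norm_mul, Complex.norm_exp_ofReal_mul_I, mul_one]

lemma measurable_wrightFun_ray (α s z ψ a : ℝ) :
    Measurable fun u => wrightFun α s z (ray ψ a u) :=
  (measurable_wrightFun α s z).comp (continuous_ray ψ a).measurable

lemma integrableOn_wrightFun_ray {α s z ψ a : ℝ} (hα : 0 < α)
    (hψ : ψ ∈ Ioo (Real.pi / 2) Real.pi) (hαψ : α * ψ < Real.pi / 2) (ha : 0 < a)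
    (hs : 0 ≤ s) (hz : 0 ≤ z) :
    IntegrableOn (fun u => wrightFun α s z (ray ψ a u)) (Ioi 0) := by
  have hc : 0 < -Real.cos ψ := by linarith [cos_neg_of_mem hψ.1 hψ.2.le]
  refine Integrable.mono' ((exp_neg_integrableOn_Ioi 0 hc).const_mul (Real.exp a *
    Real.exp (-(z * (Real.cos (α * ψ) * (a * Real.sin ψ) ^ α))) * (a * Real.sin ψ) ^ (-s)))
    (measurable_wrightFun_ray α s z ψ a).aestronglyMeasurable ?_
  · filter_upwards [ae_restrict_mem measurableSet_Ioi] with u hu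
    exact norm_wrightFun_le hα hψ hαψ ha.le (le_of_lt hu) hs hz
      (mul_pos ha (sin_pos_of_mem hψ)) (le_norm_ray_left a u) (Or.inl ha)

/-- Continuity reaches the starting point 0 because s < 1 makes u^(-s) integrable there. -/
lemma continuousOn_rayIntegral {α s z ψ A : ℝ} (hα : 0 < α)
    (hψ : ψ ∈ Ioo (Real.pi / 2) Real.pi) (hαψ : α * ψ < Real.pi / 2)
    (hs : 0 ≤ s) (hs1 : s < 1) (hz : 0 ≤ z) :
    ContinuousOn (rayIntegral α s z ψ) (Icc 0 A) := by
  have hc : 0 < -Real.cos ψ := by linarith [cos_neg_of_mem hψ.1 hψ.2.le]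
  have hsin := sin_pos_of_mem hψ
  refine continuousOn_of_dominated (bound := fun u => Real.exp A * (Real.sin ψ) ^ (-s) *
    (u ^ (1 - s - 1) * Real.exp (-(-Real.cos ψ) * u))) ?_ ?_ ?_ ?_
  · exact fun a _ => ((measurable_wrightFun_ray α s z ψ a).mul_const _).aestronglyMeasurable
  · intro a ha
    filter_upwards [ae_restrict_mem measurableSet_Ioi] with u hu
    have hu' : 0 < u := hu
    rw [norm_mul_exp_ofReal_mul_I]
    refine (norm_wrightFun_le hα hψ hαψ ha.1 hu'.le hs hz (mul_pos hu' hsin)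
      (le_norm_ray_right a u) (Or.inr hu')).trans ?_
    have hk := cos_mul_pos hα hψ hαψ
    have e1 : Real.exp (-(z * (Real.cos (α * ψ) * (u * Real.sin ψ) ^ α))) ≤ 1 := by
      rw [Real.exp_le_one_iff]
      have : 0 ≤ z * (Real.cos (α * ψ) * (u * Real.sin ψ) ^ α) := by positivity
      linarith
    have e2 : Real.exp a ≤ Real.exp A := Real.exp_le_exp.2 ha.2
    calc _ ≤ Real.exp A * 1 * (u * Real.sin ψ) ^ (-s) * Real.exp (-(-Real.cos ψ) * u) := by
          gcongr
      _ = _ := by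
          rw [Real.mul_rpow hu'.le hsin.le, show 1 - s - 1 = -s by ring]; ring
  · exact (integrableOn_rpow_mul_exp_neg (by linarith) hc).const_mul _
  · filter_upwards [ae_restrict_mem measurableSet_Ioi] with u hu a ha
    have h1 : ContinuousAt (wrightFun α s z) (ray ψ a u) :=
      continuousAt_wrightFun_ray hψ (le_of_lt hu) (Or.inr hu)
    have h2 : ContinuousAt (fun a => ray ψ a u) a := by unfold ray; fun_prop
    exact ((ContinuousAt.comp (f := fun a => ray ψ a u) h1 h2).mul
      continuousAt_const).continuousWithinAt

lemma hasDerivAt_ray_left (ψ a u : ℝ) : HasDerivAt (fun a => ray ψ a u) 1 a := by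
  unfold ray
  simpa using (Complex.ofRealCLM.hasDerivAt (x := a)).add_const
    ((u : ℂ) * Complex.exp (ψ * Complex.I))

lemma hasDerivAt_ray_right (ψ a u : ℝ) :
    HasDerivAt (fun u => ray ψ a u) (Complex.exp (ψ * Complex.I)) u := by
  unfold ray
  simpa using ((Complex.ofRealCLM.hasDerivAt (x := u)).mul_const
    (Complex.exp (ψ * Complex.I))).const_add (a : ℂ)

/-- The derivative of `wrightFun`. -/
def wrightDeriv (α s z : ℝ) (σ : ℂ) : ℂ :=
  wrightFun α s z σ * (1 - z * α * σ ^ ((α : ℂ) - 1)) - s * wrightFun α (s + 1) z σ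

lemma norm_wrightDeriv_ray_le {α ψ a u s z m : ℝ} (hα : 0 < α) (hα1 : α < 1)
    (hψ : ψ ∈ Ioo (Real.pi / 2) Real.pi)
    (hαψ : α * ψ < Real.pi / 2) (ha : 0 ≤ a) (hu : 0 ≤ u) (hs : 0 ≤ s) (hz : 0 ≤ z)
    (hm : 0 < m) (hmr : m ≤ ‖ray ψ a u‖) (hau : 0 < a ∨ 0 < u) :
    ‖wrightDeriv α s z (ray ψ a u)‖ ≤
      Real.exp a * (m ^ (-s) * (1 + z * α * m ^ (α - 1)) + s * m ^ (-(s + 1))) *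
        Real.exp (-(-Real.cos ψ) * u) := by
  have hk := cos_mul_pos hα hψ hαψ
  have e1 : Real.exp (-(z * (Real.cos (α * ψ) * m ^ α))) ≤ 1 := by
    rw [Real.exp_le_one_iff]
    have : 0 ≤ z * (Real.cos (α * ψ) * m ^ α) := by positivity
    linarith
  have key : ∀ s : ℝ, 0 ≤ s → ‖wrightFun α s z (ray ψ a u)‖ ≤
      Real.exp a * m ^ (-s) * Real.exp (-(-Real.cos ψ) * u) := by
    intro s hs
    refine (norm_wrightFun_le hα hψ hαψ ha hu hs hz hm hmr hau).trans ?_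
    calc _ ≤ Real.exp a * 1 * m ^ (-s) * Real.exp (-(-Real.cos ψ) * u) := by gcongr
      _ = _ := by ring
  have h2 : ‖(1 : ℂ) - z * α * ray ψ a u ^ ((α : ℂ) - 1)‖ ≤ 1 + z * α * m ^ (α - 1) := by
    refine (norm_sub_le _ _).trans ?_
    have : ((α : ℂ) - 1) = ((α - 1 : ℝ) : ℂ) := by push_cast; rfl
    rw [norm_one, norm_mul, norm_mul, Complex.norm_real, Complex.norm_real,
      Real.norm_of_nonneg hz, Real.norm_of_nonneg hα.le, this, Complex.norm_cpow_real]
    gcongr 1 + z * α * ?_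
    exact Real.rpow_le_rpow_of_nonpos hm hmr (by linarith)
  refine (norm_sub_le _ _).trans ?_
  rw [norm_mul, norm_mul, Complex.norm_real, Real.norm_of_nonneg hs]
  calc _ ≤ Real.exp a * m ^ (-s) * Real.exp (-(-Real.cos ψ) * u) * (1 + z * α * m ^ (α - 1))
        + s * (Real.exp a * m ^ (-(s + 1)) * Real.exp (-(-Real.cos ψ) * u)) := by
        gcongr
        · exact key s hs
        · exact key (s + 1) (by linarith)
    _ = _ := by ring

lemma wrightFun_ofReal_im (α s z : ℝ) {a : ℝ} (ha : 0 ≤ a) : (wrightFun α s z a).im = 0 := by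
  unfold wrightFun
  rw [← Complex.ofReal_neg, ← Complex.ofReal_cpow ha, ← Complex.ofReal_cpow ha,
    ← Complex.ofReal_mul, ← Complex.ofReal_sub, ← Complex.ofReal_exp, ← Complex.ofReal_mul,
    Complex.ofReal_im]

lemma measurable_wrightDeriv (α s z : ℝ) : Measurable (wrightDeriv α s z) := by
  have := measurable_wrightFun α s z
  have := measurable_wrightFun α (s + 1) z
  unfold wrightDeriv; fun_prop

/-- The integrand is the u-derivative of `wrightFun` along the ray, which decays at infinity; only
the value at the starting point contributes. -/
lemma integral_wrightDeriv_ray {α s z ψ a : ℝ} (hα : 0 < α) (hα1 : α < 1)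
    (hψ : ψ ∈ Ioo (Real.pi / 2) Real.pi) (hαψ : α * ψ < Real.pi / 2) (ha : 0 < a)
    (hs : 0 ≤ s) (hz : 0 ≤ z) :
    ∫ u in Ioi (0:ℝ), wrightDeriv α s z (ray ψ a u) * Complex.exp (ψ * Complex.I) =
      - wrightFun α s z a := by
  have hc : 0 < -Real.cos ψ := by linarith [cos_neg_of_mem hψ.1 hψ.2.le]
  have hsin := sin_pos_of_mem hψ
  have hd : ∀ u, 0 ≤ u → HasDerivAt (fun u => wrightFun α s z (ray ψ a u))
      (wrightDeriv α s z (ray ψ a u) * Complex.exp (ψ * Complex.I)) u := fun u hu =>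
    HasDerivAt.comp u (hasDerivAt_wrightFun (ray_mem_slitPlane hψ hu (Or.inl ha)))
      (hasDerivAt_ray_right ψ a u)
  have h := integral_Ioi_of_hasDerivAt_of_tendsto (a := 0) (m := 0)
    (hd 0 le_rfl).continuousAt.continuousWithinAt (fun u hu => hd u (le_of_lt hu)) ?_ ?_
  · rw [h]; simp [ray]
  · refine Integrable.mono' ((exp_neg_integrableOn_Ioi 0 hc).const_mul (Real.exp a *
      ((a * Real.sin ψ) ^ (-s) * (1 + z * α * (a * Real.sin ψ) ^ (α - 1)) +
        s * (a * Real.sin ψ) ^ (-(s + 1)))))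
      (((measurable_wrightDeriv α s z).comp (continuous_ray ψ a).measurable).mul_const
        _).aestronglyMeasurable ?_
    · filter_upwards [ae_restrict_mem measurableSet_Ioi] with u hu
      rw [norm_mul_exp_ofReal_mul_I]
      exact norm_wrightDeriv_ray_le hα hα1 hψ hαψ ha.le (le_of_lt hu) hs hz
        (mul_pos ha hsin) (le_norm_ray_left a u) (Or.inl ha)
  · rw [tendsto_zero_iff_norm_tendsto_zero]
    have h0 : Tendsto (fun u => Real.exp a * Real.exp (-(z * (Real.cos (α * ψ) *
        (a * Real.sin ψ) ^ α))) * (a * Real.sin ψ) ^ (-s) * Real.exp (-(-Real.cos ψ) * u))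
        atTop (𝓝 0) := by
      have : Tendsto (fun u : ℝ => Real.exp (-(-Real.cos ψ) * u)) atTop (𝓝 0) :=
        Real.tendsto_exp_atBot.comp (tendsto_id.const_mul_atTop_of_neg (by linarith))
      simpa using this.const_mul _
    refine squeeze_zero' (Eventually.of_forall fun _ => norm_nonneg _) ?_ h0
    filter_upwards [eventually_ge_atTop 0] with u hu
    exact norm_wrightFun_le hα hψ hαψ ha.le hu hs hz
      (mul_pos ha hsin) (le_norm_ray_left a u) (Or.inl ha)

/-- Infinitesimal form of Cauchy's theorem: moving the start of the ray from a to a + da removes the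
contribution of that piece of the real axis. -/
lemma hasDerivAt_rayIntegral {α s z ψ a : ℝ} (hα : 0 < α) (hα1 : α < 1)
    (hψ : ψ ∈ Ioo (Real.pi / 2) Real.pi) (hαψ : α * ψ < Real.pi / 2) (ha : 0 < a)
    (hs : 0 ≤ s) (hz : 0 ≤ z) :
    HasDerivAt (rayIntegral α s z ψ) (- wrightFun α s z a) a := by
  have hc : 0 < -Real.cos ψ := by linarith [cos_neg_of_mem hψ.1 hψ.2.le]
  have hsin := sin_pos_of_mem hψ
  rw [← integral_wrightDeriv_ray hα hα1 hψ hαψ ha hs hz]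
  set m := a / 2 * Real.sin ψ with hm
  have hm0 : 0 < m := by positivity
  refine (hasDerivAt_integral_of_dominated_loc_of_deriv_le
    (Ioo_mem_nhds (show a / 2 < a by linarith) (show a < 2 * a by linarith))
    (F := fun a u => wrightFun α s z (ray ψ a u) * Complex.exp (ψ * Complex.I))
    (F' := fun a u => wrightDeriv α s z (ray ψ a u) * Complex.exp (ψ * Complex.I))
    (bound := fun u => Real.exp (2 * a) * (m ^ (-s) * (1 + z * α * m ^ (α - 1)) +
      s * m ^ (-(s + 1))) * Real.exp (-(-Real.cos ψ) * u)) ?_ ?_ ?_ ?_ ?_ ?_).2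
  · exact Eventually.of_forall fun y =>
      ((measurable_wrightFun_ray α s z ψ y).mul_const _).aestronglyMeasurable
  · exact (integrableOn_wrightFun_ray hα hψ hαψ ha hs hz).mul_const _
  · exact (((measurable_wrightDeriv α s z).comp (continuous_ray ψ a).measurable).mul_const
        _).aestronglyMeasurable
  · filter_upwards [ae_restrict_mem measurableSet_Ioi] with u hu y hy
    have hy0 : 0 < y := by linarith [hy.1]
    rw [norm_mul_exp_ofReal_mul_I]
    refine (norm_wrightDeriv_ray_le hα hα1 hψ hαψ hy0.le (le_of_lt hu) hs hz hm0
      (le_trans ?_ (le_norm_ray_left y u)) (Or.inl hy0)).trans ?_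
    · rw [hm]; gcongr; exact hy.1.le
    · gcongr; exact hy.2.le
  · exact (exp_neg_integrableOn_Ioi 0 hc).const_mul _
  · filter_upwards [ae_restrict_mem measurableSet_Ioi] with u hu y hy
    have hy0 : 0 < y := by linarith [hy.1]
    have hsl : ray ψ y u ∈ Complex.slitPlane := ray_mem_slitPlane hψ (le_of_lt hu) (Or.inl hy0)
    have := HasDerivAt.comp (h := fun y => ray ψ y u) y
      (hasDerivAt_wrightFun (α := α) (s := s) (z := z) hsl) (hasDerivAt_ray_left ψ y u)
    rw [mul_one] at this
    exact this.mul_const _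

/-- The imaginary part of the ray integral does not depend on the starting point. -/
lemma rayIntegral_im_eq {α s z ψ a : ℝ} (hα : 0 < α) (hα1 : α < 1)
    (hψ : ψ ∈ Ioo (Real.pi / 2) Real.pi) (hαψ : α * ψ < Real.pi / 2) (ha : 0 < a)
    (hs : 0 ≤ s) (hs1 : s < 1) (hz : 0 ≤ z) :
    (rayIntegral α s z ψ a).im = (rayIntegral α s z ψ 0).im := by
  -- The derivative in the starting point is real, so the imaginary part has slope zero. The mean
  -- value theorem asks only for continuity at 0, where the integrand is singular.
  obtain ⟨c, hc, h⟩ := exists_hasDerivAt_eq_slope (fun a => (rayIntegral α s z ψ a).im)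
    (fun a => (- wrightFun α s z a).im) ha
    (Complex.continuous_im.comp_continuousOn (continuousOn_rayIntegral hα hψ hαψ hs hs1 hz))
    (fun x hx => by
      have := hasDerivAt_rayIntegral hα hα1 hψ hαψ hx.1 hs hz
      exact Complex.imCLM.hasFDerivAt.comp_hasDerivAt x this)
  rw [Complex.neg_im, wrightFun_ofReal_im α s z hc.1.le, neg_zero, eq_comm, div_eq_zero_iff] at h
  rcases h with h | h <;> linarith

/-! ### Mainardi's series as a contour integral -/

lemma ray_zero_cpow {ψ u : ℝ} (hψ : ψ ∈ Ioo (Real.pi / 2) Real.pi) (hu : 0 < u) (c : ℝ) :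
    ray ψ 0 u ^ (c : ℂ) = (u ^ c : ℝ) * Complex.exp (ψ * c * Complex.I) := by
  have h0 : Complex.exp (ψ * Complex.I) ≠ 0 := Complex.exp_ne_zero _
  have hlog : Complex.log (Complex.exp (ψ * Complex.I)) = ψ * Complex.I :=
    Complex.log_exp (by simp; linarith [hψ.1, Real.pi_pos]) (by simpa using hψ.2.le)
  rw [ray, Complex.ofReal_zero, zero_add, Complex.cpow_def_of_ne_zero
    (mul_ne_zero (by exact_mod_cast hu.ne') h0), Complex.log_ofReal_mul hu h0, hlog, add_mul,
    Complex.exp_add, Real.rpow_def_of_pos hu]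
  push_cast
  ring_nf

/-- From the origin the integrand is a rotated Gamma integrand times exp(-zσ^α); expanding the last
factor produces Gamma integrals with shifted exponents, by `rayGamma_mul_pow`. -/
lemma wrightFun_ray_zero {α s z ψ u : ℝ} (hψ : ψ ∈ Ioo (Real.pi / 2) Real.pi) (hu : 0 < u) :
    wrightFun α s z (ray ψ 0 u) * Complex.exp (ψ * Complex.I) =
      rayGamma (1 - s) ψ u *
        Complex.exp (-(z * ((u ^ α : ℝ) * Complex.exp (ψ * α * Complex.I)))) := by
  have e : Complex.exp (ψ * ((1 - s : ℝ) : ℂ) * Complex.I) =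
      Complex.exp (ψ * Complex.I) * Complex.exp (ψ * (-s : ℝ) * Complex.I) := by
    rw [← Complex.exp_add]; push_cast; ring_nf
  have e0 : ray ψ 0 u = u * Complex.exp (ψ * Complex.I) := by simp [ray]
  rw [wrightFun, ← Complex.ofReal_neg s, ray_zero_cpow hψ hu, ray_zero_cpow hψ hu, rayGamma, e,
    sub_eq_add_neg, Complex.exp_add, e0, show 1 - s - 1 = -s by ring]
  ring

lemma rayGamma_mul_pow {x α ψ u : ℝ} (hu : 0 < u) (n : ℕ) :
    rayGamma x ψ u * ((u ^ α : ℝ) * Complex.exp (ψ * α * Complex.I)) ^ n =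
      rayGamma (x + α * n) ψ u := by
  rw [rayGamma, rayGamma, mul_pow, ← Complex.exp_nat_mul, ← Complex.ofReal_pow,
    ← Real.rpow_mul_natCast hu.le, show x + α * n - 1 = (x - 1) + α * n by ring,
    Real.rpow_add hu, show (ψ * ((x + α * n : ℝ) : ℂ) * Complex.I) =
      ψ * x * Complex.I + n * (ψ * α * Complex.I) by push_cast; ring, Complex.exp_add]
  push_cast
  ring

/-- `exp (z u ^ α)` with `α < 1` is dominated by any exponential. -/
lemma exists_exp_rpow_le {α z c : ℝ} (hα : 0 < α) (hα1 : α < 1) (hz : 0 ≤ z) (hc : 0 < c) :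
    ∃ C : ℝ, ∀ u : ℝ, 0 < u → Real.exp (z * u ^ α) ≤ C * Real.exp (c * u) := by
  have h1 : Tendsto (fun δ : ℝ => z * δ ^ (α - 1)) atTop (𝓝 0) := by
    have := (tendsto_rpow_neg_atTop (y := 1 - α) (by linarith)).const_mul z
    simpa using this
  -- Beyond the threshold δ one has z u^α ≤ c u; below it, z u^α is at most z δ^α, which goes into
  -- the constant.
  obtain ⟨δ, hδ, hδ0⟩ := ((h1.eventually_lt_const hc).and (eventually_gt_atTop 0)).exists
  refine ⟨Real.exp (z * δ ^ α), fun u hu => ?_⟩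
  rw [← Real.exp_add]
  refine Real.exp_le_exp.2 ?_
  rcases le_total u δ with h | h
  · have : z * u ^ α ≤ z * δ ^ α := by gcongr
    nlinarith [mul_pos hc hu]
  · have e : u ^ α = u ^ (α - 1) * u := by rw [← Real.rpow_add_one hu.ne']; ring_nf
    have h2 : u ^ (α - 1) ≤ δ ^ (α - 1) := Real.rpow_le_rpow_of_nonpos hδ0 h (by linarith)
    have h3 : z * u ^ α ≤ c * u := by
      rw [e, ← mul_assoc]; gcongr
      exact (mul_le_mul_of_nonneg_left h2 hz).trans hδ.le
    have : 0 ≤ z * δ ^ α := by positivity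
    linarith

/-- Reflection formula, in a form that also holds at positive integers: there the sine vanishes, and
so does the left side by the convention that Γ is 0 at its poles. -/
lemma inv_Gamma_one_sub (x : ℝ) (hx : 0 < x) :
    (Real.Gamma (1 - x))⁻¹ = Real.Gamma x * Real.sin (Real.pi * x) / Real.pi := by
  have h := Real.Gamma_mul_Gamma_one_sub x
  have hG := (Real.Gamma_pos_of_pos hx).ne'
  rw [mul_comm, ← eq_div_iff hG] at h
  rw [h, inv_div, div_div_eq_mul_div]

lemma exp_pi_mul_Gamma_im (x : ℝ) :
    (Complex.exp (Real.pi * x * Complex.I) * Real.Gamma x).im =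
      Real.Gamma x * Real.sin (Real.pi * x) := by
  rw [← Complex.ofReal_mul, mul_comm, Complex.im_ofReal_mul, Complex.exp_ofReal_mul_I_im]

/-- Termwise integration of the power series of exp(-zσ^α). The absolute series sums to exp(z u^α),
which half of the decay rate -cos ψ absorbs since α < 1. -/
lemma hasSum_rayIntegral_zero {α z ψ : ℝ} (hα : 0 < α) (hα1 : α < 1)
    (hψ : ψ ∈ Ioo (Real.pi / 2) Real.pi) (hz : 0 ≤ z) :
    HasSum (fun n : ℕ => ∫ u in Ioi (0:ℝ), ((-z : ℂ) ^ n / n.factorial) *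
      rayGamma (α + α * n) ψ u) (rayIntegral α (1 - α) z ψ 0) := by
  have hc : 0 < -Real.cos ψ := by linarith [cos_neg_of_mem hψ.1 hψ.2.le]
  have hb : ∀ u : ℝ, HasSum (fun n : ℕ => u ^ (α - 1) * Real.exp (Real.cos ψ * u) *
      ((z * u ^ α) ^ n / n.factorial))
      (u ^ (α - 1) * Real.exp (Real.cos ψ * u) * Real.exp (z * u ^ α)) := by
    intro u
    have := NormedSpace.expSeries_div_hasSum_exp (z * u ^ α)
    rw [← Real.exp_eq_exp_ℝ] at this
    exact this.mul_left _
  refine hasSum_integral_of_dominated_convergence (fun n u => u ^ (α - 1) *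
    Real.exp (Real.cos ψ * u) * ((z * u ^ α) ^ n / n.factorial)) ?_ ?_ ?_ ?_ ?_
  · exact fun n => ((measurable_rayGamma _ ψ).const_mul _).aestronglyMeasurable
  · intro n
    filter_upwards [ae_restrict_mem measurableSet_Ioi] with u hu
    have hu' : 0 < u := hu
    rw [norm_mul, norm_rayGamma _ _ hu', norm_div, norm_pow, norm_neg, Complex.norm_real,
      Real.norm_of_nonneg hz, Complex.norm_natCast,
      show α + α * n - 1 = (α - 1) + α * n by ring, Real.rpow_add hu',
      mul_pow, ← Real.rpow_mul_natCast hu'.le]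
    exact le_of_eq (by ring)
  · exact Eventually.of_forall fun u => (hb u).summable
  · obtain ⟨C, hC⟩ := exists_exp_rpow_le hα hα1 hz (c := -Real.cos ψ / 2) (by linarith)
    simp_rw [fun u => (hb u).tsum_eq]
    refine Integrable.mono' ((integrableOn_rpow_mul_exp_neg hα (c := -Real.cos ψ / 2)
      (by linarith)).const_mul C) ?_ ?_
    · exact Measurable.aestronglyMeasurable (by fun_prop)
    · filter_upwards [ae_restrict_mem measurableSet_Ioi] with u hu
      have hu' : 0 < u := hu
      rw [Real.norm_of_nonneg (by positivity)]
      calc _ ≤ u ^ (α - 1) * Real.exp (Real.cos ψ * u) * (C * Real.exp (-Real.cos ψ / 2 * u)) := by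
            gcongr; exact hC u hu'
        _ = C * (u ^ (α - 1) * (Real.exp (Real.cos ψ * u) * Real.exp (-Real.cos ψ / 2 * u))) := by
            ring
        _ = _ := by rw [← Real.exp_add]; ring_nf
  · filter_upwards [ae_restrict_mem measurableSet_Ioi] with u hu
    have hu' : 0 < u := hu
    rw [wrightFun_ray_zero hψ hu', show 1 - (1 - α) = α by ring]
    have := NormedSpace.expSeries_div_hasSum_exp
      (-(z * ((u ^ α : ℝ) * Complex.exp (ψ * α * Complex.I))))
    rw [← Complex.exp_eq_exp_ℂ] at this
    refine (this.mul_left _).congr_fun fun n => ?_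
    rw [← rayGamma_mul_pow hu', ← neg_mul, mul_pow]
    ring

/-- Each term has imaginary part Γ(x) sin(πx) with x = α + αn, which is π / Γ(1 - x) by reflection.
-/
lemma mainardi_eq_rayIntegral_zero {α z ψ : ℝ} (hα : 0 < α) (hα1 : α < 1)
    (hψ : ψ ∈ Ioo (Real.pi / 2) Real.pi) (hz : 0 ≤ z) :
    mainardi α z = (rayIntegral α (1 - α) z ψ 0).im / Real.pi := by
  have h := (Complex.hasSum_im (hasSum_rayIntegral_zero hα hα1 hψ hz)).div_const Real.pi
  rw [mainardi, ← h.tsum_eq]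
  congr 1
  ext n
  have hx : 0 < α + α * n := by positivity
  rw [integral_const_mul, integral_rayGamma hx hψ.1 hψ.2.le,
    show ((-z : ℂ) ^ n / n.factorial) = (((-z) ^ n / n.factorial : ℝ) : ℂ) by push_cast; rfl,
    Complex.im_ofReal_mul, exp_pi_mul_Gamma_im,
    show -α * n + 1 - α = 1 - (α + α * n) by ring, div_mul_eq_div_div, div_eq_mul_inv _
    (Real.Gamma _), inv_Gamma_one_sub _ hx]
  ring

lemma mainardi_eq_rayIntegral {α z ψ a : ℝ} (hα : 0 < α) (hα1 : α < 1)
    (hψ : ψ ∈ Ioo (Real.pi / 2) Real.pi) (hαψ : α * ψ < Real.pi / 2) (ha : 0 < a) (hz : 0 ≤ z) :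
    mainardi α z = (rayIntegral α (1 - α) z ψ a).im / Real.pi := by
  rw [mainardi_eq_rayIntegral_zero hα hα1 hψ hz,
    rayIntegral_im_eq hα hα1 hψ hαψ ha (by linarith) (by linarith) hz]

/-- Hankel's formula for the reciprocal Gamma function. -/
lemma rayIntegral_im_eq_inv_Gamma {α s ψ : ℝ} (hα : 0 < α) (hα1 : α < 1)
    (hψ : ψ ∈ Ioo (Real.pi / 2) Real.pi) (hαψ : α * ψ < Real.pi / 2)
    (hs : 0 < s) (hs1 : s < 1) :
    (rayIntegral α s 0 ψ 1).im = Real.pi * (Real.Gamma s)⁻¹ := by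
  rw [rayIntegral_im_eq hα hα1 hψ hαψ one_pos hs.le hs1 le_rfl]
  have : rayIntegral α s 0 ψ 0 = ∫ u in Ioi (0:ℝ), rayGamma (1 - s) ψ u := by
    refine setIntegral_congr_fun measurableSet_Ioi fun u hu => ?_
    simp only [wrightFun_ray_zero hψ (show 0 < u from hu)]
    simp
  rw [this, integral_rayGamma (by linarith) hψ.1 hψ.2.le, exp_pi_mul_Gamma_im]
  have h := inv_Gamma_one_sub (1 - s) (by linarith)
  rw [show 1 - (1 - s) = s by ring] at h
  rw [h]
  field_simp [Real.pi_ne_zero]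

/-- At s = 1 the integrand is not integrable from the origin, so the value is the limit of Hankel's
formula as s increases to 1, taken on the ray that starts at 1. -/
lemma rayIntegral_one_im {α ψ : ℝ} (hα : 0 < α) (hα1 : α < 1)
    (hψ : ψ ∈ Ioo (Real.pi / 2) Real.pi) (hαψ : α * ψ < Real.pi / 2) :
    (rayIntegral α 1 0 ψ 1).im = Real.pi := by
  have hc : 0 < -Real.cos ψ := by linarith [cos_neg_of_mem hψ.1 hψ.2.le]
  have hsin := sin_pos_of_mem hψ
  have hcont : ContinuousOn (fun s => rayIntegral α s 0 ψ 1) (Icc 0 1) := by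
    refine continuousOn_of_dominated (bound := fun u => Real.exp 1 * (Real.sin ψ) ^ (-1 : ℝ) *
      Real.exp (-(-Real.cos ψ) * u)) ?_ ?_ ?_ ?_
    · exact fun s _ => ((measurable_wrightFun_ray α s 0 ψ 1).mul_const _).aestronglyMeasurable
    · intro s hs
      filter_upwards [ae_restrict_mem measurableSet_Ioi] with u hu
      rw [norm_mul_exp_ofReal_mul_I]
      refine (norm_wrightFun_le hα hψ hαψ zero_le_one (le_of_lt hu) hs.1 le_rfl
        (m := Real.sin ψ) hsin (by simpa using le_norm_ray_left (ψ := ψ) 1 u)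
        (Or.inl one_pos)).trans ?_
      rw [zero_mul, neg_zero, Real.exp_zero, mul_one]
      gcongr Real.exp 1 * ?_ * _
      exact Real.rpow_le_rpow_of_exponent_ge hsin (Real.sin_le_one _) (by linarith [hs.2])
    · exact (exp_neg_integrableOn_Ioi 0 hc).const_mul _
    · filter_upwards [ae_restrict_mem measurableSet_Ioi] with u hu
      have hne : ray ψ 1 u ≠ 0 := Complex.slitPlane_ne_zero
        (ray_mem_slitPlane hψ (le_of_lt hu) (Or.inl one_pos))
      have : Continuous fun s : ℝ => ray ψ 1 u ^ (-s : ℂ) :=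
        Continuous.const_cpow (by fun_prop) (Or.inl hne)
      exact ((continuous_const.mul this).mul continuous_const).continuousOn
  have h1 : Tendsto (fun s => (rayIntegral α s 0 ψ 1).im) (𝓝[<] 1)
      (𝓝 (rayIntegral α 1 0 ψ 1).im) := by
    have := (hcont 1 ⟨zero_le_one, le_rfl⟩).mono_of_mem_nhdsWithin
      (Filter.mem_of_superset (Ioo_mem_nhdsLT (zero_lt_one (α := ℝ))) Ioo_subset_Icc_self)
    exact (Complex.continuous_im.tendsto _).comp this
  have h2 : Tendsto (fun s => Real.pi * (Real.Gamma s)⁻¹) (𝓝[<] 1) (𝓝 Real.pi) := by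
    have h3 : ContinuousAt Real.Gamma 1 :=
      (Real.differentiableAt_Gamma fun m => by
        have : (0 : ℝ) ≤ m := m.cast_nonneg
        linarith).continuousAt
    have := (h3.inv₀ (by simp)).const_mul Real.pi
    have := this.tendsto.mono_left (nhdsWithin_le_nhds (s := Iio 1))
    simpa using this
  refine tendsto_nhds_unique h1 (h2.congr' ?_)
  filter_upwards [Ioo_mem_nhdsLT (zero_lt_one (α := ℝ))] with s hs
  exact (rayIntegral_im_eq_inv_Gamma hα hα1 hψ hαψ hs.1 hs.2).symm

/-! ### Decay and total mass of Mainardi's function -/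

/-- Mainardi's function decays faster than any exponential. -/
lemma exists_mainardi_le {α : ℝ} (hα : 0 < α) (hα1 : α < 1) (c : ℝ) :
    ∃ C, 0 ≤ C ∧ ∀ z, 0 ≤ z → |mainardi α z| ≤ C * Real.exp (-c * z) := by
  obtain ⟨ψ, hψ, hαψ⟩ := exists_angle hα hα1
  have hc : 0 < -Real.cos ψ := by linarith [cos_neg_of_mem hψ.1 hψ.2.le]
  have hsin := sin_pos_of_mem hψ
  have hk := cos_mul_pos hα hψ hαψ
  have h1 : Tendsto (fun a : ℝ => Real.cos (α * ψ) * (a * Real.sin ψ) ^ α) atTop atTop :=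
    ((tendsto_rpow_atTop hα).comp (tendsto_id.atTop_mul_const hsin)).const_mul_atTop hk
  -- The rate of decay in z is cos(αψ)(a sin ψ)^α; moving the start of the ray to the right makes it
  -- exceed any c.
  obtain ⟨a, hac, ha⟩ := ((h1.eventually_ge_atTop c).and (eventually_gt_atTop 0)).exists
  set m := a * Real.sin ψ
  have hm : 0 < m := by positivity
  set D := ∫ u in Ioi (0:ℝ), Real.exp (-(-Real.cos ψ) * u) with hD
  have hD0 : 0 ≤ D := integral_nonneg fun u => (Real.exp_pos _).le
  refine ⟨Real.exp a * m ^ (-(1 - α)) * D / Real.pi, by positivity, fun z hz => ?_⟩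
  rw [mainardi_eq_rayIntegral hα hα1 hψ hαψ ha hz, abs_div, abs_of_pos Real.pi_pos, div_mul_eq_mul_div]
  gcongr
  refine (Complex.abs_im_le_norm _).trans ?_
  calc ‖rayIntegral α (1 - α) z ψ a‖ ≤ ∫ u in Ioi (0:ℝ), Real.exp a *
        Real.exp (-(z * (Real.cos (α * ψ) * m ^ α))) * m ^ (-(1 - α)) *
        Real.exp (-(-Real.cos ψ) * u) := by
        refine norm_integral_le_of_norm_le ((exp_neg_integrableOn_Ioi 0 hc).const_mul _) ?_
        filter_upwards [ae_restrict_mem measurableSet_Ioi] with u hu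
        rw [norm_mul_exp_ofReal_mul_I]
        exact norm_wrightFun_le hα hψ hαψ ha.le (le_of_lt hu) (by linarith) hz hm
          (le_norm_ray_left a u) (Or.inl ha)
    _ = Real.exp a * m ^ (-(1 - α)) * D *
        Real.exp (-(z * (Real.cos (α * ψ) * m ^ α))) := by rw [integral_const_mul]; ring
    _ ≤ _ := by
        gcongr
        nlinarith

lemma measurable_mainardi (α : ℝ) : Measurable (mainardi α) := by
  unfold mainardi
  exact Measurable.tsum fun n => by fun_prop

/-- Mainardi's function has total mass one. -/
lemma integral_mainardi {α : ℝ} (hα : 0 < α) (hα1 : α < 1) :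
    ∫ z in Ioi (0:ℝ), mainardi α z = 1 := by
  obtain ⟨ψ, hψ, hαψ⟩ := exists_angle hα hα1
  have hc : 0 < -Real.cos ψ := by linarith [cos_neg_of_mem hψ.1 hψ.2.le]
  have hsin := sin_pos_of_mem hψ
  have hk := cos_mul_pos hα hψ hαψ
  set F : ℝ → ℝ → ℂ := fun z u =>
    wrightFun α (1 - α) z (ray ψ 1 u) * Complex.exp (ψ * Complex.I) with hF
  have hmeas : Measurable (Function.uncurry F) := by
    simp only [hF, Function.uncurry_def, wrightFun, ray]
    fun_prop
  have hint : Integrable (Function.uncurry F)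
      ((volume.restrict (Ioi (0:ℝ))).prod (volume.restrict (Ioi (0:ℝ)))) := by
    have hb := Integrable.mul_prod (μ := volume.restrict (Ioi (0:ℝ)))
      (ν := volume.restrict (Ioi (0:ℝ)))
      ((exp_neg_integrableOn_Ioi 0 (b := Real.cos (α * ψ) * Real.sin ψ ^ α)
        (by positivity)).const_mul (Real.exp 1 * Real.sin ψ ^ (-(1 - α))))
      (exp_neg_integrableOn_Ioi 0 hc)
    refine Integrable.mono' hb hmeas.aestronglyMeasurable ?_
    rw [Measure.prod_restrict]
    filter_upwards [ae_restrict_mem (measurableSet_Ioi.prod measurableSet_Ioi)] with p hp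
    rw [Function.uncurry, hF]
    simp only
    rw [norm_mul_exp_ofReal_mul_I]
    refine (norm_wrightFun_le hα hψ hαψ zero_le_one (le_of_lt hp.2) (by linarith) (le_of_lt hp.1)
        (m := Real.sin ψ) hsin (by simpa using le_norm_ray_left (ψ := ψ) 1 p.2)
        (Or.inl one_pos)).trans (le_of_eq ?_)
    ring_nf
  have hswap := integral_integral_swap hint
  have e1 : ∫ z in Ioi (0:ℝ), ∫ u in Ioi (0:ℝ), F z u =
      ∫ z in Ioi (0:ℝ), rayIntegral α (1 - α) z ψ 1 := rfl
  -- Integrating first in z gives σ^(-α), which turns σ^(α-1) into σ^(-1): the integral with s = 1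
  -- and z = 0 remains.
  have e2 : ∫ u in Ioi (0:ℝ), ∫ z in Ioi (0:ℝ), F z u = rayIntegral α 1 0 ψ 1 := by
    refine setIntegral_congr_fun measurableSet_Ioi fun u hu => ?_
    have hsl : ray ψ 1 u ∈ Complex.slitPlane :=
      ray_mem_slitPlane hψ (le_of_lt hu) (Or.inl one_pos)
    have hne := Complex.slitPlane_ne_zero hsl
    have hre : 0 < (ray ψ 1 u ^ (α : ℂ)).re :=
      lt_of_lt_of_le (mul_pos hk (Real.rpow_pos_of_pos (norm_pos_iff.2 hne) _))
        (re_cpow_ray_ge hα hψ hαψ zero_le_one (le_of_lt hu) (Or.inl one_pos))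
    have h3 := integral_exp_mul_complex_Ioi (a := -(ray ψ 1 u ^ (α : ℂ))) (by simpa using hre) 0
    have h4 : ∀ z : ℝ, F z u = (Complex.exp (ray ψ 1 u) * ray ψ 1 u ^ (-((1 - α : ℝ) : ℂ)) *
        Complex.exp (ψ * Complex.I)) * Complex.exp (-(ray ψ 1 u ^ (α : ℂ)) * z) := by
      intro z
      simp only [hF, wrightFun, sub_eq_add_neg (ray ψ 1 u), Complex.exp_add]
      ring_nf
    simp_rw [h4]
    rw [integral_const_mul, h3]
    simp only [wrightFun, Complex.ofReal_zero, mul_zero, Complex.exp_zero, zero_mul, sub_zero]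
    rw [neg_div_neg_eq, one_div, ← Complex.cpow_neg,
      show (-(1 : ℝ) : ℂ) = -((1 - α : ℝ) : ℂ) + -(α : ℂ) by push_cast; ring,
      Complex.cpow_add _ _ hne]
    ring
  rw [e1, e2] at hswap
  have hint' : Integrable (fun z => rayIntegral α (1 - α) z ψ 1) (volume.restrict (Ioi (0:ℝ))) :=
    hint.integral_prod_left
  have h5 : ∫ z in Ioi (0:ℝ), (rayIntegral α (1 - α) z ψ 1).im = Real.pi := by
    rw [← rayIntegral_one_im hα hα1 hψ hαψ, ← hswap]
    exact integral_im hint'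
  calc ∫ z in Ioi (0:ℝ), mainardi α z
      = ∫ z in Ioi (0:ℝ), (rayIntegral α (1 - α) z ψ 1).im / Real.pi :=
        setIntegral_congr_fun measurableSet_Ioi fun z hz =>
          mainardi_eq_rayIntegral hα hα1 hψ hαψ one_pos (le_of_lt hz)
    _ = 1 := by rw [integral_div, h5, div_self Real.pi_ne_zero]

/-! ### The operator families `T_α` and `S_α` -/

section Semigroup

variable {X : Type*} [NormedAddCommGroup X] [NormedSpace ℝ X]

/-- Factoring out the operator at the smaller of the two times reduces both left and right
continuity to continuity at 0. -/
lemma IsC0Semigroup.continuousOn {T : ℝ → X →L[ℝ] X} (hT : IsC0Semigroup T) {M ω : ℝ}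
    (hM : 1 ≤ M) (hω : 0 ≤ ω) (hbound : ∀ t : ℝ, 0 ≤ t → ‖T t‖ ≤ M * Real.exp (ω * t)) (x : X) :
    ContinuousOn (fun t => T t x) (Ici 0) := by
  have key : Tendsto (fun h => ‖T h x - x‖) (𝓝[≥] 0) (𝓝 0) := by
    have h1 : Tendsto (fun h => T h x) (𝓝[≥] 0) (𝓝 x) := by
      have h2 : ContinuousWithinAt (fun h => T h x) (Ioi 0) 0 := by
        simpa [ContinuousWithinAt, hT.zero] using hT.cont x
      have := continuousWithinAt_Ioi_iff_Ici.1 h2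
      simpa [ContinuousWithinAt, hT.zero] using this
    exact tendsto_iff_norm_sub_tendsto_zero.1 h1
  have bd : ∀ s t : ℝ, 0 ≤ s → s ≤ t →
      ‖T t x - T s x‖ ≤ M * Real.exp (ω * s) * ‖T |t - s| x - x‖ := by
    intro s t hs hst
    have e : T t x = T s (T (t - s) x) := by
      have := hT.add s (t - s) hs (by linarith)
      rw [add_sub_cancel] at this
      rw [this]; rfl
    rw [e, ← map_sub, abs_of_nonneg (by linarith)]
    exact (ContinuousLinearMap.le_opNorm _ _).trans (by gcongr; exact hbound s hs)
  intro t ht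
  have ht' : 0 ≤ t := ht
  rw [ContinuousWithinAt, tendsto_iff_norm_sub_tendsto_zero]
  have h1 : Tendsto (fun s : ℝ => |s - t|) (𝓝[Ici 0] t) (𝓝[≥] 0) := by
    refine tendsto_nhdsWithin_iff.2 ⟨?_, Eventually.of_forall fun s => mem_Ici.2 (abs_nonneg _)⟩
    have : Continuous fun s : ℝ => |s - t| := by fun_prop
    simpa using (this.tendsto t).mono_left nhdsWithin_le_nhds
  have h2 := (key.comp h1).const_mul (M * Real.exp (ω * t))
  rw [mul_zero] at h2
  refine squeeze_zero' (Eventually.of_forall fun _ => norm_nonneg _) ?_ h2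
  filter_upwards [self_mem_nhdsWithin] with s hs
  have hs' : 0 ≤ s := hs
  rcases le_total t s with h | h
  · exact bd t s ht' h
  · rw [norm_sub_rev]
    refine (bd s t hs' h).trans ?_
    simp only [Function.comp, abs_sub_comm s t]
    gcongr

/-- A subordination integral `∫ w(ρ) T(t ^ α ρ) dρ` with a rapidly decaying weight is a bounded
strongly continuous family of operators on compact time intervals. -/
lemma exists_subordinated_family [CompleteSpace X] {T : ℝ → X →L[ℝ] X} (hT : IsC0Semigroup T)
    {M ω : ℝ}
    (hM : 1 ≤ M) (hω : 0 ≤ ω) (hbound : ∀ t : ℝ, 0 ≤ t → ‖T t‖ ≤ M * Real.exp (ω * t))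
    {α b : ℝ} (hα : 0 < α) (hb : 0 ≤ b) {w : ℝ → ℝ} (hw : Measurable w)
    (hdec : ∀ c : ℝ, ∃ C, 0 ≤ C ∧ ∀ z, 0 ≤ z → |w z| ≤ C * Real.exp (-c * z)) :
    ∃ S : ℝ → X →L[ℝ] X,
      (∀ t ∈ Icc 0 b, ∀ η, S t η = ∫ ρ in Ioi (0 : ℝ), w ρ • T (t ^ α * ρ) η) ∧
      (∀ η, Continuous fun t => S t η) ∧ ∃ C, 0 ≤ C ∧ ∀ t, ‖S t‖ ≤ C := by
  -- The weight must cancel the growth exp(ω b^α ρ) of the semigroup and leave an integrable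
  -- exp(-ρ).
  obtain ⟨C, hC0, hC⟩ := hdec (ω * b ^ α + 1)
  have hcl : ∀ t : ℝ, (projIcc 0 b hb t : ℝ) ∈ Icc 0 b := fun t => (projIcc 0 b hb t).2
  -- Time is clamped to [0,b], so that the family is bounded and continuous on the whole line.
  set τ : ℝ → ℝ := fun t => (projIcc 0 b hb t : ℝ) ^ α with hτ
  have hτ0 : ∀ t, 0 ≤ τ t := fun t => Real.rpow_nonneg (hcl t).1 _
  have hτb : ∀ t, τ t ≤ b ^ α := fun t => Real.rpow_le_rpow (hcl t).1 (hcl t).2 hα.le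
  have hτc : Continuous τ := (continuous_subtype_val.comp continuous_projIcc).rpow_const
    fun _ => Or.inr hα.le
  have hTc : ∀ η, Continuous fun t => T (max t 0) η := fun η =>
    (hT.continuousOn hM hω hbound η).comp_continuous (by fun_prop) fun t => mem_Ici.2 (le_max_right _ _)
  have hmeas : ∀ t η, AEStronglyMeasurable (fun ρ => w ρ • T (τ t * ρ) η)
      (volume.restrict (Ioi (0:ℝ))) := by
    intro t η
    refine AEStronglyMeasurable.congr (f := fun ρ => w ρ • T (max (τ t * ρ) 0) η) ?_ ?_
    · refine hw.aestronglyMeasurable.smul ?_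
      exact ((hTc η).comp (continuous_const.mul continuous_id)).aestronglyMeasurable
    · filter_upwards [ae_restrict_mem measurableSet_Ioi] with ρ hρ
      rw [max_eq_left (mul_nonneg (hτ0 t) (le_of_lt hρ))]
  have hbd : ∀ t η, ∀ᵐ ρ ∂(volume.restrict (Ioi (0:ℝ))),
      ‖w ρ • T (τ t * ρ) η‖ ≤ C * M * ‖η‖ * Real.exp (-1 * ρ) := by
    intro t η
    filter_upwards [ae_restrict_mem measurableSet_Ioi] with ρ hρ
    have hρ' : 0 < ρ := hρ
    rw [norm_smul]
    have h1 : ‖T (τ t * ρ) η‖ ≤ M * Real.exp (ω * b ^ α * ρ) * ‖η‖ := by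
      refine (ContinuousLinearMap.le_opNorm _ _).trans ?_
      gcongr
      refine (hbound _ (mul_nonneg (hτ0 t) hρ'.le)).trans ?_
      have : ω * (τ t * ρ) ≤ ω * b ^ α * ρ := by
        rw [mul_assoc]; gcongr; exact hτb t
      gcongr
    calc _ ≤ C * Real.exp (-(ω * b ^ α + 1) * ρ) * (M * Real.exp (ω * b ^ α * ρ) * ‖η‖) := by
          gcongr; exact hC ρ hρ'.le
      _ = C * M * ‖η‖ * (Real.exp (-(ω * b ^ α + 1) * ρ) * Real.exp (ω * b ^ α * ρ)) := by ring
      _ = _ := by rw [← Real.exp_add]; ring_nf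
  have hbi : ∀ η : X, Integrable (fun ρ => C * M * ‖η‖ * Real.exp (-1 * ρ))
      (volume.restrict (Ioi (0:ℝ))) := fun η => (exp_neg_integrableOn_Ioi 0 one_pos).const_mul _
  have hint : ∀ t η, Integrable (fun ρ => w ρ • T (τ t * ρ) η) (volume.restrict (Ioi (0:ℝ))) :=
    fun t η => Integrable.mono' (hbi η) (hmeas t η) (hbd t η)
  set D := ∫ ρ in Ioi (0:ℝ), Real.exp (-1 * ρ)
  have hD0 : 0 ≤ D := integral_nonneg fun u => (Real.exp_pos _).le
  have hnorm : ∀ t η, ‖∫ ρ in Ioi (0 : ℝ), w ρ • T (τ t * ρ) η‖ ≤ C * M * D * ‖η‖ := by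
    intro t η
    refine (norm_integral_le_of_norm_le (hbi η) (hbd t η)).trans (le_of_eq ?_)
    rw [integral_const_mul]; ring
  let S : ℝ → X →L[ℝ] X := fun t => LinearMap.mkContinuous
    { toFun := fun η => ∫ ρ in Ioi (0 : ℝ), w ρ • T (τ t * ρ) η
      map_add' := fun x y => by
        rw [← integral_add (hint t x) (hint t y)]; simp only [map_add, smul_add]
      map_smul' := fun c x => by
        rw [RingHom.id_apply, ← integral_smul]; simp only [map_smul, smul_comm c] }
    (C * M * D) (hnorm t)
  refine ⟨S, fun t ht η => ?_, fun η => ?_, C * M * D, by positivity, fun t => ?_⟩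
  · change ∫ ρ in Ioi (0 : ℝ), w ρ • T (τ t * ρ) η = _
    simp only [hτ, projIcc_of_mem hb ht]
  · change Continuous fun t => ∫ ρ in Ioi (0 : ℝ), w ρ • T (τ t * ρ) η
    refine continuous_of_dominated (hmeas · η) (hbd · η) (hbi η) ?_
    filter_upwards [ae_restrict_mem measurableSet_Ioi] with ρ hρ
    have h1 : Continuous fun t => T (max (τ t * ρ) 0) η :=
      (hTc η).comp (hτc.mul continuous_const)
    have h2 : ∀ t, max (τ t * ρ) 0 = τ t * ρ := fun t =>
      max_eq_left (mul_nonneg (hτ0 t) (le_of_lt hρ))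
    simp only [h2] at h1
    exact h1.const_smul _
  · exact LinearMap.mkContinuous_norm_le _ (by positivity) _

lemma exists_clamped_semigroup {T : ℝ → X →L[ℝ] X} (hT : IsC0Semigroup T) {M ω : ℝ}
    (hM : 1 ≤ M) (hω : 0 ≤ ω) (hbound : ∀ t : ℝ, 0 ≤ t → ‖T t‖ ≤ M * Real.exp (ω * t))
    {b : ℝ} (hb : 0 ≤ b) :
    ∃ S : ℝ → X →L[ℝ] X, (∀ t ∈ Icc 0 b, ∀ η, S t η = T t η) ∧
      (∀ η, Continuous fun t => S t η) ∧ ∃ C, 0 ≤ C ∧ ∀ t, ‖S t‖ ≤ C := by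
  refine ⟨fun t => T (projIcc 0 b hb t), fun t ht η => by simp only [projIcc_of_mem hb ht],
    fun η => ?_, M * Real.exp (ω * b), by positivity, fun t => ?_⟩
  · exact (hT.continuousOn hM hω hbound η).comp_continuous
      (continuous_subtype_val.comp continuous_projIcc) fun t => (projIcc 0 b hb t).2.1
  · refine (hbound _ (projIcc 0 b hb t).2.1).trans ?_
    gcongr
    exact (projIcc 0 b hb t).2.2

lemma exists_opT_family [CompleteSpace X] {T : ℝ → X →L[ℝ] X} (hT : IsC0Semigroup T) {M ω : ℝ}
    (hM : 1 ≤ M) (hω : 0 ≤ ω) (hbound : ∀ t : ℝ, 0 ≤ t → ‖T t‖ ≤ M * Real.exp (ω * t))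
    {α b : ℝ} (hα : 0 < α) (hα1 : α ≤ 1) (hb : 0 ≤ b) :
    ∃ S : ℝ → X →L[ℝ] X, (∀ t ∈ Icc 0 b, ∀ η, S t η = opT T α t η) ∧
      (∀ η, Continuous fun t => S t η) ∧ ∃ C, 0 ≤ C ∧ ∀ t, ‖S t‖ ≤ C := by
  rcases hα1.eq_or_lt with rfl | hα1
  · simpa [opT] using exists_clamped_semigroup hT hM hω hbound hb
  · simpa [opT, hα1.ne] using exists_subordinated_family hT hM hω hbound hα hb
      (measurable_mainardi α) (exists_mainardi_le hα hα1)

lemma exists_opS_family [CompleteSpace X] {T : ℝ → X →L[ℝ] X} (hT : IsC0Semigroup T) {M ω : ℝ}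
    (hM : 1 ≤ M) (hω : 0 ≤ ω) (hbound : ∀ t : ℝ, 0 ≤ t → ‖T t‖ ≤ M * Real.exp (ω * t))
    {α b : ℝ} (hα : 0 < α) (hα1 : α ≤ 1) (hb : 0 ≤ b) :
    ∃ S : ℝ → X →L[ℝ] X, (∀ t ∈ Icc 0 b, ∀ η, S t η = opS T α t η) ∧
      (∀ η, Continuous fun t => S t η) ∧ ∃ C, 0 ≤ C ∧ ∀ t, ‖S t‖ ≤ C := by
  rcases hα1.eq_or_lt with rfl | hα1
  · simpa [opS] using exists_clamped_semigroup hT hM hω hbound hb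
  · have := exists_subordinated_family hT hM hω hbound hα hb
      (w := fun ρ => α * ρ * mainardi α ρ) (by have := measurable_mainardi α; fun_prop) ?_
    · simpa [opS, hα1.ne] using this
    · intro c
      -- The extra unit of decay pays for the factor z ≤ exp z.
      obtain ⟨C, hC0, hC⟩ := exists_mainardi_le hα hα1 (c + 1)
      refine ⟨α * C, by positivity, fun z hz => ?_⟩
      rw [abs_mul, abs_mul, abs_of_pos hα, abs_of_nonneg hz]
      have h1 : z ≤ Real.exp z := by linarith [Real.add_one_le_exp z]
      calc _ ≤ α * Real.exp z * (C * Real.exp (-(c + 1) * z)) := by gcongr; exact hC z hz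
        _ = α * C * (Real.exp z * Real.exp (-(c + 1) * z)) := by ring
        _ = _ := by rw [← Real.exp_add]; ring_nf

/-- Total mass one is what matches the formula on [0,b] with the initial segment at t = 0. -/
lemma opT_zero [CompleteSpace X] {T : ℝ → X →L[ℝ] X} (hT : IsC0Semigroup T) {α : ℝ} (hα : 0 < α)
    (hα1 : α ≤ 1) (η : X) : opT T α 0 η = η := by
  rcases hα1.eq_or_lt with rfl | hα1
  · simp [opT, hT.zero]
  · simp only [opT, hα1.ne, if_false, Real.zero_rpow hα.ne', zero_mul, hT.zero]
    rw [ContinuousLinearMap.id_apply, integral_smul_const, integral_mainardi hα hα1, one_smul]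

end Semigroup

/-! ### The covariance kernel of fractional Brownian motion -/

lemma intervalIntegrable_abs_rpow {c : ℝ} (hc : -1 < c) (a b : ℝ) :
    IntervalIntegrable (fun x : ℝ => |x| ^ c) volume a b := by
  have key : ∀ b : ℝ, 0 ≤ b → IntervalIntegrable (fun x : ℝ => |x| ^ c) volume 0 b := by
    intro b hb
    refine (intervalIntegral.intervalIntegrable_rpow' hc (a := 0) (b := b)).congr ?_
    intro x hx
    rw [uIoc_of_le hb] at hx
    simp only [abs_of_pos hx.1]
  have key' : ∀ b : ℝ, IntervalIntegrable (fun x : ℝ => |x| ^ c) volume 0 b := by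
    intro b
    rcases le_total 0 b with hb | hb
    · exact key b hb
    · have := key (-b) (by linarith)
      rw [IntervalIntegrable.iff_comp_neg] at this
      simpa using this
  exact (key' a).symm.trans (key' b)

lemma hasDerivAt_abs_rpow {c x : ℝ} (hx : x ≠ 0) :
    HasDerivAt (fun x : ℝ => |x| ^ c) (c * x * |x| ^ (c - 2)) x := by
  have h := (hasDerivAt_abs hx).rpow_const (p := c) (Or.inl (abs_ne_zero.2 hx))
  refine h.congr_deriv ?_
  have e : |x| ^ (c - 1) = |x| ^ (c - 2) * |x| := by
    rw [← Real.rpow_add_one (abs_ne_zero.2 hx)]; ring_nf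
  have e2 : ((SignType.sign x : SignType) : ℝ) * |x| = x := sign_mul_abs x
  rw [e]
  linear_combination (c * |x| ^ (c - 2)) * e2

/-- For negative c the power blows up at 0, but the product has size |x|^(c+1). -/
lemma continuous_mul_abs_rpow {c : ℝ} (hc : -1 < c) : Continuous fun x : ℝ => x * |x| ^ c := by
  refine continuous_iff_continuousAt.2 fun x => ?_
  rcases eq_or_ne x 0 with rfl | hx
  · rw [ContinuousAt, zero_mul, tendsto_zero_iff_abs_tendsto_zero]
    have h : Continuous fun x : ℝ => |x| ^ (c + 1) :=
      continuous_abs.rpow_const fun _ => Or.inr (by linarith)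
    have h0 := h.tendsto 0
    rw [abs_zero, Real.zero_rpow (by linarith)] at h0
    refine squeeze_zero (fun _ => abs_nonneg _) (fun x => ?_) h0
    rcases eq_or_ne x 0 with rfl | hx
    · simp; positivity
    · simp only [Function.comp]
      rw [abs_mul, abs_of_nonneg (a := |x| ^ c) (by positivity),
        Real.rpow_add_one (abs_ne_zero.2 hx), mul_comm]
  · exact continuousAt_id.mul (hasDerivAt_abs_rpow hx).continuousAt

/-- The primitive x|x|^c / (c+1) is continuous everywhere and differentiable off 0; one exceptional
point does not harm the fundamental theorem. -/
lemma integral_abs_rpow {c : ℝ} (hc : -1 < c) (a b : ℝ) :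
    ∫ x in a..b, |x| ^ c = (b * |b| ^ c - a * |a| ^ c) / (c + 1) := by
  have hc1 : c + 1 ≠ 0 := by linarith
  have h := integral_eq_of_hasDerivAt_off_countable (fun x : ℝ => x * |x| ^ c / (c + 1))
    (fun x => |x| ^ c) (countable_singleton (0 : ℝ)) (a := a) (b := b)
    ((continuous_mul_abs_rpow hc).div_const _).continuousOn ?_ (intervalIntegrable_abs_rpow hc a b)
  · rw [h]; ring
  · intro x hx
    have hx0 : x ≠ 0 := fun h => hx.2 (by simp [h])
    refine (((hasDerivAt_id x).fun_mul (hasDerivAt_abs_rpow (c := c) hx0)).div_const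
      (c + 1)).congr_deriv ?_
    have e : |x| ^ c = |x| ^ (c - 2) * x ^ 2 := by
      rw [← sq_abs, ← Real.rpow_natCast |x| 2, ← Real.rpow_add (abs_pos.2 hx0)]
      norm_num
    rw [div_eq_iff hc1, e]
    simp only [id]
    ring

lemma integral_mul_abs_rpow {c : ℝ} (hc : -1 < c) (a b : ℝ) :
    ∫ x in a..b, x * |x| ^ c = (|b| ^ (c + 2) - |a| ^ (c + 2)) / (c + 2) := by
  have hc1 : c + 2 ≠ 0 := by linarith
  have h := integral_eq_of_hasDerivAt_off_countable (fun x : ℝ => |x| ^ (c + 2) / (c + 2))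
    (fun x => x * |x| ^ c) (countable_singleton (0 : ℝ)) (a := a) (b := b)
    ((continuous_abs.rpow_const fun _ => Or.inr (by linarith)).div_const _).continuousOn ?_
    ((continuous_mul_abs_rpow hc).intervalIntegrable a b)
  · rw [h]; ring
  · intro x hx
    have hx0 : x ≠ 0 := fun h => hx.2 (by simp [h])
    refine ((hasDerivAt_abs_rpow (c := c + 2) hx0).div_const (c + 2)).congr_deriv ?_
    rw [add_sub_cancel_right]
    field_simp

/-- The potential `∫_0^τ |u - v|^{2H-2} dv`. -/
def fbmPot (H τ u : ℝ) : ℝ := ∫ v in Icc 0 τ, |u - v| ^ (2 * H - 2)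

lemma fbmPot_eq {H : ℝ} (hH : 1 / 2 < H) {τ : ℝ} (hτ : 0 ≤ τ) (u : ℝ) :
    fbmPot H τ u = (u * |u| ^ (2 * H - 2) - (u - τ) * |u - τ| ^ (2 * H - 2)) / (2 * H - 1) := by
  rw [fbmPot, integral_Icc_eq_integral_Ioc, ← intervalIntegral.integral_of_le hτ,
    intervalIntegral.integral_comp_sub_left (fun x => |x| ^ (2 * H - 2)),
    integral_abs_rpow (by linarith), sub_zero]
  ring_nf

lemma integrableOn_fbmKernel {H : ℝ} (hH : 1 / 2 < H) (τ u : ℝ) :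
    IntegrableOn (fun v => |u - v| ^ (2 * H - 2)) (Icc 0 τ) := by
  rcases le_total 0 τ with hτ | hτ
  · rw [integrableOn_Icc_iff_integrableOn_Ioc, ← intervalIntegrable_iff_integrableOn_Ioc_of_le hτ]
    have := (intervalIntegrable_abs_rpow (c := 2 * H - 2) (by linarith) (u - 0) (u - τ)).comp_sub_left u
    simpa using this
  · rw [IntegrableOn, Measure.restrict_eq_zero.2 (by rw [Real.volume_Icc]; simpa using hτ)]
    exact integrable_zero_measure

lemma continuous_fbmPot {H : ℝ} (hH : 1 / 2 < H) {τ : ℝ} (hτ : 0 ≤ τ) : Continuous (fbmPot H τ) := by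
  rw [show fbmPot H τ = _ from funext (fbmPot_eq hH hτ)]
  have h := continuous_mul_abs_rpow (c := 2 * H - 2) (by linarith)
  exact (h.sub (h.comp (continuous_id.sub continuous_const))).div_const _

lemma exists_fbmPot_le {H : ℝ} (hH : 1 / 2 < H) {t : ℝ} (ht : 0 ≤ t) :
    ∃ C, 0 ≤ C ∧ ∀ u ∈ Icc 0 t, ∀ τ ≤ t, fbmPot H τ u ≤ C := by
  obtain ⟨C, hC⟩ := isCompact_Icc.exists_bound_of_continuousOn
    (continuous_fbmPot hH ht).continuousOn (s := Icc 0 t)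
  refine ⟨C, (norm_nonneg _).trans (hC 0 ⟨le_rfl, ht⟩), fun u hu τ hτ => ?_⟩
  refine le_trans ?_ ((le_abs_self _).trans (hC u hu))
  exact setIntegral_mono_set (integrableOn_fbmKernel hH t u)
    (Eventually.of_forall fun _ => by positivity) (Icc_subset_Icc_right hτ).eventuallyLE

/-- The mixed second derivative of the covariance is H(2H-1)|u-v|^(2H-2), integrable because H >
1/2. This identity is the link between fractional Brownian motion and the |𝓗| norm. -/
lemma fbmCov_eq {H : ℝ} (hH : 1 / 2 < H) {t s : ℝ} (ht : 0 ≤ t) (hs : 0 ≤ s) :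
    (t ^ (2 * H) + s ^ (2 * H) - |t - s| ^ (2 * H)) / 2 =
      H * (2 * H - 1) * ∫ u in Icc 0 t, fbmPot H s u := by
  have hc : -1 < 2 * H - 2 := by linarith
  have h1 := (continuous_mul_abs_rpow hc).intervalIntegrable (μ := volume)
  have h1' : Continuous fun x : ℝ => (x - s) * |x - s| ^ (2 * H - 2) :=
    (continuous_mul_abs_rpow hc).comp (continuous_id.sub continuous_const)
  rw [integral_Icc_eq_integral_Ioc, ← intervalIntegral.integral_of_le ht]
  simp_rw [fbmPot_eq hH hs]
  rw [intervalIntegral.integral_div, intervalIntegral.integral_sub (h1 _ _)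
    (h1'.intervalIntegrable _ _),
    intervalIntegral.integral_comp_sub_right (fun x => x * |x| ^ (2 * H - 2)),
    integral_mul_abs_rpow hc, integral_mul_abs_rpow hc, abs_zero, zero_sub, abs_neg,
    abs_of_nonneg ht, abs_of_nonneg hs, sub_add_cancel, Real.zero_rpow (by linarith)]
  have h2 : 2 * H - 1 ≠ 0 := by linarith
  have h3 : H ≠ 0 := by linarith
  field_simp
  ring

/-! ### Elementary integrals of step functions -/

section StepFun

variable {X Ω : Type*} [NormedAddCommGroup X]

/-- The difference of two step functions. -/
def StepFun.sub (σ ρ : StepFun X) : StepFun X where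
  n := σ.n + ρ.n
  τ := Fin.append σ.τ ρ.τ
  c := Fin.append σ.c (fun i => - ρ.c i)

lemma StepFun.toFun_sub (σ ρ : StepFun X) (s : ℝ) :
    (σ.sub ρ).toFun s = σ.toFun s - ρ.toFun s := by
  unfold StepFun.toFun StepFun.sub
  rw [Fin.sum_univ_add, sub_eq_add_neg, ← Finset.sum_neg_distrib]
  simp only [Fin.append_left, Fin.append_right, Set.indicator_apply]
  congr 1
  refine Finset.sum_congr rfl fun i _ => ?_
  split_ifs <;> simp

lemma StepFun.sub_τ_le {σ ρ : StepFun X} {t : ℝ} (hσ : ∀ i, (σ.τ i : ℝ) ≤ t)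
    (hρ : ∀ i, (ρ.τ i : ℝ) ≤ t) (i) : ((σ.sub ρ).τ i : ℝ) ≤ t := by
  change ((Fin.append σ.τ ρ.τ) i : ℝ) ≤ t
  induction i using Fin.addCases with
  | left i => simpa using hσ i
  | right i => simpa using hρ i

lemma StepFun.measurable_toFun (σ : StepFun X) : StronglyMeasurable σ.toFun := by
  unfold StepFun.toFun
  refine Finset.stronglyMeasurable_fun_sum _ fun i _ => ?_
  exact stronglyMeasurable_const.indicator measurableSet_Icc

lemma StepFun.memLp_toFun (σ : StepFun X) (p : ℝ≥0∞) (μ : Measure ℝ) [IsFiniteMeasure μ] :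
    MemLp σ.toFun p μ := by
  unfold StepFun.toFun
  exact memLp_finsetSum _ fun i _ => (memLp_const _).indicator measurableSet_Icc

/-- `|𝓗|` is controlled by `L²`. -/
lemma exists_absHNormSq_le {H : ℝ} (hH : 1 / 2 < H) {t : ℝ} (ht : 0 ≤ t) :
    ∃ C : ℝ≥0, ∀ ψ : ℝ → X, AEStronglyMeasurable ψ (volume.restrict (Icc 0 t)) →
      absHNormSq H t ψ ≤ C * ∫⁻ u in Icc 0 t, ‖ψ u‖ₑ ^ 2 := by
  obtain ⟨C, hC0, hC⟩ := exists_fbmPot_le hH ht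
  refine ⟨(H * (2 * H - 1)).toNNReal * C.toNNReal, fun ψ hψ => ?_⟩
  have hpot : ∀ u ∈ Icc 0 t, ∫⁻ v in Icc 0 t, ENNReal.ofReal (|u - v| ^ (2 * H - 2)) ≤
      ENNReal.ofReal C := by
    intro u hu
    rw [← ofReal_integral_eq_lintegral_ofReal (integrableOn_fbmKernel hH t u)
      (Eventually.of_forall fun _ => by positivity)]
    exact ENNReal.ofReal_le_ofReal (hC u hu t le_rfl)
  have hk : Measurable fun p : ℝ × ℝ => ENNReal.ofReal (|p.1 - p.2| ^ (2 * H - 2)) := by fun_prop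
  have hn : AEMeasurable (fun u => ‖ψ u‖ₑ ^ 2) (volume.restrict (Icc 0 t)) := hψ.enorm.pow_const 2
  have e1 : ∫⁻ u in Icc 0 t, ∫⁻ v in Icc 0 t,
      ‖ψ u‖ₑ ^ 2 * ENNReal.ofReal (|u - v| ^ (2 * H - 2)) ≤
      ENNReal.ofReal C * ∫⁻ u in Icc 0 t, ‖ψ u‖ₑ ^ 2 := by
    rw [← lintegral_const_mul'' _ hn]
    refine setLIntegral_mono_ae' measurableSet_Icc (Eventually.of_forall fun u hu => ?_)
    rw [lintegral_const_mul' _ _ (by simp), mul_comm]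
    gcongr
    exact hpot u hu
  have e2 : ∫⁻ u in Icc 0 t, ∫⁻ v in Icc 0 t,
      ‖ψ v‖ₑ ^ 2 * ENNReal.ofReal (|u - v| ^ (2 * H - 2)) ≤
      ENNReal.ofReal C * ∫⁻ u in Icc 0 t, ‖ψ u‖ₑ ^ 2 := by
    rw [lintegral_lintegral_swap]
    · refine le_trans (le_of_eq ?_) e1
      simp_rw [abs_sub_comm]
    · exact hn.comp_snd.mul hk.aemeasurable
  -- Schur's test: replace ‖ψ(u)‖‖ψ(v)‖ by half the sum of squares; by symmetry of the kernel both
  -- halves are controlled by the bounded potential.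
  have e3 : ∫⁻ u in Icc 0 t, ∫⁻ v in Icc 0 t,
      ‖ψ u‖ₑ * ‖ψ v‖ₑ * ENNReal.ofReal (|u - v| ^ (2 * H - 2)) ≤
      2⁻¹ * (∫⁻ u in Icc 0 t, ∫⁻ v in Icc 0 t,
      (‖ψ u‖ₑ ^ 2 * ENNReal.ofReal (|u - v| ^ (2 * H - 2)) +
        ‖ψ v‖ₑ ^ 2 * ENNReal.ofReal (|u - v| ^ (2 * H - 2)))) := by
    rw [← lintegral_const_mul' _ _ (by simp)]
    refine lintegral_mono fun u => ?_
    rw [← lintegral_const_mul' _ _ (by simp)]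
    refine lintegral_mono fun v => ?_
    rw [← add_mul, ← mul_assoc]
    refine mul_le_mul_left ?_ _
    have : ‖ψ u‖₊ * ‖ψ v‖₊ ≤ 2⁻¹ * (‖ψ u‖₊ ^ 2 + ‖ψ v‖₊ ^ 2) := by
      rw [← NNReal.coe_le_coe]; push_cast
      nlinarith [sq_nonneg (‖ψ u‖ - ‖ψ v‖)]
    simp only [enorm_eq_nnnorm]
    rw [show (2⁻¹ : ℝ≥0∞) = ((2⁻¹ : ℝ≥0) : ℝ≥0∞) by simp]
    exact_mod_cast this
  have e4 : ∫⁻ u in Icc 0 t, ∫⁻ v in Icc 0 t,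
      (‖ψ u‖ₑ ^ 2 * ENNReal.ofReal (|u - v| ^ (2 * H - 2)) +
        ‖ψ v‖ₑ ^ 2 * ENNReal.ofReal (|u - v| ^ (2 * H - 2))) ≤
      2 * (ENNReal.ofReal C * ∫⁻ u in Icc 0 t, ‖ψ u‖ₑ ^ 2) := by
    have : ∀ u, ∫⁻ v in Icc 0 t, (‖ψ u‖ₑ ^ 2 * ENNReal.ofReal (|u - v| ^ (2 * H - 2)) +
        ‖ψ v‖ₑ ^ 2 * ENNReal.ofReal (|u - v| ^ (2 * H - 2))) =
        (∫⁻ v in Icc 0 t, ‖ψ u‖ₑ ^ 2 * ENNReal.ofReal (|u - v| ^ (2 * H - 2))) +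
        ∫⁻ v in Icc 0 t, ‖ψ v‖ₑ ^ 2 * ENNReal.ofReal (|u - v| ^ (2 * H - 2)) := fun u =>
      lintegral_add_left ((hk.comp measurable_prodMk_left).const_mul _) _
    simp_rw [this]
    rw [lintegral_add_left', two_mul (ENNReal.ofReal C * _)]
    · exact add_le_add e1 e2
    · have : AEMeasurable (fun p : ℝ × ℝ => ‖ψ p.1‖ₑ ^ 2 * ENNReal.ofReal (|p.1 - p.2| ^ (2 * H - 2)))
          ((volume.restrict (Icc 0 t)).prod (volume.restrict (Icc 0 t))) :=
        hn.comp_fst.mul hk.aemeasurable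
      exact this.lintegral_prod_right'
  unfold absHNormSq
  have e5 : (2⁻¹ : ℝ≥0∞) * 2 = 1 := ENNReal.inv_mul_cancel (by simp) (by simp)
  calc _ ≤ ENNReal.ofReal (H * (2 * H - 1)) *
        (2⁻¹ * (2 * (ENNReal.ofReal C * ∫⁻ u in Icc 0 t, ‖ψ u‖ₑ ^ 2))) := by
        gcongr; exact e3.trans (by gcongr)
    _ = _ := by
        rw [← mul_assoc 2⁻¹, e5, one_mul, ← mul_assoc]; rfl

variable [InnerProductSpace ℝ X] [MeasurableSpace Ω] {P : Measure Ω}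

lemma IsFBM.memLp {H : ℝ} {β : ℝ≥0 → Ω → ℝ} (hβ : IsFBM H β P) (t : ℝ≥0) : MemLp (β t) 2 P :=
  (hβ.gaussian.hasGaussianLaw_eval t).memLp_two

lemma StepFun.memLp_integral (σ : StepFun X) {β : ℝ≥0 → Ω → ℝ} (hβ : ∀ t, MemLp (β t) 2 P) :
    MemLp (σ.integral β) 2 P := by
  unfold StepFun.integral
  exact memLp_finsetSum _ fun i _ =>
    (ContinuousLinearMap.toSpanSingleton ℝ (σ.c i)).comp_memLp' (hβ _)

/-- The elementary integral of a step function as an element of `L²`. -/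
def StepFun.toLp (σ : StepFun X) {β : ℝ≥0 → Ω → ℝ} (hβ : ∀ t, MemLp (β t) 2 P) : Lp X 2 P :=
  (σ.memLp_integral hβ).toLp

lemma StepFun.toLp_sub (σ ρ : StepFun X) {β : ℝ≥0 → Ω → ℝ} (hβ : ∀ t, MemLp (β t) 2 P) :
    (σ.sub ρ).toLp hβ = σ.toLp hβ - ρ.toLp hβ := by
  unfold StepFun.toLp
  rw [← MemLp.toLp_sub]
  congr 1
  ext ω
  change ∑ i : Fin (σ.n + ρ.n), β (Fin.append σ.τ ρ.τ i) ω • Fin.append σ.c (fun i => -ρ.c i) i =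
    ∑ i, β (σ.τ i) ω • σ.c i - ∑ i, β (ρ.τ i) ω • ρ.c i
  rw [Fin.sum_univ_add]
  simp [Fin.append_left, Fin.append_right, sub_eq_add_neg]

lemma StepFun.inner_toLp (σ ρ : StepFun X) {β γ : ℝ≥0 → Ω → ℝ} (hβ : ∀ t, MemLp (β t) 2 P)
    (hγ : ∀ t, MemLp (γ t) 2 P) :
    inner ℝ (σ.toLp hβ) (ρ.toLp hγ) =
      ∑ i, ∑ j, (∫ ω, β (σ.τ i) ω * γ (ρ.τ j) ω ∂P) * inner ℝ (σ.c i) (ρ.c j) := by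
  rw [L2.inner_def]
  have h1 : ∀ᵐ ω ∂P, inner ℝ (σ.toLp hβ ω) (ρ.toLp hγ ω) =
      ∑ i, ∑ j, (β (σ.τ i) ω * γ (ρ.τ j) ω) * inner ℝ (σ.c i) (ρ.c j) := by
    filter_upwards [(σ.memLp_integral hβ).coeFn_toLp, (ρ.memLp_integral hγ).coeFn_toLp] with ω e1 e2
    rw [StepFun.toLp, StepFun.toLp, e1, e2, StepFun.integral, StepFun.integral, sum_inner]
    refine Finset.sum_congr rfl fun i _ => ?_
    rw [inner_sum]
    refine Finset.sum_congr rfl fun j _ => ?_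
    rw [real_inner_smul_left, real_inner_smul_right]; ring
  have hint : ∀ i j, Integrable (fun ω => (β (σ.τ i) ω * γ (ρ.τ j) ω) * inner ℝ (σ.c i) (ρ.c j)) P :=
    fun i j => ((hβ _).integrable_mul (hγ _)).mul_const _
  rw [integral_congr_ae h1, integral_finsetSum _ fun i _ => integrable_finsetSum _ fun j _ => hint i j]
  refine Finset.sum_congr rfl fun i _ => ?_
  rw [integral_finsetSum _ fun j _ => hint i j]
  exact Finset.sum_congr rfl fun j _ => integral_mul_const _ _

/-- The potential `∫ |u - v|^{2H-2} σ(v) dv` of a step function. -/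
def StepFun.pot (H : ℝ) (σ : StepFun X) (u : ℝ) : X := ∑ j, fbmPot H (σ.τ j) u • σ.c j

lemma StepFun.continuous_pot {H : ℝ} (hH : 1 / 2 < H) (σ : StepFun X) : Continuous (σ.pot H) := by
  unfold StepFun.pot
  exact continuous_finsetSum _ fun j _ =>
    (continuous_fbmPot hH (σ.τ j).coe_nonneg).smul continuous_const

lemma StepFun.pot_eq_integral {H : ℝ} (hH : 1 / 2 < H) (σ : StepFun X) [CompleteSpace X] {t : ℝ}
    (hσ : ∀ i, (σ.τ i : ℝ) ≤ t) (u : ℝ) :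
    σ.pot H u = ∫ v in Icc 0 t, |u - v| ^ (2 * H - 2) • σ.toFun v := by
  have h : ∀ v, |u - v| ^ (2 * H - 2) • σ.toFun v = ∑ j, (Icc (0 : ℝ) (σ.τ j)).indicator
      (fun v => |u - v| ^ (2 * H - 2) • σ.c j) v := by
    intro v
    rw [StepFun.toFun, Finset.smul_sum]
    refine Finset.sum_congr rfl fun j _ => ?_
    simp only [Set.indicator_apply]; split_ifs <;> simp
  simp_rw [h]
  rw [integral_finsetSum _ fun j _ => (((integrableOn_fbmKernel hH t u).smul_const
    (σ.c j)).indicator measurableSet_Icc)]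
  refine Finset.sum_congr rfl fun j _ => ?_
  rw [integral_indicator measurableSet_Icc, Measure.restrict_restrict measurableSet_Icc,
    inter_eq_left.2 (Icc_subset_Icc_right (hσ j)), integral_smul_const, fbmPot]

/-- Writing the covariance form as a pairing with the continuous potential of ρ shows that, for
fixed ρ, the inner product is controlled by the L¹ norm of σ. The uniqueness of Wiener integrals
rests on this. -/
lemma IsFBM.inner_toLp {H : ℝ} (hH : 1 / 2 < H) {β : ℝ≥0 → Ω → ℝ} (hβ : IsFBM H β P)
    (σ ρ : StepFun X) {t : ℝ} (hσ : ∀ i, (σ.τ i : ℝ) ≤ t) :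
    inner ℝ (σ.toLp hβ.memLp) (ρ.toLp hβ.memLp) =
      H * (2 * H - 1) * ∫ u in Icc 0 t, inner ℝ (σ.toFun u) (ρ.pot H u) := by
  have h : ∀ u, inner ℝ (σ.toFun u) (ρ.pot H u) = ∑ i, ∑ j, (Icc (0 : ℝ) (σ.τ i)).indicator
      (fun u => fbmPot H (ρ.τ j) u * inner ℝ (σ.c i) (ρ.c j)) u := by
    intro u
    rw [StepFun.toFun, StepFun.pot, sum_inner]
    refine Finset.sum_congr rfl fun i _ => ?_
    rw [inner_sum]
    refine Finset.sum_congr rfl fun j _ => ?_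
    simp only [Set.indicator_apply]; split_ifs <;> simp [real_inner_smul_right]
  have hint : ∀ i j, Integrable ((Icc (0 : ℝ) (σ.τ i)).indicator
      (fun u => fbmPot H (ρ.τ j) u * inner ℝ (σ.c i) (ρ.c j))) (volume.restrict (Icc 0 t)) := by
    intro i j
    refine Integrable.indicator ?_ measurableSet_Icc
    exact ((continuous_fbmPot hH (ρ.τ j).coe_nonneg).mul continuous_const).continuousOn.integrableOn_Icc
  simp_rw [h]
  rw [StepFun.inner_toLp, integral_finsetSum _ fun i _ => integrable_finsetSum _ fun j _ => hint i j,
    Finset.mul_sum]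
  refine Finset.sum_congr rfl fun i _ => ?_
  rw [integral_finsetSum _ fun j _ => hint i j, Finset.mul_sum]
  refine Finset.sum_congr rfl fun j _ => ?_
  rw [hβ.cov, fbmCov_eq hH (σ.τ i).coe_nonneg (ρ.τ j).coe_nonneg, integral_indicator measurableSet_Icc,
    Measure.restrict_restrict measurableSet_Icc, inter_eq_left.2 (Icc_subset_Icc_right (hσ i)),
    integral_mul_const]
  ring

/-- By independence each mixed moment factors into means, and those of β vanish. -/
lemma inner_toLp_eq_zero_of_indep {β γ : ℝ≥0 → Ω → ℝ}
    (hβ : ∀ t, MemLp (β t) 2 P) (hγ : ∀ t, MemLp (γ t) 2 P) (hβ0 : ∀ t, ∫ ω, β t ω ∂P = 0)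
    (hind : IndepFun (fun ω t => β t ω) (fun ω t => γ t ω) P) (σ ρ : StepFun X) :
    inner ℝ (σ.toLp hβ) (ρ.toLp hγ) = 0 := by
  rw [StepFun.inner_toLp]
  refine Finset.sum_eq_zero fun i _ => Finset.sum_eq_zero fun j _ => ?_
  have h := (hind.comp (measurable_pi_apply (σ.τ i)) (measurable_pi_apply (ρ.τ j)))
  have h2 := h.integral_mul_eq_mul_integral (hβ _).1 (hγ _).1
  have : ∫ ω, β (σ.τ i) ω * γ (ρ.τ j) ω ∂P = (∫ ω, β (σ.τ i) ω ∂P) * ∫ ω, γ (ρ.τ j) ω ∂P := h2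
  rw [this, hβ0, zero_mul, zero_mul]

/-- The |𝓗| norm has norms inside the double integral, so it dominates the covariance form by the
triangle and Cauchy–Schwarz inequalities. -/
lemma IsFBM.enorm_toLp_sq_le {H : ℝ} (hH : 1 / 2 < H) {β : ℝ≥0 → Ω → ℝ} (hβ : IsFBM H β P)
    [CompleteSpace X] (σ : StepFun X) {t : ℝ} (hσ : ∀ i, (σ.τ i : ℝ) ≤ t) :
    ‖σ.toLp hβ.memLp‖ₑ ^ 2 ≤ absHNormSq H t σ.toFun := by
  have hc : 0 ≤ H * (2 * H - 1) := mul_nonneg (by linarith) (by linarith)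
  have h0 : ‖σ.toLp hβ.memLp‖ₑ ^ 2 = ENNReal.ofReal (‖σ.toLp hβ.memLp‖ ^ 2) := by
    rw [ENNReal.ofReal_pow (norm_nonneg _), ofReal_norm]
  rw [h0, ← real_inner_self_eq_norm_sq, hβ.inner_toLp hH σ σ hσ, ENNReal.ofReal_mul hc, absHNormSq]
  gcongr
  refine (ENNReal.ofReal_le_ofReal (le_abs_self _)).trans ?_
  rw [← Real.enorm_eq_ofReal_abs]
  refine (enorm_integral_le_lintegral_enorm _).trans ?_
  refine lintegral_mono fun u => ?_
  have h1 : ‖(inner ℝ (σ.toFun u) (σ.pot H u) : ℝ)‖ₑ ≤ ‖σ.toFun u‖ₑ * ‖σ.pot H u‖ₑ := by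
    have := norm_inner_le_norm (𝕜 := ℝ) (σ.toFun u) (σ.pot H u)
    simp only [enorm_eq_nnnorm]
    exact_mod_cast this
  refine h1.trans ?_
  simp only [mul_assoc]
  rw [lintegral_const_mul' _ _ (by simp)]
  gcongr
  rw [σ.pot_eq_integral hH hσ]
  refine (enorm_integral_le_lintegral_enorm _).trans (le_of_eq (lintegral_congr fun v => ?_))
  rw [enorm_smul, mul_comm, Real.enorm_of_nonneg (by positivity)]

end StepFun

/-! ### Density of step functions -/

section Density

variable {X : Type*} [NormedAddCommGroup X]

/-- The step function that interpolates `g` at the right end points of `N` equal subintervals of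
`[0,t]`. -/
def StepFun.interp (g : ℝ → X) (t : ℝ≥0) (N : ℕ) : StepFun X where
  n := N
  τ i := t * (i + 1) / N
  -- Every indicator starts at 0, so the value on a cell is the sum of all later coefficients;
  -- differences make this sum telescope to the value of g at the right end of the cell.
  c i := g (t * (i + 1) / N) - if (i : ℕ) + 1 < N then g (t * (i + 2) / N) else 0

lemma StepFun.interp_τ_le (g : ℝ → X) (t : ℝ≥0) (N : ℕ) (i : Fin N) :
    (((StepFun.interp g t N).τ i : ℝ≥0) : ℝ) ≤ t := by
  have hN : (0 : ℝ) < N := by exact_mod_cast (Nat.zero_le _).trans_lt i.2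
  have hi : (i : ℝ) + 1 ≤ N := by exact_mod_cast i.2
  simp only [StepFun.interp]
  push_cast
  rw [div_le_iff₀ hN]
  gcongr

lemma StepFun.exists_interp_eq (g : ℝ → X) (t : ℝ≥0) {N : ℕ} (hN : 0 < N) {s : ℝ}
    (hs : s ∈ Icc 0 (t : ℝ)) :
    ∃ r ∈ Icc 0 (t : ℝ), |s - r| ≤ t / N ∧ (StepFun.interp g t N).toFun s = g r := by
  have hN' : (0 : ℝ) < N := by exact_mod_cast hN
  have hex : ∃ i : ℕ, s ≤ t * (i + 1) / N := by
    refine ⟨N - 1, ?_⟩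
    have : (((N - 1 : ℕ) : ℝ) + 1) = N := by
      rw [Nat.cast_sub (by omega)]; push_cast; ring
    rw [this, mul_div_assoc, div_self hN'.ne', mul_one]
    exact hs.2
  classical
  -- The index of the cell that contains s; the point 0 belongs to cell 0.
  set j := Nat.find hex with hj
  have hj1 : s ≤ t * (j + 1) / N := Nat.find_spec hex
  have hjN : j < N := by
    have : j ≤ N - 1 := Nat.find_min' hex (by
      have : (((N - 1 : ℕ) : ℝ) + 1) = N := by
        rw [Nat.cast_sub (by omega)]; push_cast; ring
      rw [this, mul_div_assoc, div_self hN'.ne', mul_one]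
      exact hs.2)
    omega
  have hj2 : (t : ℝ) * j / N ≤ s := by
    rcases Nat.eq_zero_or_pos j with h | h
    · rw [h]; simpa using hs.1
    · have := Nat.find_min hex (m := j - 1) (by omega)
      push Not at this
      rw [Nat.cast_sub (by omega)] at this
      push_cast at this
      rw [sub_add_cancel] at this
      exact this.le
  have ht0 : (0 : ℝ) ≤ t := t.coe_nonneg
  have hmono : ∀ i : ℕ, s ≤ t * (i + 1) / N ↔ j ≤ i := by
    intro i
    refine ⟨fun h => Nat.find_min' hex h, fun h => hj1.trans ?_⟩
    have : (j : ℝ) ≤ i := by exact_mod_cast h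
    gcongr
  refine ⟨t * (j + 1) / N, ⟨by positivity, ?_⟩, ?_, ?_⟩
  · rw [div_le_iff₀ hN']
    have : (j : ℝ) + 1 ≤ N := by exact_mod_cast hjN
    gcongr
  · rw [abs_le]
    have : (t : ℝ) * (j + 1) / N = t * j / N + t / N := by ring
    constructor <;> linarith [show (0 : ℝ) ≤ t / N by positivity]
  · set G : ℕ → X := fun i => if i < N then g (t * (i + 1) / N) else 0 with hG
    have h1 : (StepFun.interp g t N).toFun s =
        ∑ i : Fin N, if j ≤ (i : ℕ) then G i - G (i + 1) else 0 := by
      change ∑ i : Fin N, (Icc (0 : ℝ) ((t * (i + 1) / N : ℝ≥0) : ℝ)).indicator (fun _ =>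
        g (t * (i + 1) / N) - if (i : ℕ) + 1 < N then g (t * (i + 2) / N) else 0) s = _
      refine Finset.sum_congr rfl fun i _ => ?_
      have hi : s ∈ Icc (0 : ℝ) ((t * (i + 1) / N : ℝ≥0) : ℝ) ↔ j ≤ (i : ℕ) := by
        rw [← hmono i, mem_Icc]
        push_cast
        exact and_iff_right hs.1
      rw [Set.indicator_apply]
      simp only [hi, hG, i.2, if_true]
      have : ((((i : ℕ) + 1 : ℕ) : ℝ) + 1) = (i : ℝ) + 2 := by push_cast; ring
      rw [this]
    rw [h1, Fin.sum_univ_eq_sum_range (fun i => if j ≤ i then G i - G (i + 1) else 0) N,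
      ← Finset.sum_filter]
    have h2 : (Finset.range N).filter (fun i => j ≤ i) = Finset.Ico j N := by
      ext i; simp [and_comm]
    -- The telescoping sum is `G j - G N`, and `G N` is 0 by definition.
    rw [h2, Finset.sum_Ico_eq_sub _ hjN.le, Finset.sum_range_sub', Finset.sum_range_sub']
    simp [hG, hjN]

lemma StepFun.exists_uniform_approx {g : ℝ → X} (hg : Continuous g) (t : ℝ≥0) {ε : ℝ}
    (hε : 0 < ε) : ∃ σ : StepFun X, (∀ i, (σ.τ i : ℝ) ≤ t) ∧
      ∀ s ∈ Icc 0 (t : ℝ), ‖σ.toFun s - g s‖ ≤ ε := by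
  have huc := isCompact_Icc.uniformContinuousOn_of_continuous
    (hg.continuousOn (s := Icc 0 (t : ℝ)))
  rw [Metric.uniformContinuousOn_iff] at huc
  obtain ⟨δ, hδ, h⟩ := huc ε hε
  obtain ⟨N, hN⟩ := exists_nat_gt ((t : ℝ) / δ)
  have hN0 : (0 : ℝ) < N := lt_of_le_of_lt (by positivity) hN
  refine ⟨StepFun.interp g t N, StepFun.interp_τ_le g t N, fun s hs => ?_⟩
  obtain ⟨r, hr, hsr, e⟩ := StepFun.exists_interp_eq g t (N := N) (by exact_mod_cast hN0) hs
  rw [e, ← dist_eq_norm]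
  refine (h r hr s hs ?_).le
  rw [dist_comm, Real.dist_eq]
  refine hsr.trans_lt ?_
  rw [div_lt_iff₀ hN0]
  rw [div_lt_iff₀ hδ] at hN
  linarith

lemma StepFun.exists_tendsto_eLpNorm [NormedSpace ℝ X] (t : ℝ≥0) {ψ : ℝ → X}
    (hψ : MemLp ψ 2 (volume.restrict (Icc 0 (t : ℝ)))) :
    ∃ σ : ℕ → StepFun X, (∀ k i, ((σ k).τ i : ℝ) ≤ t) ∧
      Tendsto (fun k => eLpNorm (fun s => (σ k).toFun s - ψ s) 2
        (volume.restrict (Icc 0 (t : ℝ)))) atTop (𝓝 0) := by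
  set μ := volume.restrict (Icc 0 (t : ℝ)) with hμ
  -- The square root of the length of the interval converts a uniform bound into an L² bound.
  set K : ℝ≥0∞ := μ univ ^ (2 : ℝ≥0∞).toReal⁻¹ with hK
  have hKt : K ≠ ∞ := by
    refine ENNReal.rpow_ne_top_of_nonneg (by simp) (measure_ne_top _ _)
  have key : ∀ k : ℕ, ∃ σ : StepFun X, (∀ i, (σ.τ i : ℝ) ≤ t) ∧
      eLpNorm (fun s => σ.toFun s - ψ s) 2 μ ≤ (K + 1) * ENNReal.ofReal (1 / ((k : ℝ) + 1)) := by
    intro k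
    have hk : 0 < 1 / ((k : ℝ) + 1) := by positivity
    obtain ⟨g, hg, hgm⟩ := hψ.exists_boundedContinuous_eLpNorm_sub_le (by simp)
      (ε := ENNReal.ofReal (1 / ((k : ℝ) + 1))) (by simpa using by positivity)
    obtain ⟨σ, hσ, hσg⟩ := StepFun.exists_uniform_approx g.continuous t hk
    refine ⟨σ, hσ, ?_⟩
    have e : (fun s => σ.toFun s - ψ s) = (fun s => σ.toFun s - g s) + fun s => g s - ψ s := by
      ext s; simp
    have h1 : eLpNorm (fun s => σ.toFun s - g s) 2 μ ≤ K * ENNReal.ofReal (1 / ((k : ℝ) + 1)) := by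
      refine eLpNorm_le_of_ae_bound ?_
      filter_upwards [ae_restrict_mem measurableSet_Icc] with s hs using hσg s hs
    have h2 : eLpNorm (fun s => g s - ψ s) 2 μ ≤ ENNReal.ofReal (1 / ((k : ℝ) + 1)) := by
      rw [eLpNorm_sub_comm] at hg
      exact hg
    rw [e, add_mul, one_mul]
    refine (eLpNorm_add_le ?_ ?_ (by norm_num)).trans (add_le_add h1 h2)
    · exact (σ.measurable_toFun.aestronglyMeasurable).sub hgm.1
    · exact hgm.1.sub hψ.1
  choose σ hσ hσ' using key
  refine ⟨σ, hσ, tendsto_of_tendsto_of_tendsto_of_le_of_le tendsto_const_nhds ?_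
    (fun _ => zero_le) hσ'⟩
  have h0 : Tendsto (fun k : ℕ => ENNReal.ofReal (1 / ((k : ℝ) + 1))) atTop (𝓝 0) := by
    have := ENNReal.tendsto_ofReal (tendsto_one_div_add_atTop_nhds_zero_nat (𝕜 := ℝ))
    simpa using this
  have := ENNReal.Tendsto.const_mul h0 (a := K + 1) (Or.inr (by simp [hKt]))
  simpa using this

end Density

lemma eLpNorm_two_sq {α E : Type*} [MeasurableSpace α] [NormedAddCommGroup E] (f : α → E)
    (μ : Measure α) : eLpNorm f 2 μ ^ 2 = ∫⁻ x, ‖f x‖ₑ ^ 2 ∂μ := by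
  have := eLpNorm_nnreal_pow_eq_lintegral (f := f) (μ := μ) (p := 2) (by norm_num)
  simpa using this

/-! ### Wiener integrals of square integrable functions -/

section Wiener

variable {X Ω : Type*} [NormedAddCommGroup X] [InnerProductSpace ℝ X] [MeasurableSpace Ω]
  {P : Measure Ω}

/-- `I` is the limit of the elementary integrals of step functions on `[0,t]` that converge to `ψ`
in `L²(0,t; X)`. -/
def IsL2Wiener {β : ℝ≥0 → Ω → ℝ} (hβ : ∀ t, MemLp (β t) 2 P) (t : ℝ) (ψ : ℝ → X)
    (I : Lp X 2 P) : Prop :=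
  AEStronglyMeasurable ψ (volume.restrict (Icc 0 t)) ∧
  ∃ σ : ℕ → StepFun X, (∀ k i, ((σ k).τ i : ℝ) ≤ t) ∧
    Tendsto (fun k => eLpNorm (fun s => (σ k).toFun s - ψ s) 2 (volume.restrict (Icc 0 t)))
      atTop (𝓝 0) ∧
    Tendsto (fun k => (σ k).toLp hβ) atTop (𝓝 I)

lemma IsFBM.exists_enorm_toLp_le [CompleteSpace X] {H : ℝ} (hH : 1 / 2 < H) {β : ℝ≥0 → Ω → ℝ}
    (hβ : IsFBM H β P) {C : ℝ≥0} {t : ℝ}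
    (hC : ∀ ψ : ℝ → X, AEStronglyMeasurable ψ (volume.restrict (Icc 0 t)) →
      absHNormSq H t ψ ≤ C * ∫⁻ u in Icc 0 t, ‖ψ u‖ₑ ^ 2)
    (σ : StepFun X) (hσ : ∀ i, (σ.τ i : ℝ) ≤ t) :
    ‖σ.toLp hβ.memLp‖ₑ ^ 2 ≤ C * eLpNorm σ.toFun 2 (volume.restrict (Icc 0 t)) ^ 2 := by
  rw [eLpNorm_two_sq]
  exact (hβ.enorm_toLp_sq_le hH σ hσ).trans (hC _ σ.measurable_toFun.aestronglyMeasurable)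

lemma IsFBM.exists_isL2Wiener [CompleteSpace X] {H : ℝ} (hH : 1 / 2 < H) {β : ℝ≥0 → Ω → ℝ}
    (hβ : IsFBM H β P) {t : ℝ} (ht : 0 ≤ t) {ψ : ℝ → X}
    (hψ : MemLp ψ 2 (volume.restrict (Icc 0 t))) : ∃ I : Lp X 2 P, IsL2Wiener hβ.memLp t ψ I := by
  obtain ⟨C, hC⟩ := exists_absHNormSq_le (X := X) hH ht
  obtain ⟨σ, hσ, hσψ⟩ := StepFun.exists_tendsto_eLpNorm ⟨t, ht⟩ hψ
  set μ := volume.restrict (Icc 0 t) with hμ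
  have hσψ' : Tendsto (fun k => ((σ k).memLp_toFun 2 μ).toLp) atTop (𝓝 hψ.toLp) :=
    (Lp.tendsto_Lp_iff_tendsto_eLpNorm'' _ _ _ _).2 hσψ
  have hcau := cauchySeq_iff_tendsto_dist_atTop_0.1 hσψ'.cauchySeq
  have hcau2 : CauchySeq fun k => (σ k).toLp hβ.memLp := by
    rw [cauchySeq_iff_tendsto_dist_atTop_0]
    have h0 := hcau.const_mul (Real.sqrt C)
    rw [mul_zero] at h0
    refine squeeze_zero (fun _ => dist_nonneg) (fun p => ?_) h0
    have h1 := hβ.exists_enorm_toLp_le hH hC ((σ p.1).sub (σ p.2))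
      (StepFun.sub_τ_le (hσ p.1) (hσ p.2))
    rw [StepFun.toLp_sub] at h1
    have h2 : eLpNorm ((σ p.1).sub (σ p.2)).toFun 2 μ =
        ‖((σ p.1).memLp_toFun 2 μ).toLp - ((σ p.2).memLp_toFun 2 μ).toLp‖ₑ := by
      rw [← MemLp.toLp_sub, Lp.enorm_toLp]
      congr 1
      ext s
      exact StepFun.toFun_sub _ _ _
    rw [h2] at h1
    rw [dist_eq_norm, dist_eq_norm]
    have h3 : ‖(σ p.1).toLp hβ.memLp - (σ p.2).toLp hβ.memLp‖ ^ 2 ≤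
        C * ‖((σ p.1).memLp_toFun 2 μ).toLp - ((σ p.2).memLp_toFun 2 μ).toLp‖ ^ 2 := by
      simp only [enorm_eq_nnnorm] at h1
      exact_mod_cast h1
    refine abs_le_of_sq_le_sq' (a := _) ?_ (by positivity) |>.2
    rw [mul_pow, Real.sq_sqrt C.coe_nonneg]
    exact h3
  obtain ⟨I, hI⟩ := cauchySeq_tendsto_of_complete hcau2
  exact ⟨I, hψ.1, σ, hσ, hσψ, hI⟩

/-- Stability in the integrand: with χ = 0 it bounds the integral, and with the integrands at two
times it gives mean square continuity. -/
lemma IsL2Wiener.enorm_sub_le [CompleteSpace X] {H : ℝ} (hH : 1 / 2 < H) {β : ℝ≥0 → Ω → ℝ}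
    (hβ : IsFBM H β P) {C : ℝ≥0} {t : ℝ}
    (hC : ∀ ψ : ℝ → X, AEStronglyMeasurable ψ (volume.restrict (Icc 0 t)) →
      absHNormSq H t ψ ≤ C * ∫⁻ u in Icc 0 t, ‖ψ u‖ₑ ^ 2)
    {ψ χ : ℝ → X} {I J : Lp X 2 P} (hI : IsL2Wiener hβ.memLp t ψ I)
    (hJ : IsL2Wiener hβ.memLp t χ J) :
    ‖I - J‖ₑ ^ 2 ≤ C * eLpNorm (fun s => ψ s - χ s) 2 (volume.restrict (Icc 0 t)) ^ 2 := by
  obtain ⟨hψ, σ, hσ, hσψ, hσI⟩ := hI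
  obtain ⟨hχ, ρ, hρ, hρχ, hρJ⟩ := hJ
  set μ := volume.restrict (Icc 0 t) with hμ
  have h1 : Tendsto (fun k => ‖(σ k).toLp hβ.memLp - (ρ k).toLp hβ.memLp‖ₑ ^ 2) atTop
      (𝓝 (‖I - J‖ₑ ^ 2)) := ((ENNReal.continuous_pow 2).tendsto _).comp
    ((continuous_enorm.tendsto _).comp (hσI.sub hρJ))
  have h2 : Tendsto (fun k => (C : ℝ≥0∞) * (eLpNorm (fun s => (σ k).toFun s - ψ s) 2 μ +
      eLpNorm (fun s => ψ s - χ s) 2 μ + eLpNorm (fun s => (ρ k).toFun s - χ s) 2 μ) ^ 2) atTop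
      (𝓝 (C * eLpNorm (fun s => ψ s - χ s) 2 μ ^ 2)) := by
    refine ENNReal.Tendsto.const_mul ?_ (Or.inr (by simp))
    refine ((ENNReal.continuous_pow 2).tendsto _).comp ?_
    simpa using (hσψ.add tendsto_const_nhds).add hρχ
  refine le_of_tendsto_of_tendsto' h1 h2 fun k => ?_
  have h3 := hβ.exists_enorm_toLp_le hH hC ((σ k).sub (ρ k)) (StepFun.sub_τ_le (hσ k) (hρ k))
  rw [StepFun.toLp_sub] at h3
  refine h3.trans ?_
  gcongr
  have e : ((σ k).sub (ρ k)).toFun = ((fun s => (σ k).toFun s - ψ s) + fun s => ψ s - χ s) -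
      fun s => (ρ k).toFun s - χ s := by
    ext s; simp [StepFun.toFun_sub]
  have m1 : AEStronglyMeasurable (fun s => (σ k).toFun s - ψ s) μ :=
    (σ k).measurable_toFun.aestronglyMeasurable.sub hψ
  have m2 : AEStronglyMeasurable (fun s => (ρ k).toFun s - χ s) μ :=
    (ρ k).measurable_toFun.aestronglyMeasurable.sub hχ
  rw [e]
  refine (eLpNorm_sub_le (m1.add (hψ.sub hχ)) m2 (by norm_num)).trans ?_
  gcongr
  exact eLpNorm_add_le m1 (hψ.sub hχ) (by norm_num)

lemma IsL2Wiener.inner_eq_zero {β γ : ℝ≥0 → Ω → ℝ}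
    {hβ : ∀ t, MemLp (β t) 2 P} {hγ : ∀ t, MemLp (γ t) 2 P} (hβ0 : ∀ t, ∫ ω, β t ω ∂P = 0)
    (hind : IndepFun (fun ω t => β t ω) (fun ω t => γ t ω) P) {t s : ℝ} {ψ χ : ℝ → X}
    {I J : Lp X 2 P} (hI : IsL2Wiener hβ t ψ I) (hJ : IsL2Wiener hγ s χ J) :
    inner ℝ I J = 0 := by
  obtain ⟨-, σ, -, -, hσI⟩ := hI
  obtain ⟨-, ρ, -, -, hρJ⟩ := hJ
  refine tendsto_nhds_unique (hσI.inner hρJ) ?_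
  simp only [inner_toLp_eq_zero_of_indep hβ hγ hβ0 hind]
  exact tendsto_const_nhds

lemma tendsto_toLp_iff (σ : ℕ → StepFun X) {β : ℝ≥0 → Ω → ℝ} (hβ : ∀ t, MemLp (β t) 2 P)
    (I : Lp X 2 P) : Tendsto (fun k => (σ k).toLp hβ) atTop (𝓝 I) ↔
      Tendsto (fun k => eLpNorm (fun ω => (σ k).integral β ω - I ω) 2 P) atTop (𝓝 0) := by
  rw [Lp.tendsto_Lp_iff_tendsto_eLpNorm']
  refine tendsto_congr fun k => eLpNorm_congr_ae ?_
  filter_upwards [((σ k).memLp_integral hβ).coeFn_toLp] with ω hω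
  simp [StepFun.toLp, hω]

lemma IsL2Wiener.isWienerIntegral {H : ℝ} (hH : 1 / 2 < H) {β : ℝ≥0 → Ω → ℝ}
    {hβ : ∀ t, MemLp (β t) 2 P} {t : ℝ} (ht : 0 ≤ t) {ψ : ℝ → X} {I : Lp X 2 P}
    (hI : IsL2Wiener hβ t ψ I) : IsWienerIntegral H β t ψ I := by
  obtain ⟨C, hC⟩ := exists_absHNormSq_le (X := X) hH ht
  obtain ⟨hψ, σ, hσ, hσψ, hσI⟩ := hI
  refine ⟨hψ, σ, hσ, ?_, (tendsto_toLp_iff σ hβ I).1 hσI⟩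
  have h0 : Tendsto (fun k => (C : ℝ≥0∞) * eLpNorm (fun s => (σ k).toFun s - ψ s) 2
      (volume.restrict (Icc 0 t)) ^ 2) atTop (𝓝 0) := by
    have := ENNReal.Tendsto.const_mul (((ENNReal.continuous_pow 2).tendsto _).comp hσψ)
      (a := (C : ℝ≥0∞)) (Or.inr (by simp))
    simpa using this
  refine tendsto_of_tendsto_of_tendsto_of_le_of_le tendsto_const_nhds h0 (fun _ => zero_le)
    fun k => ?_
  have := hC (fun s => (σ k).toFun s - ψ s) ((σ k).measurable_toFun.aestronglyMeasurable.sub hψ)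
  rwa [← eLpNorm_two_sq] at this

/-- Integrals over different intervals [0,t] become comparable on one interval. The same step
functions serve, as they vanish beyond t. -/
lemma IsL2Wiener.extend {β : ℝ≥0 → Ω → ℝ} {hβ : ∀ t, MemLp (β t) 2 P} {t b : ℝ} (htb : t ≤ b)
    {ψ : ℝ → X} {I : Lp X 2 P} (hI : IsL2Wiener hβ t ψ I) :
    IsL2Wiener hβ b ((Icc 0 t).indicator ψ) I := by
  obtain ⟨hψ, σ, hσ, hσψ, hσI⟩ := hI
  refine ⟨?_, σ, fun k i => (hσ k i).trans htb, ?_, hσI⟩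
  · exact ((aestronglyMeasurable_indicator_iff measurableSet_Icc).2 hψ).restrict
  · refine hσψ.congr fun k => ?_
    have e : (fun s => (σ k).toFun s - (Icc 0 t).indicator ψ s) =
        (Icc 0 t).indicator (fun s => (σ k).toFun s - ψ s) := by
      ext s
      by_cases hs : s ∈ Icc 0 t
      · simp [hs]
      · rw [indicator_of_notMem hs, indicator_of_notMem hs, sub_zero]
        refine Finset.sum_eq_zero fun i _ => indicator_of_notMem (fun h => hs ?_) _
        exact ⟨h.1, h.2.trans (hσ k i)⟩
    rw [e, eLpNorm_indicator_eq_eLpNorm_restrict measurableSet_Icc,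
      Measure.restrict_restrict measurableSet_Icc, inter_eq_left.2 (Icc_subset_Icc_right htb)]

/-- On [0,t] one has |u - v| ≤ t and the exponent 2H - 2 is negative, so the kernel is at least
t^(2H-2). Hence convergence in |𝓗| implies convergence in L¹. -/
lemma sq_lintegral_le_absHNormSq {E : Type*} [NormedAddCommGroup E] {H : ℝ} (hH : 1 / 2 < H)
    (hH1 : H < 1) (t : ℝ) (ψ : ℝ → E) :
    ENNReal.ofReal (H * (2 * H - 1) * t ^ (2 * H - 2)) * (∫⁻ u in Icc 0 t, ‖ψ u‖ₑ) ^ 2 ≤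
      absHNormSq H t ψ := by
  have hc : 0 ≤ H * (2 * H - 1) := mul_nonneg (by linarith) (by linarith)
  rw [ENNReal.ofReal_mul hc, absHNormSq, mul_assoc]
  gcongr
  rw [sq, ← mul_assoc]
  calc _ ≤ ∫⁻ u in Icc 0 t, ‖ψ u‖ₑ * (ENNReal.ofReal (t ^ (2 * H - 2)) *
        ∫⁻ v in Icc 0 t, ‖ψ v‖ₑ) := by
        refine le_trans (le_of_eq (by ring)) (lintegral_mul_const_le _ _)
    _ ≤ _ := by
        refine setLIntegral_mono_ae' measurableSet_Icc (Eventually.of_forall fun u hu => ?_)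
        simp only [mul_assoc]
        rw [lintegral_const_mul' (‖ψ u‖ₑ) _ (by simp)]
        refine mul_le_mul_right ?_ _
        rw [← lintegral_const_mul' _ _ (by simp)]
        -- The diagonal must be removed: there the kernel takes the default value 0 of a negative
        -- power of 0.
        have hne : ∀ᵐ v ∂(volume : Measure ℝ), v ≠ u := by
          simp [ae_iff, measure_singleton]
        refine setLIntegral_mono_ae' measurableSet_Icc (hne.mono fun v hv hv' => ?_)
        rw [mul_comm]
        refine mul_le_mul_right (ENNReal.ofReal_le_ofReal ?_) _
        refine Real.rpow_le_rpow_of_nonpos (abs_pos.2 (sub_ne_zero.2 hv.symm)) ?_ (by linarith)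
        rw [abs_le]; constructor <;> linarith [hu.1, hu.2, hv'.1, hv'.2]

lemma tendsto_lintegral_of_absHNormSq {E : Type*} [NormedAddCommGroup E] {H : ℝ} (hH : 1 / 2 < H)
    (hH1 : H < 1) {t : ℝ} {ψ : ℕ → ℝ → E}
    (h : Tendsto (fun k => absHNormSq H t (ψ k)) atTop (𝓝 0)) :
    Tendsto (fun k => ∫⁻ u in Icc 0 t, ‖ψ k u‖ₑ) atTop (𝓝 0) := by
  rcases le_or_gt t 0 with ht | ht
  · have : volume (Icc 0 t) = 0 := by rw [Real.volume_Icc]; simpa using ht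
    simp [Measure.restrict_eq_zero.2 this]
  · set c := ENNReal.ofReal (H * (2 * H - 1) * t ^ (2 * H - 2)) with hc
    have hc0 : c ≠ 0 := by
      have : 0 < H * (2 * H - 1) * t ^ (2 * H - 2) :=
        mul_pos (mul_pos (by linarith) (by linarith)) (Real.rpow_pos_of_pos ht _)
      simpa [hc] using this
    have h1 : Tendsto (fun k => (c⁻¹ * absHNormSq H t (ψ k)) ^ (1 / 2 : ℝ)) atTop (𝓝 0) := by
      have h2 := ENNReal.Tendsto.const_mul h (a := c⁻¹) (Or.inr (by simpa using hc0))
      rw [mul_zero] at h2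
      have h3 := (ENNReal.continuous_rpow_const (y := (1 / 2 : ℝ))).tendsto 0
      rw [ENNReal.zero_rpow_of_pos (by norm_num)] at h3
      exact h3.comp h2
    refine tendsto_of_tendsto_of_tendsto_of_le_of_le tendsto_const_nhds h1 (fun _ => zero_le)
      fun k => ?_
    have h4 := sq_lintegral_le_absHNormSq hH hH1 t (ψ k)
    have h5 : (∫⁻ u in Icc 0 t, ‖ψ k u‖ₑ) ^ 2 ≤ c⁻¹ * absHNormSq H t (ψ k) := by
      exact (ENNReal.mul_le_iff_le_inv hc0 (by simp [hc])).1 h4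
    calc (∫⁻ u in Icc 0 t, ‖ψ k u‖ₑ) = ((∫⁻ u in Icc 0 t, ‖ψ k u‖ₑ) ^ 2) ^ (1 / 2 : ℝ) := by
          rw [← ENNReal.rpow_natCast, ← ENNReal.rpow_mul]; norm_num
      _ ≤ _ := by gcongr

/-- The Wiener integral of a function is unique. -/
lemma IsFBM.isWienerIntegral_unique {H : ℝ} (hH : 1 / 2 < H) (hH1 : H < 1) {β : ℝ≥0 → Ω → ℝ}
    (hβ : IsFBM H β P) {t : ℝ} {ψ : ℝ → X} {I J : Lp X 2 P}
    (hI : IsWienerIntegral H β t ψ I) (hJ : IsWienerIntegral H β t ψ J) : I = J := by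
  obtain ⟨hψ, σ, hσ, hσψ, hσI⟩ := hI
  obtain ⟨-, ρ, hρ, hρψ, hρJ⟩ := hJ
  rw [← tendsto_toLp_iff σ hβ.memLp] at hσI
  rw [← tendsto_toLp_iff ρ hβ.memLp] at hρJ
  have hd : Tendsto (fun k => ((σ k).sub (ρ k)).toLp hβ.memLp) atTop (𝓝 (I - J)) := by
    simp only [StepFun.toLp_sub]; exact hσI.sub hρJ
  have hd1 : Tendsto (fun k => ∫⁻ u in Icc 0 t, ‖((σ k).sub (ρ k)).toFun u‖ₑ) atTop (𝓝 0) := by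
    have h := (tendsto_lintegral_of_absHNormSq hH hH1 hσψ).add
      (tendsto_lintegral_of_absHNormSq hH hH1 hρψ)
    rw [add_zero] at h
    refine tendsto_of_tendsto_of_tendsto_of_le_of_le tendsto_const_nhds h (fun _ => zero_le)
      fun k => ?_
    have hm : AEMeasurable (fun u => ‖(σ k).toFun u - ψ u‖ₑ) (volume.restrict (Icc 0 t)) :=
      ((σ k).measurable_toFun.aestronglyMeasurable.sub hψ).enorm
    rw [← lintegral_add_left' hm]
    refine lintegral_mono fun u => ?_
    rw [StepFun.toFun_sub, ← sub_sub_sub_cancel_right _ _ (ψ u)]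
    exact enorm_sub_le
  -- The differences of the two approximations tend to 0 in L¹ and potentials of step functions are
  -- bounded, so the limit `I - J` is orthogonal to every elementary integral. Being itself a limit
  -- of such integrals, it is zero.
  have horth : ∀ θ : StepFun X, inner ℝ (I - J) (θ.toLp hβ.memLp) = 0 := by
    intro θ
    refine tendsto_nhds_unique (hd.inner tendsto_const_nhds) ?_
    obtain ⟨B, hB⟩ := isCompact_Icc.exists_bound_of_continuousOn
      (θ.continuous_pot hH).continuousOn (s := Icc 0 t)
    have h1 : Tendsto (fun k => H * (2 * H - 1) *
        (B * (∫⁻ u in Icc 0 t, ‖((σ k).sub (ρ k)).toFun u‖ₑ).toReal)) atTop (𝓝 0) := by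
      have := (((ENNReal.tendsto_toReal (by simp)).comp hd1).const_mul B).const_mul (H * (2 * H - 1))
      simpa using this
    refine squeeze_zero_norm (fun k => ?_) h1
    have hc : 0 ≤ H * (2 * H - 1) := mul_nonneg (by linarith) (by linarith)
    rw [hβ.inner_toLp hH _ θ (StepFun.sub_τ_le (hσ k) (hρ k)), norm_mul, Real.norm_of_nonneg hc]
    gcongr
    have hi : Integrable ((σ k).sub (ρ k)).toFun (volume.restrict (Icc 0 t)) :=
      memLp_one_iff_integrable.1 (StepFun.memLp_toFun _ 1 _)
    rw [← integral_norm_eq_lintegral_enorm hi.1, ← integral_const_mul]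
    refine norm_integral_le_of_norm_le (hi.norm.const_mul B) ?_
    filter_upwards [ae_restrict_mem measurableSet_Icc] with u hu
    refine (norm_inner_le_norm _ _).trans ?_
    rw [mul_comm]
    gcongr
    exact hB u hu
  have h0 : inner ℝ (I - J) (I - J) = 0 := by
    refine tendsto_nhds_unique (tendsto_const_nhds.inner hd) ?_
    simp only [horth]
    exact tendsto_const_nhds
  exact sub_eq_zero.1 (inner_self_eq_zero.1 h0)

end Wiener

/-! ### The singular convolution kernel -/

/-- The kernel `x ^ (α - 1)` on `(0, b]`. -/
def singKernel (α b x : ℝ) : ℝ := (Ioc 0 b).indicator (fun x => x ^ (α - 1)) x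

lemma measurable_singKernel (α b : ℝ) : Measurable (singKernel α b) :=
  Measurable.indicator (by fun_prop) measurableSet_Ioc

lemma memLp_singKernel {α b : ℝ} (hb : 0 ≤ b) {q : ℝ≥0∞} (hq0 : q ≠ 0) (hq : q ≠ ∞)
    (h : -1 < (α - 1) * q.toReal) : MemLp (singKernel α b) q volume := by
  have hm := (measurable_singKernel α b).aestronglyMeasurable (μ := volume)
  rw [← integrable_norm_rpow_iff hm hq0 hq]
  have hq' : 0 < q.toReal := ENNReal.toReal_pos hq0 hq
  have h1 : IntegrableOn (fun x : ℝ => x ^ ((α - 1) * q.toReal)) (Ioc 0 b) := by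
    rw [← intervalIntegrable_iff_integrableOn_Ioc_of_le hb]
    exact intervalIntegral.intervalIntegrable_rpow' h
  rw [← integrable_indicator_iff measurableSet_Ioc] at h1
  refine h1.congr (Eventually.of_forall fun x => ?_)
  simp only [singKernel, Set.indicator_apply]
  split_ifs with hx
  · have hx0 : 0 < x := hx.1
    rw [Real.norm_of_nonneg (by positivity), ← Real.rpow_mul hx0.le]
  · simp [Real.zero_rpow hq'.ne']

/-- Continuity of translations in L^q, combined with the measure preserving reflection s ↦ t - s. -/
lemma tendsto_eLpNorm_comp_sub_left {E : Type*} [NormedAddCommGroup E] {f : ℝ → E} {q : ℝ≥0∞}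
    (hq1 : 1 ≤ q) (hq : q ≠ ∞) (hf : MemLp f q volume) (t : ℝ) :
    Tendsto (fun t' => eLpNorm (fun s => f (t' - s) - f (t - s)) q volume) (𝓝 t) (𝓝 0) := by
  have : Fact (1 ≤ q) := ⟨hq1⟩
  have hmp : ∀ t : ℝ, MeasurePreserving (fun s : ℝ => t - s) volume volume := fun t =>
    Measure.measurePreserving_sub_left volume t
  let g : C(ℝ, C(ℝ, ℝ)) := (ContinuousMap.mk (fun p : ℝ × ℝ => p.1 - p.2) (by fun_prop)).curry
  have h := (tendsto_const_nhds (x := hf.toLp) (f := 𝓝 t)).compMeasurePreservingLp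
    (g.continuous.tendsto t) hmp (hmp t) hq
  exact (Lp.tendsto_Lp_iff_tendsto_eLpNorm'' (fun t' s => f (t' - s))
    (fun t' => hf.comp_measurePreserving (hmp t')) (fun s => f (t - s))
    (hf.comp_measurePreserving (hmp t))).1 h

section Convolution

variable {X : Type*} [NormedAddCommGroup X] [NormedSpace ℝ X]

/-- Strong continuity and a uniform bound give joint continuity, and with it measurability of s ↦
S(t-s)v(s). -/
lemma continuous_uncurry_of_bounded {S : ℝ → X →L[ℝ] X} (hS : ∀ η, Continuous fun t => S t η)
    {C : ℝ} (hC : ∀ t, ‖S t‖ ≤ C) : Continuous fun p : ℝ × X => S p.1 p.2 := by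
  refine continuous_iff_continuousAt.2 fun ⟨t, x⟩ => ?_
  rw [ContinuousAt, tendsto_iff_norm_sub_tendsto_zero]
  have h1 : Tendsto (fun p : ℝ × X => C * ‖p.2 - x‖ + ‖S p.1 x - S t x‖) (𝓝 (t, x)) (𝓝 0) := by
    have a1 : Continuous fun p : ℝ × X => C * ‖p.2 - x‖ + ‖S p.1 x - S t x‖ := by
      have := (hS x).comp (continuous_fst (X := ℝ) (Y := X))
      simp only [Function.comp_def] at this
      fun_prop
    simpa using a1.tendsto (t, x)
  refine squeeze_zero (fun _ => norm_nonneg _) (fun p => ?_) h1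
  calc ‖S p.1 p.2 - S t x‖ = ‖S p.1 (p.2 - x) + (S p.1 x - S t x)‖ := by
        rw [map_sub]; congr 1; abel
    _ ≤ ‖S p.1 (p.2 - x)‖ + ‖S p.1 x - S t x‖ := norm_add_le _ _
    _ ≤ _ := by
        gcongr
        exact ((S p.1).le_opNorm _).trans (by gcongr; exact hC _)

/-- The convolution integrand `k(t-s) S(t-s) v(s)`. -/
def convFun (S : ℝ → X →L[ℝ] X) (k : ℝ → ℝ) (v : ℝ → X) (t s : ℝ) : X :=
  k (t - s) • S (t - s) (v s)

lemma aestronglyMeasurable_convFun {S : ℝ → X →L[ℝ] X} (hS : ∀ η, Continuous fun t => S t η)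
    {C : ℝ} (hC : ∀ t, ‖S t‖ ≤ C) {k : ℝ → ℝ} (hk : Measurable k) {v : ℝ → X} {μ : Measure ℝ}
    (hv : AEStronglyMeasurable v μ) (t : ℝ) : AEStronglyMeasurable (convFun S k v t) μ := by
  refine AEStronglyMeasurable.smul ?_ ?_
  · exact (hk.comp (measurable_const.sub measurable_id)).aestronglyMeasurable
  · exact (continuous_uncurry_of_bounded hS hC).comp_aestronglyMeasurable
      ((continuous_const.sub continuous_id).aestronglyMeasurable.prodMk hv)

lemma enorm_convFun_le {S : ℝ → X →L[ℝ] X} {C : ℝ≥0} (hC : ∀ t, ‖S t‖ ≤ C) (k : ℝ → ℝ)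
    (v : ℝ → X) (t s : ℝ) : ‖convFun S k v t s‖ₑ ≤ C * (‖k (t - s)‖ₑ * ‖v s‖ₑ) := by
  rw [convFun, enorm_smul, mul_left_comm]
  gcongr
  have := ((S (t - s)).le_opNorm (v s)).trans (mul_le_mul_of_nonneg_right (hC _) (norm_nonneg _))
  simp only [enorm_eq_nnnorm]
  exact_mod_cast this

lemma ENNReal_add_pow_le (a b : ℝ≥0∞) (n : ℕ) : (a + b) ^ n ≤ 2 ^ n * (a ^ n + b ^ n) := by
  calc (a + b) ^ n ≤ (2 * max a b) ^ n := by
        gcongr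
        rw [two_mul]
        exact add_le_add (le_max_left _ _) (le_max_right _ _)
    _ = 2 ^ n * max a b ^ n := mul_pow _ _ _
    _ ≤ _ := by
        gcongr
        rcases max_cases a b with ⟨h, -⟩ | ⟨h, -⟩ <;> rw [h]
        · exact le_self_add
        · exact le_add_self

/-- Continuity of singular convolutions with a strongly continuous operator family. -/
lemma tendsto_tsum_lintegral_convFun {S : ℝ → X →L[ℝ] X} (hS : ∀ η, Continuous fun t => S t η)
    {C : ℝ≥0} (hC : ∀ t, ‖S t‖ ≤ C) {k : ℝ → ℝ} (hk : Measurable k) {ι : Type*} [Countable ι]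
    {v : ι → ℝ → X} {μ : Measure ℝ} (hv : ∀ n, AEStronglyMeasurable (v n) μ) {m : ℕ} (hm : m ≠ 0)
    (t : ℝ)
    (h1 : Tendsto (fun t' => ∫⁻ s, ‖k (t' - s) - k (t - s)‖ₑ ^ m * ∑' n, ‖v n s‖ₑ ^ m ∂μ)
      (𝓝 t) (𝓝 0))
    (h2 : ∫⁻ s, ‖k (t - s)‖ₑ ^ m * ∑' n, ‖v n s‖ₑ ^ m ∂μ ≠ ∞) :
    Tendsto (fun t' => ∑' n, ∫⁻ s, ‖convFun S k (v n) t' s - convFun S k (v n) t s‖ₑ ^ m ∂μ)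
      (𝓝 t) (𝓝 0) := by
  have hkt : ∀ t : ℝ, Measurable fun s => k (t - s) := fun t =>
    hk.comp (measurable_const.sub measurable_id)
  have hsum : ∀ f : ℝ → ℝ≥0∞, Measurable f →
      ∑' n, ∫⁻ s, f s * ‖v n s‖ₑ ^ m ∂μ = ∫⁻ s, f s * ∑' n, ‖v n s‖ₑ ^ m ∂μ := by
    intro f hf
    have hfm : ∀ n, AEMeasurable (fun s => f s * ‖v n s‖ₑ ^ m) μ := fun n =>
      hf.aemeasurable.mul ((hv n).enorm.pow_const m)
    rw [← lintegral_tsum hfm]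
    simp_rw [ENNReal.tsum_mul_left]
  -- The increment splits into a change of the kernel, controlled by `h1`, and a change of the
  -- operator, collected in `D`. The stochastic convolution uses m = 2 and the drift uses m = 1.
  set D : ℝ → ι → ℝ → ℝ≥0∞ := fun t' n s =>
    ‖k (t - s)‖ₑ ^ m * ‖S (t' - s) (v n s) - S (t - s) (v n s)‖ₑ ^ m with hD
  have hSm : ∀ t n, AEStronglyMeasurable (fun s => S (t - s) (v n s)) μ := fun t n =>
    (continuous_uncurry_of_bounded hS hC).comp_aestronglyMeasurable
      ((continuous_const.sub continuous_id).aestronglyMeasurable.prodMk (hv n))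
  have hDm : ∀ t' n, AEMeasurable (D t' n) μ := fun t' n =>
    ((hkt t).enorm.pow_const m).aemeasurable.mul
      ((((hSm t' n).sub (hSm t n)).enorm).pow_const m)
  have hDle : ∀ t' n s, D t' n s ≤ (2 * C) ^ m * (‖k (t - s)‖ₑ ^ m * ‖v n s‖ₑ ^ m) := by
    intro t' n s
    have : ‖S (t' - s) (v n s) - S (t - s) (v n s)‖ₑ ≤ 2 * C * ‖v n s‖ₑ := by
      refine enorm_sub_le.trans ?_
      have hb : ∀ u, ‖S u (v n s)‖ₑ ≤ C * ‖v n s‖ₑ := fun u => by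
        have := ((S u).le_opNorm (v n s)).trans
          (mul_le_mul_of_nonneg_right (hC _) (norm_nonneg _))
        simp only [enorm_eq_nnnorm]
        exact_mod_cast this
      rw [mul_assoc, two_mul]
      exact add_le_add (hb _) (hb _)
    calc D t' n s ≤ ‖k (t - s)‖ₑ ^ m * (2 * C * ‖v n s‖ₑ) ^ m := by
          simp only [hD]; gcongr
      _ = _ := by rw [mul_pow]; ring
  have hC' : ((2 : ℝ≥0∞) * C) ^ m ≠ ∞ := by finiteness
  have hDfin : ∑' n, ∫⁻ s, (2 * C) ^ m * (‖k (t - s)‖ₑ ^ m * ‖v n s‖ₑ ^ m) ∂μ ≠ ∞ := by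
    simp_rw [lintegral_const_mul' _ _ hC']
    rw [ENNReal.tsum_mul_left, hsum _ ((hkt t).enorm.pow_const m)]
    exact ENNReal.mul_ne_top hC' h2
  have hD0 : Tendsto (fun t' => ∑' n, ∫⁻ s, D t' n s ∂μ) (𝓝 t) (𝓝 0) := by
    have hin : ∀ n, Tendsto (fun t' => ∫⁻ s, D t' n s ∂μ) (𝓝 t) (𝓝 0) := by
      intro n
      refine tendsto_of_seq_tendsto fun u hu => ?_
      have := tendsto_lintegral_of_dominated_convergence' (μ := μ)
        (F := fun i s => D (u i) n s) (f := fun _ => 0)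
        (fun s => (2 * C) ^ m * (‖k (t - s)‖ₑ ^ m * ‖v n s‖ₑ ^ m))
        (fun i => hDm (u i) n)
        (fun i => Eventually.of_forall fun s => hDle (u i) n s)
        (ENNReal.ne_top_of_tsum_ne_top hDfin n)
        (Eventually.of_forall fun s => ?_)
      · rw [lintegral_zero] at this
        exact this
      · have e1 : Tendsto (fun t' => ‖S (t' - s) (v n s) - S (t - s) (v n s)‖ₑ) (𝓝 t) (𝓝 0) := by
          have e2 : Continuous fun t' => ‖S (t' - s) (v n s) - S (t - s) (v n s)‖ₑ :=
            (((hS (v n s)).comp (continuous_id.sub continuous_const)).sub continuous_const).enorm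
          simpa using e2.tendsto t
        have e3 := ENNReal.Tendsto.const_mul (((ENNReal.continuous_pow m).tendsto _).comp e1)
          (a := ‖k (t - s)‖ₑ ^ m) (Or.inr (by finiteness))
        rw [zero_pow hm, mul_zero] at e3
        exact e3.comp hu
    -- The series is an integral for the counting measure, so dominated convergence applies a second
    -- time.
    let _ : MeasurableSpace ι := ⊤
    have _ : MeasurableSingletonClass ι := ⟨fun _ => trivial⟩
    have hout := tendsto_lintegral_filter_of_dominated_convergence (l := 𝓝 t)
      (μ := Measure.count (α := ι))
      (F := fun t' n => ∫⁻ s, D t' n s ∂μ) (f := fun _ => 0)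
      (fun n => ∫⁻ s, (2 * C) ^ m * (‖k (t - s)‖ₑ ^ m * ‖v n s‖ₑ ^ m) ∂μ)
      (Eventually.of_forall fun t' => measurable_from_top)
      (Eventually.of_forall fun t' => Eventually.of_forall fun n => lintegral_mono fun s =>
        hDle t' n s)
      (by rw [lintegral_count]; exact hDfin)
      (Eventually.of_forall fun n => hin n)
    simp only [lintegral_count, tsum_zero] at hout
    exact hout
  have hbound : Tendsto (fun t' => 2 ^ m * (C ^ m * ∫⁻ s, ‖k (t' - s) - k (t - s)‖ₑ ^ m *
      ∑' n, ‖v n s‖ₑ ^ m ∂μ) + 2 ^ m * ∑' n, ∫⁻ s, D t' n s ∂μ) (𝓝 t) (𝓝 0) := by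
    have a1 := ENNReal.Tendsto.const_mul (ENNReal.Tendsto.const_mul h1
      (a := (C : ℝ≥0∞) ^ m) (Or.inr (by finiteness))) (a := (2 : ℝ≥0∞) ^ m) (Or.inr (by finiteness))
    have a2 := ENNReal.Tendsto.const_mul hD0 (a := (2 : ℝ≥0∞) ^ m) (Or.inr (by finiteness))
    simpa using a1.add a2
  refine tendsto_of_tendsto_of_tendsto_of_le_of_le tendsto_const_nhds hbound (fun _ => zero_le)
    fun t' => ?_
  have hkd : Measurable fun s => ‖k (t' - s) - k (t - s)‖ₑ ^ m :=
    (((hkt t').sub (hkt t)).enorm).pow_const m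
  have hpt : ∀ n s, ‖convFun S k (v n) t' s - convFun S k (v n) t s‖ₑ ^ m ≤
      2 ^ m * (C ^ m * (‖k (t' - s) - k (t - s)‖ₑ ^ m * ‖v n s‖ₑ ^ m)) + 2 ^ m * D t' n s := by
    intro n s
    have e : convFun S k (v n) t' s - convFun S k (v n) t s =
        (k (t' - s) - k (t - s)) • S (t' - s) (v n s) +
        k (t - s) • (S (t' - s) (v n s) - S (t - s) (v n s)) := by
      simp only [convFun, sub_smul, smul_sub]; abel
    have hb : ‖S (t' - s) (v n s)‖ₑ ≤ C * ‖v n s‖ₑ := by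
      have := ((S (t' - s)).le_opNorm (v n s)).trans
        (mul_le_mul_of_nonneg_right (hC _) (norm_nonneg _))
      simp only [enorm_eq_nnnorm]
      exact_mod_cast this
    rw [e]
    calc _ ≤ (‖(k (t' - s) - k (t - s)) • S (t' - s) (v n s)‖ₑ +
          ‖k (t - s) • (S (t' - s) (v n s) - S (t - s) (v n s))‖ₑ) ^ m := by
          gcongr; exact enorm_add_le _ _
      _ ≤ (‖k (t' - s) - k (t - s)‖ₑ * (C * ‖v n s‖ₑ) +
          ‖k (t - s)‖ₑ * ‖S (t' - s) (v n s) - S (t - s) (v n s)‖ₑ) ^ m := by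
          rw [enorm_smul, enorm_smul]; gcongr
      _ ≤ _ := (ENNReal_add_pow_le _ _ m).trans (le_of_eq (by
          simp only [hD, mul_pow]; ring))
  calc ∑' n, ∫⁻ s, ‖convFun S k (v n) t' s - convFun S k (v n) t s‖ₑ ^ m ∂μ
      ≤ ∑' n, ∫⁻ s, (2 ^ m * (C ^ m * (‖k (t' - s) - k (t - s)‖ₑ ^ m * ‖v n s‖ₑ ^ m)) +
          2 ^ m * D t' n s) ∂μ := by
        refine ENNReal.tsum_le_tsum fun n => lintegral_mono fun s => hpt n s
    _ = ∑' n, (2 ^ m * (C ^ m * ∫⁻ s, ‖k (t' - s) - k (t - s)‖ₑ ^ m * ‖v n s‖ₑ ^ m ∂μ) +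
          2 ^ m * ∫⁻ s, D t' n s ∂μ) := by
        refine tsum_congr fun n => ?_
        rw [lintegral_add_right' _ ((hDm t' n).const_mul _), lintegral_const_mul' _ _ (by finiteness),
          lintegral_const_mul' _ _ (by finiteness), lintegral_const_mul' _ _ (by finiteness)]
    _ = _ := by
        rw [ENNReal.tsum_add, ENNReal.tsum_mul_left, ENNReal.tsum_mul_left, ENNReal.tsum_mul_left,
          hsum _ hkd]

end Convolution

/-! ### The stochastic convolution -/

/-- Hölder's inequality with exponent q on ‖κ‖² and p on A, which puts κ in L^(2q). -/
lemma lintegral_enorm_sq_mul_le {p q : ℝ} (hpq : p.HolderConjugate q) {μ : Measure ℝ} {κ : ℝ → ℝ}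
    (hκ : AEMeasurable κ μ) {A : ℝ → ℝ≥0∞} (hA : AEMeasurable A μ) :
    ∫⁻ s, ‖κ s‖ₑ ^ 2 * A s ∂μ ≤
      eLpNorm κ (ENNReal.ofReal (2 * q)) μ ^ 2 * (∫⁻ s, A s ^ p ∂μ) ^ (1 / p) := by
  have hq : 0 < q := hpq.symm.pos
  refine (ENNReal.lintegral_mul_le_Lp_mul_Lq μ hpq.symm (hκ.enorm.pow_const 2) hA).trans
    (le_of_eq ?_)
  congr 1
  rw [eLpNorm_eq_lintegral_rpow_enorm_toReal (by simpa using hq) ENNReal.ofReal_ne_top,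
    ENNReal.toReal_ofReal (by positivity), ← ENNReal.rpow_natCast, ← ENNReal.rpow_mul]
  congr 1
  · refine lintegral_congr fun s => ?_
    rw [← ENNReal.rpow_natCast, ← ENNReal.rpow_mul]; norm_num
  · field_simp; norm_num

/-- Pythagoras for finite partial sums, applied to the orthogonal family of lines spanned by the
terms. -/
lemma tsum_enorm_sq_of_pairwise_orthogonal {E ι : Type*} [NormedAddCommGroup E]
    [InnerProductSpace ℝ E] [CompleteSpace E] {f : ι → E}
    (horth : ∀ i j, i ≠ j → inner ℝ (f i) (f j) = 0) (hf : ∑' i, ‖f i‖ₑ ^ 2 ≠ ∞) :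
    Summable f ∧ ‖∑' i, f i‖ₑ ^ 2 ≤ ∑' i, ‖f i‖ₑ ^ 2 := by
  have hfam : OrthogonalFamily ℝ (fun i => (ℝ ∙ f i : Submodule ℝ E))
      fun i => (ℝ ∙ f i).subtypeₗᵢ := by
    refine OrthogonalFamily.of_pairwise fun i j hij => ?_
    rw [Function.onFun, Submodule.isOrtho_span]
    simpa using horth i j hij
  let g : ∀ i, (ℝ ∙ f i : Submodule ℝ E) := fun i => ⟨f i, Submodule.mem_span_singleton_self _⟩
  have hsum : Summable fun i => ‖g i‖ ^ 2 := by
    have h1 : ∀ i, ‖g i‖ ^ 2 = (‖f i‖ₑ ^ 2).toReal := fun i => by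
      rw [ENNReal.toReal_pow, toReal_enorm]; rfl
    simp_rw [h1]
    exact ENNReal.summable_toReal hf
  have hs : Summable f := (hfam.summable_iff_norm_sq_summable g).2 hsum
  refine ⟨hs, ?_⟩
  have ht : Tendsto (fun s : Finset ι => ‖∑ i ∈ s, f i‖ₑ ^ 2) atTop (𝓝 (‖∑' i, f i‖ₑ ^ 2)) :=
    ((ENNReal.continuous_pow 2).tendsto _).comp ((continuous_enorm.tendsto _).comp hs.hasSum)
  refine le_of_tendsto' ht fun s => ?_
  have h2 : ‖∑ i ∈ s, f i‖ ^ 2 = ∑ i ∈ s, ‖f i‖ ^ 2 := hfam.norm_sum g s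
  have h3 : ‖∑ i ∈ s, f i‖ₑ ^ 2 = ∑ i ∈ s, ‖f i‖ₑ ^ 2 := by
    simp only [enorm_eq_nnnorm]
    have : ‖∑ i ∈ s, f i‖₊ ^ 2 = ∑ i ∈ s, ‖f i‖₊ ^ 2 := by
      rw [← NNReal.coe_inj]; push_cast; exact h2
    exact_mod_cast this
  rw [h3]
  exact ENNReal.sum_le_tsum s

section StochConv

variable {X Ω : Type*} [NormedAddCommGroup X] [InnerProductSpace ℝ X] [MeasurableSpace Ω]
  {P : Measure Ω}

lemma IsL2Wiener.congr {β : ℝ≥0 → Ω → ℝ} {hβ : ∀ t, MemLp (β t) 2 P} {t : ℝ}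
    {ψ χ : ℝ → X} {I : Lp X 2 P} (hI : IsL2Wiener hβ t ψ I)
    (h : ψ =ᵐ[volume.restrict (Icc 0 t)] χ) : IsL2Wiener hβ t χ I := by
  obtain ⟨hψ, σ, hσ, hσψ, hσI⟩ := hI
  refine ⟨hψ.congr h, σ, hσ, hσψ.congr fun k => eLpNorm_congr_ae ?_, hσI⟩
  filter_upwards [h] with s hs
  rw [hs]

lemma isL2Wiener_zero {β : ℝ≥0 → Ω → ℝ} (hβ : ∀ t, MemLp (β t) 2 P) (t : ℝ) :
    IsL2Wiener hβ t (0 : ℝ → X) 0 := by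
  refine ⟨aestronglyMeasurable_zero, fun _ => ⟨0, Fin.elim0, Fin.elim0⟩, fun k i => i.elim0, ?_, ?_⟩
  · have : ∀ s, (StepFun.mk 0 Fin.elim0 Fin.elim0 : StepFun X).toFun s = 0 := fun s => by
      change ∑ i : Fin 0, _ = (0 : X)
      simp
    simp [this]
  · have : (StepFun.mk 0 Fin.elim0 Fin.elim0 : StepFun X).toLp hβ = 0 := by
      rw [StepFun.toLp, ← MemLp.toLp_zero (MemLp.zero')]
      congr 1
    simp [this]

/-- Series of Wiener integrals of singular convolutions with respect to independent fractional
Brownian motions. -/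
lemma exists_stochConv [CompleteSpace X] {ι : Type*} [Countable ι] {H : ℝ} (hH : 1 / 2 < H)
    {β : ι → ℝ≥0 → Ω → ℝ} (hβ : ∀ n, IsFBM H (β n) P)
    (hind : iIndepFun (fun n ω (t : ℝ≥0) => β n t ω) P) {b α p : ℝ} (hb : 0 ≤ b)
    (hα : 1 / 2 < α) (hα1 : α ≤ 1) (hp : 1 / (2 * α - 1) < p) {S : ℝ → X →L[ℝ] X}
    (hS : ∀ η, Continuous fun t => S t η) {C : ℝ≥0} (hC : ∀ t, ‖S t‖ ≤ C) {v : ι → ℝ → X}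
    (hv : ∀ n, AEStronglyMeasurable (v n) (volume.restrict (Icc 0 b)))
    (hint : ∫⁻ s in Icc 0 b, (∑' n, ‖v n s‖ₑ ^ 2) ^ p ≠ ∞) :
    ∃ (J : Icc 0 b → ι → Lp X 2 P) (I : Icc 0 b → Lp X 2 P), Continuous I ∧
      I ⟨0, le_rfl, hb⟩ = 0 ∧ ∀ t, HasSum (J t) (I t) ∧
        ∀ n, IsL2Wiener (hβ n).memLp t (convFun S (singKernel α b) (v n) t) (J t n) := by
  set μ := volume.restrict (Icc 0 b) with hμ
  set k := singKernel α b with hk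
  have hkm : Measurable k := measurable_singKernel α b
  have hα2 : 0 < 2 * α - 1 := by linarith
  -- Since α ≤ 1, the lower bound 1/(2α-1) is at least 1.
  have hp1 : 1 < p := lt_of_le_of_lt (by rw [le_div_iff₀ hα2]; linarith) hp
  have hpq := Real.HolderConjugate.conjExponent hp1
  set q := p.conjExponent with hq
  have hq1 : 1 < q := hpq.symm.lt
  have hkq : MemLp k (ENNReal.ofReal (2 * q)) volume := by
    refine memLp_singKernel hb (by simpa using by linarith) ENNReal.ofReal_ne_top ?_
    rw [ENNReal.toReal_ofReal (by linarith), hq, Real.conjExponent]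
    rw [div_lt_iff₀ hα2] at hp
    have hp0 : 0 < p - 1 := by linarith
    -- The condition p > 1/(2α-1) says exactly that 2q(1-α) < 1 for the conjugate exponent q, i.e.
    -- that the kernel lies in L^(2q).
    have : (1 - α) * (2 * (p / (p - 1))) < 1 := by
      rw [← mul_div_assoc, ← mul_div_assoc, div_lt_one hp0]
      nlinarith
    linarith
  set A : ℝ → ℝ≥0∞ := fun s => ∑' n, ‖v n s‖ₑ ^ 2 with hA
  have hAm : AEMeasurable A μ := AEMeasurable.tsum fun n => (hv n).enorm.pow_const 2
  have hle : ∀ κ : ℝ → ℝ, AEMeasurable κ volume → ∫⁻ s, ‖κ s‖ₑ ^ 2 * A s ∂μ ≤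
      eLpNorm κ (ENNReal.ofReal (2 * q)) volume ^ 2 * (∫⁻ s, A s ^ p ∂μ) ^ (1 / p) := by
    intro κ hκ
    refine (lintegral_enorm_sq_mul_le hpq hκ.restrict hAm).trans ?_
    gcongr
    exact Measure.restrict_le_self
  have hAp : (∫⁻ s, A s ^ p ∂μ) ^ (1 / p) ≠ ∞ :=
    ENNReal.rpow_ne_top_of_nonneg (by positivity) hint
  have hmp : ∀ t : ℝ, MeasurePreserving (fun s : ℝ => t - s) volume volume := fun t =>
    Measure.measurePreserving_sub_left volume t
  have hfin : ∀ t, ∫⁻ s, ‖k (t - s)‖ₑ ^ 2 * A s ∂μ ≠ ∞ := by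
    intro t
    have h1 := hkq.comp_measurePreserving (hmp t)
    refine ne_top_of_le_ne_top ?_ (hle (fun s => k (t - s)) h1.1.aemeasurable)
    exact ENNReal.mul_ne_top (ENNReal.pow_ne_top h1.2.ne) hAp
  have hconv : ∀ t, Tendsto (fun t' => ∫⁻ s, ‖k (t' - s) - k (t - s)‖ₑ ^ 2 * A s ∂μ) (𝓝 t)
      (𝓝 0) := by
    intro t
    have h1 := tendsto_eLpNorm_comp_sub_left (by
      rw [ENNReal.one_le_ofReal]; linarith) ENNReal.ofReal_ne_top hkq t
    have h2 : Tendsto (fun t' => eLpNorm (fun s => k (t' - s) - k (t - s))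
        (ENNReal.ofReal (2 * q)) volume ^ 2 * (∫⁻ s, A s ^ p ∂μ) ^ (1 / p)) (𝓝 t) (𝓝 0) := by
      have := ENNReal.Tendsto.mul_const (((ENNReal.continuous_pow 2).tendsto _).comp h1)
        (b := (∫⁻ s, A s ^ p ∂μ) ^ (1 / p)) (Or.inr hAp)
      simpa using this
    refine tendsto_of_tendsto_of_tendsto_of_le_of_le tendsto_const_nhds h2 (fun _ => zero_le)
      fun t' => hle (fun s => k (t' - s) - k (t - s)) ?_
    exact (((hkq.comp_measurePreserving (hmp t')).1).sub
      (hkq.comp_measurePreserving (hmp t)).1).aemeasurable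
  have htend := fun t => tendsto_tsum_lintegral_convFun hS hC hkm hv two_ne_zero t (hconv t) (hfin t)
  have hcm : ∀ n t, AEStronglyMeasurable (convFun S k (v n) t) μ := fun n t =>
    aestronglyMeasurable_convFun hS hC hkm (hv n) t
  have hcfin : ∀ t, ∑' n, ∫⁻ s, ‖convFun S k (v n) t s‖ₑ ^ 2 ∂μ ≠ ∞ := by
    intro t
    refine ne_top_of_le_ne_top (ENNReal.mul_ne_top (b := ∫⁻ s, ‖k (t - s)‖ₑ ^ 2 * A s ∂μ)
      (a := (C : ℝ≥0∞) ^ 2) (by finiteness) (hfin t)) ?_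
    have hkt : Measurable fun s => k (t - s) := hkm.comp (measurable_const.sub measurable_id)
    have h1 : ∫⁻ s, ‖k (t - s)‖ₑ ^ 2 * A s ∂μ =
        ∑' n, ∫⁻ s, ‖k (t - s)‖ₑ ^ 2 * ‖v n s‖ₑ ^ 2 ∂μ := by
      have hfm : ∀ n, AEMeasurable (fun s => ‖k (t - s)‖ₑ ^ 2 * ‖v n s‖ₑ ^ 2) μ := fun n =>
        (hkt.enorm.pow_const 2).aemeasurable.mul ((hv n).enorm.pow_const 2)
      rw [← lintegral_tsum hfm]
      simp_rw [ENNReal.tsum_mul_left]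
      rfl
    rw [h1, ← ENNReal.tsum_mul_left]
    refine ENNReal.tsum_le_tsum fun n => ?_
    rw [← lintegral_const_mul' _ _ (by finiteness)]
    refine lintegral_mono fun s => ?_
    calc ‖convFun S k (v n) t s‖ₑ ^ 2 ≤ (C * (‖k (t - s)‖ₑ * ‖v n s‖ₑ)) ^ 2 := by
          gcongr; exact enorm_convFun_le hC k (v n) t s
      _ = _ := by ring
  have hmem : ∀ n t, MemLp (convFun S k (v n) t) 2 μ := by
    intro n t
    refine ⟨hcm n t, ?_⟩
    have := (ENNReal.ne_top_of_tsum_ne_top (hcfin t) n).lt_top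
    rw [← eLpNorm_two_sq] at this
    exact lt_top_iff_ne_top.2 fun h => by simp [h] at this
  have hJ : ∀ (t : Icc 0 b) n, ∃ J : Lp X 2 P,
      IsL2Wiener (hβ n).memLp t (convFun S k (v n) t) J := by
    intro t n
    refine (hβ n).exists_isL2Wiener hH t.2.1 ((hmem n t).mono_measure ?_)
    exact Measure.restrict_mono (Icc_subset_Icc_right t.2.2) le_rfl
  choose J hJ using hJ
  -- The kernel vanishes for s ≥ t, so each integral over [0,t] is also one over [0,b] of the same
  -- function; integrals at different times can then be subtracted.
  have hJb : ∀ (t : Icc 0 b) n, IsL2Wiener (hβ n).memLp b (convFun S k (v n) t) (J t n) := by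
    intro t n
    refine ((hJ t n).extend t.2.2).congr ?_
    filter_upwards [ae_restrict_mem measurableSet_Icc] with s hs
    by_cases hst : s ≤ t
    · rw [indicator_of_mem (show s ∈ Icc 0 (t : ℝ) from ⟨hs.1, hst⟩)]
    · rw [indicator_of_notMem (fun h => hst h.2), convFun, hk, singKernel, indicator_of_notMem,
        zero_smul]
      intro h
      have : 0 < (t : ℝ) - s := h.1
      linarith
  obtain ⟨D, hD⟩ := exists_absHNormSq_le (X := X) hH hb
  -- Orthogonality across different times is needed for the increments of the series.
  have horth : ∀ (t t' : Icc 0 b) n m, n ≠ m → inner ℝ (J t n) (J t' m) = 0 := fun t t' n m hnm =>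
    (hJ t n).inner_eq_zero (hβ n).centered (hind.indepFun hnm) (hJ t' m)
  have hJle : ∀ (t : Icc 0 b) n, ‖J t n‖ₑ ^ 2 ≤ D * ∫⁻ s, ‖convFun S k (v n) t s‖ₑ ^ 2 ∂μ := by
    intro t n
    have := IsL2Wiener.enorm_sub_le hH (hβ n) hD (hJb t n) (isL2Wiener_zero _ b)
    simpa [eLpNorm_two_sq] using this
  have hJsum : ∀ t : Icc 0 b, ∑' n, ‖J t n‖ₑ ^ 2 ≠ ∞ := by
    intro t
    refine ne_top_of_le_ne_top ?_ (ENNReal.tsum_le_tsum (hJle t))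
    rw [ENNReal.tsum_mul_left]
    exact ENNReal.mul_ne_top (by simp) (hcfin t)
  have hsummable : ∀ t, Summable (J t) := fun t =>
    (tsum_enorm_sq_of_pairwise_orthogonal (fun n m => horth t t n m) (hJsum t)).1
  refine ⟨J, fun t => ∑' n, J t n, ?_, ?_, fun t => ⟨(hsummable t).hasSum, hJ t⟩⟩
  · refine continuous_iff_continuousAt.2 fun t => ?_
    rw [ContinuousAt, tendsto_iff_edist_tendsto_0]
    have h1 : Tendsto (fun t' : Icc 0 b => (D * ∑' n, ∫⁻ s,
        ‖convFun S k (v n) t' s - convFun S k (v n) t s‖ₑ ^ 2 ∂μ) ^ (1 / 2 : ℝ)) (𝓝 t) (𝓝 0) := by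
      have h2 := ENNReal.Tendsto.const_mul ((htend t).comp (continuous_subtype_val.tendsto t))
        (a := (D : ℝ≥0∞)) (Or.inr (by simp))
      rw [mul_zero] at h2
      have h3 := (ENNReal.continuous_rpow_const (y := (1 / 2 : ℝ))).tendsto 0
      rw [ENNReal.zero_rpow_of_pos (by norm_num)] at h3
      exact h3.comp h2
    refine tendsto_of_tendsto_of_tendsto_of_le_of_le tendsto_const_nhds h1 (fun _ => zero_le)
      fun t' => ?_
    have hd : ∀ n, ‖J t' n - J t n‖ₑ ^ 2 ≤ D * ∫⁻ s,
        ‖convFun S k (v n) t' s - convFun S k (v n) t s‖ₑ ^ 2 ∂μ := by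
      intro n
      have := IsL2Wiener.enorm_sub_le hH (hβ n) hD (hJb t' n) (hJb t n)
      rwa [eLpNorm_two_sq] at this
    have hdsum : ∑' n, ‖J t' n - J t n‖ₑ ^ 2 ≤ D * ∑' n, ∫⁻ s,
        ‖convFun S k (v n) t' s - convFun S k (v n) t s‖ₑ ^ 2 ∂μ := by
      rw [← ENNReal.tsum_mul_left]
      exact ENNReal.tsum_le_tsum hd
    have hdfin : ∑' n, ‖J t' n - J t n‖ₑ ^ 2 ≠ ∞ := by
      refine ne_top_of_le_ne_top (b := ∑' n, 2 ^ 2 * (‖J t' n‖ₑ ^ 2 + ‖J t n‖ₑ ^ 2)) ?_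
        (ENNReal.tsum_le_tsum fun n => ?_)
      · rw [ENNReal.tsum_mul_left, ENNReal.tsum_add]
        exact ENNReal.mul_ne_top (by finiteness) (ENNReal.add_ne_top.2 ⟨hJsum t', hJsum t⟩)
      · refine le_trans ?_ (ENNReal_add_pow_le _ _ 2)
        gcongr
        exact enorm_sub_le
    have h4 := (tsum_enorm_sq_of_pairwise_orthogonal (f := fun n => J t' n - J t n)
      (fun n m hnm => by
        simp only [inner_sub_left, inner_sub_right, horth _ _ n m hnm, sub_zero]) hdfin).2
    rw [edist_eq_enorm_sub, ← (hsummable t').tsum_sub (hsummable t)]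
    calc _ = (‖∑' n, (J t' n - J t n)‖ₑ ^ 2) ^ (1 / 2 : ℝ) := by
          rw [← ENNReal.rpow_natCast, ← ENNReal.rpow_mul]; norm_num
      _ ≤ _ := by gcongr; exact h4.trans hdsum
  · have h0 : ∀ n, J ⟨0, le_rfl, hb⟩ n = 0 := by
      intro n
      have h1 := hJle ⟨0, le_rfl, hb⟩ n
      have h2 : ∫⁻ s, ‖convFun S k (v n) 0 s‖ₑ ^ 2 ∂μ = 0 := by
        rw [lintegral_eq_zero_iff' ((hcm n 0).enorm.pow_const 2)]
        filter_upwards [ae_restrict_mem measurableSet_Icc] with s hs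
        have : k (0 - s) = 0 := indicator_of_notMem (fun h => by
          have : 0 < 0 - s := h.1
          linarith [hs.1]) _
        rw [zero_sub] at this
        simp [convFun, this]
      rw [h2, mul_zero] at h1
      simpa using h1
    simp [h0]

end StochConv

/-! ### The delay term as an operator on square integrable functions -/

section Delay

variable {X : Type*} [NormedAddCommGroup X] {r b : ℝ}

lemma lintegral_eq_eLpNorm_rpow {α E : Type*} [MeasurableSpace α] [NormedAddCommGroup E]
    (f : α → E) (μ : Measure α) : eLpNorm f 2 μ = (∫⁻ x, ‖f x‖ₑ ^ 2 ∂μ) ^ (1 / 2 : ℝ) := by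
  rw [← eLpNorm_two_sq, ← ENNReal.rpow_natCast, ← ENNReal.rpow_mul]; norm_num

/-- The hypotheses on the delay nonlinearity. -/
structure DelayHyp (hrb : -r ≤ b) (f : ℝ → C(Icc (-r) 0, X) → X) (Cf : ℝ) : Prop where
  meas : ∀ x : C(Icc (-r) b, X),
    AEStronglyMeasurable (fun s => f s (segment hrb x s)) (volume.restrict (Icc 0 b))
  lip : ∀ x y : C(Icc (-r) b, X), ∀ t ∈ Icc 0 b,
    ∫⁻ s in Icc 0 t, ‖f s (segment hrb x s) - f s (segment hrb y s)‖ₑ ^ 2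
      ≤ ENNReal.ofReal Cf * ∫⁻ s in Icc (-r) t,
        ‖x (projIcc (-r) b hrb s) - y (projIcc (-r) b hrb s)‖ₑ ^ 2
  sq_int : ∫⁻ s in Icc 0 b, ‖f s 0‖ₑ ^ 2 < ∞

variable {hrb : -r ≤ b} {f : ℝ → C(Icc (-r) 0, X) → X} {Cf : ℝ}

lemma DelayHyp.eLpNorm_le (hf : DelayHyp hrb f Cf) (x y : C(Icc (-r) b, X)) {t : ℝ}
    (ht : t ∈ Icc 0 b) :
    eLpNorm (fun s => f s (segment hrb x s) - f s (segment hrb y s)) 2 (volume.restrict (Icc 0 t)) ≤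
      ENNReal.ofReal Cf ^ (1 / 2 : ℝ) * eLpNorm (fun s => x (projIcc (-r) b hrb s) -
        y (projIcc (-r) b hrb s)) 2 (volume.restrict (Icc (-r) t)) := by
  rw [lintegral_eq_eLpNorm_rpow, lintegral_eq_eLpNorm_rpow,
    ← ENNReal.mul_rpow_of_nonneg _ _ (by norm_num)]
  gcongr
  exact hf.lip x y t ht

lemma continuous_comp_projIcc (x : C(Icc (-r) b, X)) :
    Continuous fun s => x (projIcc (-r) b hrb s) := x.continuous.comp continuous_projIcc

/-- The delay term is Lipschitz in `L²` on every initial interval. -/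
lemma IsDelayTerm.eLpNorm_diff_le (hf : DelayHyp hrb f Cf) {u u' g g' : ℝ → X}
    (h : IsDelayTerm hrb f u g) (h' : IsDelayTerm hrb f u' g') {t : ℝ} (ht : t ∈ Icc 0 b) :
    eLpNorm (fun s => g s - g' s) 2 (volume.restrict (Icc 0 t)) ≤
      ENNReal.ofReal Cf ^ (1 / 2 : ℝ) *
        eLpNorm (fun s => u s - u' s) 2 (volume.restrict (Icc (-r) t)) := by
  obtain ⟨hu, hg, z, hz, hzg⟩ := h
  obtain ⟨hu', hg', z', hz', hzg'⟩ := h'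
  set K := ENNReal.ofReal Cf ^ (1 / 2 : ℝ) with hK
  have hKt : K ≠ ∞ := ENNReal.rpow_ne_top_of_nonneg (by norm_num) (by simp)
  set μr := volume.restrict (Icc (-r) t) with hμr
  set μ0 := volume.restrict (Icc 0 t) with hμ0
  have hμr' : μr ≤ volume.restrict (Icc (-r) b) :=
    Measure.restrict_mono (Icc_subset_Icc_right ht.2) le_rfl
  have hμ0' : μ0 ≤ volume.restrict (Icc 0 b) :=
    Measure.restrict_mono (Icc_subset_Icc_right ht.2) le_rfl
  -- Inserting the continuous approximations bounds the left side by this quantity for each k; all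
  -- approximation errors vanish in the limit.
  have hlim : Tendsto (fun k => eLpNorm (fun s => f s (segment hrb (z k) s) - g s) 2
      (volume.restrict (Icc 0 b)) + K * (eLpNorm (fun s => z k (projIcc (-r) b hrb s) - u s) 2
      (volume.restrict (Icc (-r) b)) + eLpNorm (fun s => u s - u' s) 2 μr +
      eLpNorm (fun s => z' k (projIcc (-r) b hrb s) - u' s) 2 (volume.restrict (Icc (-r) b))) +
      eLpNorm (fun s => f s (segment hrb (z' k) s) - g' s) 2 (volume.restrict (Icc 0 b))) atTop
      (𝓝 (K * eLpNorm (fun s => u s - u' s) 2 μr)) := by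
    have h1 := ENNReal.Tendsto.const_mul ((hz.add (tendsto_const_nhds
      (x := eLpNorm (fun s => u s - u' s) 2 μr))).add hz') (a := K) (Or.inr hKt)
    simpa using (hzg.add h1).add hzg'
  refine ge_of_tendsto' hlim fun k => ?_
  have mg : AEStronglyMeasurable g μ0 := hg.1.mono_measure hμ0'
  have mg' : AEStronglyMeasurable g' μ0 := hg'.1.mono_measure hμ0'
  have mf : AEStronglyMeasurable (fun s => f s (segment hrb (z k) s)) μ0 :=
    (hf.meas (z k)).mono_measure hμ0'
  have mf' : AEStronglyMeasurable (fun s => f s (segment hrb (z' k) s)) μ0 :=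
    (hf.meas (z' k)).mono_measure hμ0'
  have mu : AEStronglyMeasurable u μr := hu.1.mono_measure hμr'
  have mu' : AEStronglyMeasurable u' μr := hu'.1.mono_measure hμr'
  have mz : AEStronglyMeasurable (fun s => z k (projIcc (-r) b hrb s)) μr :=
    (continuous_comp_projIcc (z k)).aestronglyMeasurable
  have mz' : AEStronglyMeasurable (fun s => z' k (projIcc (-r) b hrb s)) μr :=
    (continuous_comp_projIcc (z' k)).aestronglyMeasurable
  have e1 : eLpNorm (fun s => z k (projIcc (-r) b hrb s) - z' k (projIcc (-r) b hrb s)) 2 μr ≤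
      eLpNorm (fun s => z k (projIcc (-r) b hrb s) - u s) 2 (volume.restrict (Icc (-r) b)) +
      eLpNorm (fun s => u s - u' s) 2 μr +
      eLpNorm (fun s => z' k (projIcc (-r) b hrb s) - u' s) 2 (volume.restrict (Icc (-r) b)) := by
    have e : (fun s => z k (projIcc (-r) b hrb s) - z' k (projIcc (-r) b hrb s)) =
        ((fun s => z k (projIcc (-r) b hrb s) - u s) + fun s => u s - u' s) -
        fun s => z' k (projIcc (-r) b hrb s) - u' s := by
      ext s; simp
    rw [e]
    refine (eLpNorm_sub_le ((mz.sub mu).add (mu.sub mu')) (mz'.sub mu') (by norm_num)).trans ?_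
    refine add_le_add ((eLpNorm_add_le (mz.sub mu) (mu.sub mu') (by norm_num)).trans ?_)
      (eLpNorm_mono_measure _ hμr')
    exact add_le_add (eLpNorm_mono_measure _ hμr') le_rfl
  have e : (fun s => g s - g' s) = ((fun s => f s (segment hrb (z k) s) - f s (segment hrb (z' k) s)) -
      fun s => f s (segment hrb (z k) s) - g s) + fun s => f s (segment hrb (z' k) s) - g' s := by
    ext s; simp
  rw [e]
  refine (eLpNorm_add_le ((mf.sub mf').sub (mf.sub mg)) (mf'.sub mg') (by norm_num)).trans ?_
  refine add_le_add ((eLpNorm_sub_le (mf.sub mf') (mf.sub mg) (by norm_num)).trans ?_)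
    (eLpNorm_mono_measure _ hμ0')
  rw [add_comm]
  refine add_le_add (eLpNorm_mono_measure _ hμ0') ((hf.eLpNorm_le (z k) (z' k) ht).trans ?_)
  gcongr

lemma IsDelayTerm.congr_left {u u' g : ℝ → X} (h : IsDelayTerm hrb f u g)
    (huu' : u =ᵐ[volume.restrict (Icc (-r) b)] u') : IsDelayTerm hrb f u' g := by
  obtain ⟨hu, hg, z, hz, hzg⟩ := h
  refine ⟨(memLp_congr_ae huu').1 hu, hg, z, hz.congr fun k => eLpNorm_congr_ae ?_, hzg⟩
  filter_upwards [huu'] with s hs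
  rw [hs]

/-- Comparison with the zero function, whose segments are zero and whose image is square integrable
by assumption. -/
lemma DelayHyp.memLp (hb : 0 ≤ b) (hf : DelayHyp hrb f Cf) (z : C(Icc (-r) b, X)) :
    MemLp (fun s => f s (segment hrb z s)) 2 (volume.restrict (Icc 0 b)) := by
  have h0 : ∀ s, segment hrb (0 : C(Icc (-r) b, X)) s = 0 := fun s => rfl
  have m0 : MemLp (fun s => f s (segment hrb (0 : C(Icc (-r) b, X)) s)) 2
      (volume.restrict (Icc 0 b)) := by
    refine ⟨hf.meas 0, ?_⟩
    rw [lintegral_eq_eLpNorm_rpow]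
    simp only [h0]
    exact ENNReal.rpow_lt_top_of_nonneg (by norm_num) hf.sq_int.ne
  have m1 : MemLp (fun s => f s (segment hrb z s) - f s (segment hrb (0 : C(Icc (-r) b, X)) s)) 2
      (volume.restrict (Icc 0 b)) := by
    refine ⟨(hf.meas z).sub (hf.meas 0), (hf.eLpNorm_le z 0 ⟨hb, le_rfl⟩).trans_lt ?_⟩
    refine ENNReal.mul_lt_top (ENNReal.rpow_lt_top_of_nonneg (by norm_num) (by simp)) ?_
    have : MemLp (fun s => z (projIcc (-r) b hrb s) - (0 : C(Icc (-r) b, X)) (projIcc (-r) b hrb s)) 2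
        (volume.restrict (Icc (-r) b)) := by
      refine MemLp.of_bound ((continuous_comp_projIcc z).sub
        (continuous_comp_projIcc 0)).aestronglyMeasurable ‖z‖ (Eventually.of_forall fun s => ?_)
      simpa using z.norm_coe_le_norm _
    exact this.2
  convert m1.add m0 using 1
  ext s
  simp

/-- Continuous functions are dense in L², and the Lipschitz bound sends an approximating sequence to
a Cauchy sequence. -/
lemma DelayHyp.exists_isDelayTerm [NormedSpace ℝ X] [CompleteSpace X] (hb : 0 ≤ b)
    (hf : DelayHyp hrb f Cf) {u : ℝ → X} (hu : MemLp u 2 (volume.restrict (Icc (-r) b))) :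
    ∃ g : Lp X 2 (volume.restrict (Icc (0 : ℝ) b)), IsDelayTerm hrb f u g := by
  set μr := volume.restrict (Icc (-r) b) with hμr
  set μ0 := volume.restrict (Icc (0:ℝ) b) with hμ0
  have key : ∀ k : ℕ, ∃ z : C(Icc (-r) b, X),
      eLpNorm (fun s => z (projIcc (-r) b hrb s) - u s) 2 μr ≤
        ENNReal.ofReal (1 / ((k : ℝ) + 1)) := by
    intro k
    have hk : 0 < 1 / ((k : ℝ) + 1) := by positivity
    obtain ⟨g, hg, hgm⟩ := hu.exists_boundedContinuous_eLpNorm_sub_le (by simp)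
      (ε := ENNReal.ofReal (1 / ((k : ℝ) + 1))) (by simpa using by positivity)
    refine ⟨⟨fun s => g s, by fun_prop⟩, ?_⟩
    rw [eLpNorm_sub_comm] at hg
    refine le_trans (le_of_eq (eLpNorm_congr_ae ?_)) hg
    filter_upwards [ae_restrict_mem measurableSet_Icc] with s hs
    simp [projIcc_of_mem hrb hs]
  choose z hz using key
  have hz0 : Tendsto (fun k => eLpNorm (fun s => z k (projIcc (-r) b hrb s) - u s) 2 μr) atTop
      (𝓝 0) := by
    refine tendsto_of_tendsto_of_tendsto_of_le_of_le tendsto_const_nhds ?_ (fun _ => zero_le) hz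
    have := ENNReal.tendsto_ofReal (tendsto_one_div_add_atTop_nhds_zero_nat (𝕜 := ℝ))
    simpa using this
  have mz : ∀ k, MemLp (fun s => z k (projIcc (-r) b hrb s)) 2 μr := fun k =>
    MemLp.of_bound (continuous_comp_projIcc (z k)).aestronglyMeasurable ‖z k‖
      (Eventually.of_forall fun s => (z k).norm_coe_le_norm _)
  have hz' : Tendsto (fun k => (mz k).toLp) atTop (𝓝 hu.toLp) :=
    (Lp.tendsto_Lp_iff_tendsto_eLpNorm'' _ _ _ _).2 hz0
  have hcau := cauchySeq_iff_tendsto_dist_atTop_0.1 hz'.cauchySeq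
  have hcau2 : CauchySeq fun k => (hf.memLp hb (z k)).toLp := by
    rw [cauchySeq_iff_tendsto_dist_atTop_0]
    have h0 := hcau.const_mul (ENNReal.ofReal Cf ^ (1 / 2 : ℝ)).toReal
    rw [mul_zero] at h0
    refine squeeze_zero (fun _ => dist_nonneg) (fun p => ?_) h0
    rw [dist_eq_norm, dist_eq_norm, ← MemLp.toLp_sub, ← MemLp.toLp_sub, Lp.norm_toLp, Lp.norm_toLp,
      ← ENNReal.toReal_mul]
    refine ENNReal.toReal_mono ?_ (hf.eLpNorm_le (z p.1) (z p.2) ⟨hb, le_rfl⟩)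
    exact ENNReal.mul_ne_top (ENNReal.rpow_ne_top_of_nonneg (by norm_num) (by simp))
      ((mz p.1).sub (mz p.2)).2.ne
  obtain ⟨g, hg⟩ := cauchySeq_tendsto_of_complete hcau2
  refine ⟨g, hu, Lp.memLp g, z, hz0, ?_⟩
  rw [Lp.tendsto_Lp_iff_tendsto_eLpNorm'] at hg
  refine hg.congr fun k => eLpNorm_congr_ae ?_
  filter_upwards [(hf.memLp hb (z k)).coeFn_toLp] with s hs
  simp [hs]

end Delay

/-! ### The deterministic convolution operator -/

section Drift

lemma lintegral_enorm_mul_le {E : Type*} [NormedAddCommGroup E] {μ : Measure ℝ} {κ : ℝ → ℝ}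
    (hκ : AEMeasurable κ μ) {g : ℝ → E} (hg : AEStronglyMeasurable g μ) :
    ∫⁻ s, ‖κ s‖ₑ * ‖g s‖ₑ ∂μ ≤ eLpNorm κ 2 μ * eLpNorm g 2 μ := by
  refine (ENNReal.lintegral_mul_le_Lp_mul_Lq μ Real.HolderConjugate.two_two hκ.enorm
    hg.enorm).trans (le_of_eq ?_)
  rw [lintegral_eq_eLpNorm_rpow, lintegral_eq_eLpNorm_rpow]
  simp

variable {X : Type*} [NormedAddCommGroup X] [NormedSpace ℝ X]

/-- Cauchy–Schwarz with a square integrable kernel. As the kernel vanishes on the negative axis, the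
value at t is bounded by the norm over [0,t] alone; this causality makes the fixed point map of
Volterra type. -/
lemma exists_drift_family [CompleteSpace X] {S : ℝ → X →L[ℝ] X}
    (hS : ∀ η, Continuous fun t => S t η)
    {C : ℝ≥0} (hC : ∀ t, ‖S t‖ ≤ C) {k : ℝ → ℝ} (hkm : Measurable k) (hk : MemLp k 2 volume)
    (hk0 : ∀ x ≤ 0, k x = 0) (b : ℝ) :
    ∃ (K : ℝ → Lp X 2 (volume.restrict (Icc (0:ℝ) b)) →L[ℝ] X) (D : ℝ≥0),
      (∀ t g, K t g = ∫ s in Icc 0 b, convFun S k g t s) ∧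
      (∀ g, Continuous fun t => K t g) ∧
      (∀ t ≤ b, ∀ g, ‖K t g‖ₑ ≤ D * eLpNorm g 2 (volume.restrict (Icc 0 t))) ∧
      ∀ t, ‖K t‖ ≤ D := by
  set μ := volume.restrict (Icc (0:ℝ) b) with hμ
  have hmp : ∀ t : ℝ, MeasurePreserving (fun s : ℝ => t - s) volume volume := fun t =>
    Measure.measurePreserving_sub_left volume t
  have hkt : ∀ t : ℝ, Measurable fun s => k (t - s) := fun t =>
    hkm.comp (measurable_const.sub measurable_id)
  set D : ℝ≥0 := C * (eLpNorm k 2 volume).toNNReal with hD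
  have hDe : (D : ℝ≥0∞) = C * eLpNorm k 2 volume := by
    rw [hD, ENNReal.coe_mul, ENNReal.coe_toNNReal hk.2.ne]
  have hkn : ∀ t (ν : Measure ℝ), ν ≤ volume → eLpNorm (fun s => k (t - s)) 2 ν ≤
      eLpNorm k 2 volume := by
    intro t ν hν
    refine (eLpNorm_mono_measure _ hν).trans (le_of_eq ?_)
    exact eLpNorm_comp_measurePreserving hk.1 (hmp t)
  have hle : ∀ t (ν : Measure ℝ), ν ≤ volume → ∀ g : ℝ → X, AEStronglyMeasurable g ν →
      ∫⁻ s, ‖convFun S k g t s‖ₑ ∂ν ≤ D * eLpNorm g 2 ν := by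
    intro t ν hν g hg
    calc ∫⁻ s, ‖convFun S k g t s‖ₑ ∂ν ≤ ∫⁻ s, C * (‖k (t - s)‖ₑ * ‖g s‖ₑ) ∂ν :=
          lintegral_mono fun s => enorm_convFun_le hC k g t s
      _ = C * ∫⁻ s, ‖k (t - s)‖ₑ * ‖g s‖ₑ ∂ν := lintegral_const_mul' _ _ (by simp)
      _ ≤ C * (eLpNorm k 2 volume * eLpNorm g 2 ν) := by
          gcongr
          refine (lintegral_enorm_mul_le (hkt t).aemeasurable hg).trans ?_
          gcongr
          exact hkn t ν hν
      _ = _ := by rw [hDe, mul_assoc]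
  have hμle : μ ≤ volume := Measure.restrict_le_self
  have hint : ∀ t (g : Lp X 2 μ), Integrable (convFun S k g t) μ := fun t g =>
    ⟨aestronglyMeasurable_convFun hS hC hkm (Lp.aestronglyMeasurable g) t,
      (hle t μ hμle g (Lp.aestronglyMeasurable g)).trans_lt
        (ENNReal.mul_lt_top (by simp) (Lp.memLp g).2)⟩
  have hnorm : ∀ t (g : Lp X 2 μ), ‖∫ s, convFun S k g t s ∂μ‖ ≤ D * ‖g‖ := by
    intro t g
    have h1 := (enorm_integral_le_lintegral_enorm (convFun S k g t)).trans
      (hle t μ hμle g (Lp.aestronglyMeasurable g))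
    rw [← Lp.enorm_def] at h1
    simp only [enorm_eq_nnnorm] at h1
    exact_mod_cast h1
  let K : ℝ → Lp X 2 μ →L[ℝ] X := fun t => LinearMap.mkContinuous
    { toFun := fun g => ∫ s, convFun S k g t s ∂μ
      map_add' := fun g g' => by
        rw [← integral_add (hint t g) (hint t g')]
        refine integral_congr_ae ?_
        filter_upwards [Lp.coeFn_add g g'] with s hs
        simp only [convFun, hs, Pi.add_apply, map_add, smul_add]
      map_smul' := fun c g => by
        rw [RingHom.id_apply, ← integral_smul]
        refine integral_congr_ae ?_
        filter_upwards [Lp.coeFn_smul c g] with s hs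
        simp [convFun, hs, smul_comm c] }
    D (hnorm t)
  refine ⟨K, D, fun t g => rfl, fun g => ?_, fun t ht g => ?_, fun t =>
    LinearMap.mkContinuous_norm_le _ D.coe_nonneg _⟩
  · refine continuous_iff_continuousAt.2 fun t => ?_
    have hg := Lp.aestronglyMeasurable g
    have h1 : Tendsto (fun t' => ∫⁻ s, ‖k (t' - s) - k (t - s)‖ₑ ^ 1 *
        ∑' _ : Unit, ‖g s‖ₑ ^ 1 ∂μ) (𝓝 t) (𝓝 0) := by
      have h2 := ENNReal.Tendsto.mul_const (tendsto_eLpNorm_comp_sub_left (by norm_num) (by simp)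
        hk t) (b := eLpNorm g 2 μ) (Or.inr (Lp.memLp g).2.ne)
      rw [zero_mul] at h2
      refine tendsto_of_tendsto_of_tendsto_of_le_of_le tendsto_const_nhds h2 (fun _ => zero_le)
        fun t' => ?_
      simp only [pow_one, tsum_fintype, Finset.univ_unique, Finset.sum_const, Finset.card_singleton,
        one_smul]
      refine (lintegral_enorm_mul_le ((hkt t').sub (hkt t)).aemeasurable hg).trans ?_
      gcongr
      exact eLpNorm_mono_measure _ hμle
    have h3 : ∫⁻ s, ‖k (t - s)‖ₑ ^ 1 * ∑' _ : Unit, ‖g s‖ₑ ^ 1 ∂μ ≠ ∞ := by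
      simp only [pow_one, tsum_fintype, Finset.univ_unique, Finset.sum_const, Finset.card_singleton,
        one_smul]
      refine ne_top_of_le_ne_top ?_ (lintegral_enorm_mul_le (hkt t).aemeasurable hg)
      exact ENNReal.mul_ne_top (ne_top_of_le_ne_top hk.2.ne (hkn t μ hμle)) (Lp.memLp g).2.ne
    have h4 := tendsto_tsum_lintegral_convFun hS hC hkm (v := fun _ : Unit => (g : ℝ → X))
      (fun _ => hg) one_ne_zero t h1 h3
    simp only [pow_one, tsum_fintype, Finset.univ_unique, Finset.sum_const, Finset.card_singleton,
        one_smul] at h4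
    rw [ContinuousAt, tendsto_iff_edist_tendsto_0]
    refine tendsto_of_tendsto_of_tendsto_of_le_of_le tendsto_const_nhds h4 (fun _ => zero_le)
      fun t' => ?_
    change edist (∫ s, convFun S k g t' s ∂μ) (∫ s, convFun S k g t s ∂μ) ≤ _
    rw [edist_eq_enorm_sub, ← integral_sub (hint t' g) (hint t g)]
    exact enorm_integral_le_lintegral_enorm _
  · change ‖∫ s, convFun S k g t s ∂μ‖ₑ ≤ _
    have hsub : Icc 0 t ⊆ Icc 0 b := Icc_subset_Icc_right ht
    have e : ∫ s, convFun S k g t s ∂μ = ∫ s in Icc 0 t, convFun S k g t s := by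
      refine setIntegral_eq_of_subset_of_forall_sdiff_eq_zero measurableSet_Icc hsub fun s hs => ?_
      have : t - s ≤ 0 := by
        by_contra! h
        exact hs.2 ⟨hs.1.1, by linarith⟩
      simp [convFun, hk0 _ this]
    rw [e]
    refine (enorm_integral_le_lintegral_enorm _).trans (hle t _ Measure.restrict_le_self g ?_)
    exact (Lp.aestronglyMeasurable g).mono_measure (Measure.restrict_mono hsub le_rfl)

/-- A bounded strongly continuous family of operators acts strongly continuously on `L²`. -/
lemma continuous_compLp {E Z Ω : Type*} [NormedAddCommGroup E] [NormedSpace ℝ E]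
    [TopologicalSpace Z] [FirstCountableTopology Z] [MeasurableSpace Ω] {P : Measure Ω}
    {A : Z → E →L[ℝ] X} (hA : ∀ g, Continuous fun z => A z g) {C : ℝ≥0} (hC : ∀ z, ‖A z‖ ≤ C)
    (G : Lp E 2 P) : Continuous fun z => (A z).compLp G := by
  refine continuous_iff_continuousAt.2 fun z => ?_
  refine tendsto_of_seq_tendsto fun u hu => ?_
  rw [Lp.tendsto_Lp_iff_tendsto_eLpNorm']
  have e : ∀ i, eLpNorm (⇑((A (u i)).compLp G) - ⇑((A z).compLp G)) 2 P =
      (∫⁻ ω, ‖A (u i) (G ω) - A z (G ω)‖ₑ ^ 2 ∂P) ^ (1 / 2 : ℝ) := by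
    intro i
    rw [← lintegral_eq_eLpNorm_rpow]
    refine eLpNorm_congr_ae ?_
    filter_upwards [(A (u i)).coeFn_compLp G, (A z).coeFn_compLp G] with ω h1 h2
    simp [h1, h2]
  have hlim : Tendsto (fun i => ∫⁻ ω, ‖A (u i) (G ω) - A z (G ω)‖ₑ ^ 2 ∂P) atTop (𝓝 0) := by
    have hG := Lp.aestronglyMeasurable G
    have := tendsto_lintegral_of_dominated_convergence' (μ := P)
      (F := fun i ω => ‖A (u i) (G ω) - A z (G ω)‖ₑ ^ 2) (f := fun _ => 0)
      (fun ω => (2 * C * ‖G ω‖ₑ) ^ 2)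
      (fun i => ((((A (u i)).continuous.comp_aestronglyMeasurable hG).sub
        ((A z).continuous.comp_aestronglyMeasurable hG)).enorm).pow_const 2)
      (fun i => Eventually.of_forall fun ω => ?_) ?_ (Eventually.of_forall fun ω => ?_)
    · rw [lintegral_zero] at this
      exact this
    · have hb : ∀ z, ‖A z (G ω)‖ₑ ≤ C * ‖G ω‖ₑ := fun z => by
        have := ((A z).le_opNorm (G ω)).trans (mul_le_mul_of_nonneg_right (hC _) (norm_nonneg _))
        simp only [enorm_eq_nnnorm]
        exact_mod_cast this
      simp only
      gcongr
      refine enorm_sub_le.trans ?_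
      rw [mul_assoc, two_mul]
      exact add_le_add (hb _) (hb _)
    · simp_rw [mul_pow]
      rw [lintegral_const_mul' _ _ (by finiteness), ← eLpNorm_two_sq]
      have := (Lp.memLp G).2.ne
      finiteness
    · have h1 : Tendsto (fun z' => ‖A z' (G ω) - A z (G ω)‖ₑ ^ 2) (𝓝 z) (𝓝 0) := by
        have h2 : Continuous fun z' => ‖A z' (G ω) - A z (G ω)‖ₑ ^ 2 :=
          (ENNReal.continuous_pow 2).comp ((hA (G ω)).sub continuous_const).enorm
        simpa using h2.tendsto z
      exact h1.comp hu
  have h3 := (ENNReal.continuous_rpow_const (y := (1 / 2 : ℝ))).tendsto 0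
  rw [ENNReal.zero_rpow_of_pos (by norm_num)] at h3
  exact (h3.comp hlim).congr fun i => (e i).symm

end Drift

/-! ### Jointly measurable modifications and the delay term of a mean square continuous process -/

section Modification

variable {X Ω : Type*} [NormedAddCommGroup X] [MeasurableSpace Ω] {P : Measure Ω} {r b : ℝ}

/-- `ξ` is a jointly measurable modification of `x`. -/
structure IsModification (ξ : ℝ → Ω → X) (x : C(Icc (-r) b, Lp X 2 P)) : Prop where
  meas : StronglyMeasurable (Function.uncurry ξ)
  ae_eq : ∀ s : Icc (-r) b, ξ s =ᵐ[P] x s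

lemma stronglyMeasurable_uncurry_comp [TopologicalSpace.SeparableSpace X] {g : ℤ → Ω → X}
    (hg : ∀ i, StronglyMeasurable (g i)) {n : ℝ → ℤ} (hn : Measurable n) :
    StronglyMeasurable (Function.uncurry fun s ω => g (n s) ω) := by
  borelize X
  have := UniformSpace.secondCountable_of_separable X
  have h1 : Measurable (Function.uncurry g) :=
    measurable_from_prod_countable_right fun i => (hg i).measurable
  exact (h1.comp ((hn.comp measurable_fst).prodMk measurable_snd)).stronglyMeasurable

/-- A mean square continuous process has a jointly measurable modification. -/
lemma exists_isModification [CompleteSpace X] [TopologicalSpace.SeparableSpace X]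
    (hrb : -r ≤ b) (x : C(Icc (-r) b, Lp X 2 P)) : ∃ ξ : ℝ → Ω → X, IsModification ξ x := by
  have hu := CompactSpace.uniformContinuous_of_continuous x.continuous
  rw [Metric.uniformContinuous_iff] at hu
  -- Discretising time with mesh 1/N gives processes with countably many values of the time index,
  -- hence jointly measurable. Errors 2^(-k) have summable squares, so they converge almost surely
  -- at each time.
  have key : ∀ k : ℕ, ∃ N : ℕ, 0 < N ∧ ∀ s : Icc (-r) b,
      dist (x (projIcc (-r) b hrb (⌊(s : ℝ) * N⌋ / N))) (x s) ≤ (1 / 2) ^ k := by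
    intro k
    obtain ⟨δ, hδ, h⟩ := hu ((1 / 2) ^ k) (by positivity)
    obtain ⟨N, hN⟩ := exists_nat_gt (1 / δ)
    have hN0 : (0 : ℝ) < N := lt_trans (by positivity) hN
    refine ⟨N, by exact_mod_cast hN0, fun s => (h ?_).le⟩
    have e : projIcc (-r) b hrb (s : ℝ) = s := projIcc_val hrb s
    have h1 : dist (projIcc (-r) b hrb (⌊(s : ℝ) * N⌋ / N)) (projIcc (-r) b hrb (s : ℝ)) ≤
        dist ((⌊(s : ℝ) * N⌋ : ℝ) / N) s := by
      simpa using (LipschitzWith.projIcc hrb).dist_le_mul ((⌊(s : ℝ) * N⌋ : ℝ) / N) s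
    rw [e] at h1
    refine h1.trans_lt ?_
    rw [Real.dist_eq, abs_sub_lt_iff]
    have h2 := Int.floor_le ((s : ℝ) * N)
    have h3 := Int.lt_floor_add_one ((s : ℝ) * N)
    rw [div_lt_iff₀ hδ] at hN
    constructor
    · have : (⌊(s : ℝ) * N⌋ : ℝ) / N ≤ s := by rw [div_le_iff₀ hN0]; exact h2
      linarith
    · have : s - δ < (⌊(s : ℝ) * N⌋ : ℝ) / N := by rw [lt_div_iff₀ hN0]; nlinarith
      linarith
  choose N hN0 hN using key
  let q : ℕ → ℤ → Icc (-r) b := fun k i => projIcc (-r) b hrb (i / N k)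
  let ζ : ℕ → ℝ → Ω → X := fun k s ω => x (q k ⌊s * N k⌋) ω
  have hζ : ∀ k, StronglyMeasurable (Function.uncurry (ζ k)) := fun k =>
    stronglyMeasurable_uncurry_comp (g := fun i ω => x (q k i) ω)
      (fun i => Lp.stronglyMeasurable _) (Int.measurable_floor.comp (measurable_id.mul_const _))
  refine ⟨fun s ω => limUnder atTop fun k => ζ k s ω, ?_, fun s => ?_⟩
  · exact StronglyMeasurable.limUnder hζ
  have hm : ∀ k, AEStronglyMeasurable (fun ω => ζ k s ω - x s ω) P := fun k =>
    (Lp.aestronglyMeasurable _).sub (Lp.aestronglyMeasurable _)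
  have hle : ∀ k, ∫⁻ ω, ‖ζ k s ω - x s ω‖ₑ ^ 2 ∂P ≤ ENNReal.ofReal ((1 / 4) ^ k) := by
    intro k
    have h1 := hN k s
    rw [dist_eq_norm] at h1
    rw [← eLpNorm_two_sq]
    have h2 : eLpNorm (fun ω => ζ k s ω - x s ω) 2 P = ENNReal.ofReal
        ‖x (projIcc (-r) b hrb (⌊(s : ℝ) * N k⌋ / N k)) - x s‖ := by
      rw [ofReal_norm, Lp.enorm_def]
      exact eLpNorm_congr_ae (Lp.coeFn_sub _ _).symm
    rw [h2, ← ENNReal.ofReal_pow (norm_nonneg _)]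
    refine ENNReal.ofReal_le_ofReal ((pow_le_pow_left₀ (norm_nonneg _) h1 2).trans (le_of_eq ?_))
    rw [← pow_mul, mul_comm, pow_mul]; norm_num
  have hsum : ∫⁻ ω, ∑' k, ‖ζ k s ω - x s ω‖ₑ ^ 2 ∂P ≠ ∞ := by
    rw [lintegral_tsum fun k => (hm k).enorm.pow_const 2]
    refine ne_top_of_le_ne_top ?_ (ENNReal.tsum_le_tsum hle)
    exact (summable_geometric_of_lt_one (by norm_num) (by norm_num)).tsum_ofReal_ne_top
  have hae := ae_lt_top' (AEMeasurable.tsum fun k => (hm k).enorm.pow_const 2) hsum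
  filter_upwards [hae] with ω hω
  have h0 := ENNReal.tendsto_atTop_zero_of_tsum_ne_top hω.ne
  refine Tendsto.limUnder_eq (tendsto_iff_edist_tendsto_0.2 ?_)
  have h3 := ((ENNReal.continuous_rpow_const (y := (1 / 2 : ℝ))).tendsto 0).comp h0
  rw [ENNReal.zero_rpow_of_pos (by norm_num)] at h3
  refine h3.congr fun k => ?_
  simp only [Function.comp_apply, edist_eq_enorm_sub]
  rw [← ENNReal.rpow_natCast, ← ENNReal.rpow_mul]; norm_num

/-- By Tonelli the path distance depends only on the mean square processes. For one process it shows
that almost all paths of two modifications agree almost everywhere. -/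
lemma IsModification.lintegral_lintegral_sub [SFinite P] {hrb : -r ≤ b} {ξ ξ' : ℝ → Ω → X}
    {x x' : C(Icc (-r) b, Lp X 2 P)} (h : IsModification ξ x) (h' : IsModification ξ' x') {t : ℝ}
    (ht : t ≤ b) :
    ∫⁻ ω, (∫⁻ s in Icc (-r) t, ‖ξ s ω - ξ' s ω‖ₑ ^ 2) ∂P =
      ∫⁻ s in Icc (-r) t, ‖x (projIcc (-r) b hrb s) - x' (projIcc (-r) b hrb s)‖ₑ ^ 2 := by
  rw [lintegral_lintegral_swap]
  · refine setLIntegral_congr_fun measurableSet_Icc fun s hs => ?_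
    have hs' : s ∈ Icc (-r) b := ⟨hs.1, hs.2.trans ht⟩
    rw [← eLpNorm_two_sq, Lp.enorm_def]
    congr 1
    refine eLpNorm_congr_ae ?_
    filter_upwards [h.ae_eq ⟨s, hs'⟩, h'.ae_eq ⟨s, hs'⟩,
      Lp.coeFn_sub (x (projIcc (-r) b hrb s)) (x' (projIcc (-r) b hrb s))] with ω h1 h2 h3
    rw [h3, Pi.sub_apply, projIcc_of_mem hrb hs', ← h1, ← h2]
  · exact (((h.meas.sub h'.meas).comp_measurable measurable_swap).enorm.pow_const 2).aemeasurable

/-- Open sets are countable unions of rational balls around a dense sequence. For L²-valued maps the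
distances are integrals with a parameter, whose measurability is accessible. -/
lemma measurable_of_measurable_dist {E : Type*} [PseudoMetricSpace E] [SecondCountableTopology E]
    [MeasurableSpace E] [BorelSpace E] {F : Ω → E} (h : ∀ d, Measurable fun ω => dist (F ω) d) :
    Measurable F := by
  refine measurable_of_isOpen fun U hU => ?_
  obtain ⟨D, hD, hD'⟩ := TopologicalSpace.exists_countable_dense E
  have e : F ⁻¹' U = ⋃ d ∈ D, ⋃ q : ℚ, ⋃ (_ : Metric.ball d q ⊆ U), {ω | dist (F ω) d < q} := by
    ext ω
    simp only [mem_preimage, mem_iUnion, mem_ofPred_eq, exists_prop]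
    constructor
    · intro hω
      obtain ⟨ε, hε, hεU⟩ := Metric.isOpen_iff.1 hU _ hω
      obtain ⟨d, hd, hdD⟩ := hD'.exists_dist_lt (F ω) (half_pos hε)
      obtain ⟨q, hq1, hq2⟩ := exists_rat_btwn hdD
      refine ⟨d, hd, q, fun y hy => hεU ?_, hq1⟩
      rw [Metric.mem_ball] at hy ⊢
      linarith [dist_triangle y d (F ω), dist_comm d (F ω)]
    · rintro ⟨d, -, q, hq, h⟩
      exact hq h
  rw [e]
  exact MeasurableSet.biUnion hD fun d _ => MeasurableSet.iUnion fun q =>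
    MeasurableSet.iUnion fun _ => measurableSet_lt (h d) measurable_const

/-- The paths of a jointly measurable modification form a square integrable random element of
`L²`. -/
lemma IsModification.exists_path [IsFiniteMeasure P] [TopologicalSpace.SeparableSpace X]
    (hrb : -r ≤ b) {ξ : ℝ → Ω → X} {x : C(Icc (-r) b, Lp X 2 P)} (h : IsModification ξ x) :
    ∃ Ξ : Ω → Lp X 2 (volume.restrict (Icc (-r) b)), MemLp Ξ 2 P ∧
      ∀ᵐ ω ∂P, (fun s => ξ s ω) =ᵐ[volume.restrict (Icc (-r) b)] Ξ ω := by
  classical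
  set μ := volume.restrict (Icc (-r) b) with hμ
  have hm : ∀ ω, StronglyMeasurable fun s => ξ s ω := fun ω => h.meas.of_uncurry_right
  have h0 : IsModification (fun _ _ => (0 : X)) (0 : C(Icc (-r) b, Lp X 2 P)) :=
    ⟨stronglyMeasurable_const, fun s => (Lp.coeFn_zero X 2 P).symm⟩
  have hI : ∫⁻ ω, ∫⁻ s, ‖ξ s ω‖ₑ ^ 2 ∂μ ∂P < ∞ := by
    have := h.lintegral_lintegral_sub (hrb := hrb) h0 le_rfl
    simp only [sub_zero, ContinuousMap.zero_apply] at this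
    rw [hμ, this]
    calc ∫⁻ s in Icc (-r) b, ‖x (projIcc (-r) b hrb s)‖ₑ ^ 2
        ≤ ∫⁻ s in Icc (-r) b, ‖x‖ₑ ^ 2 := by
          refine lintegral_mono fun s => ?_
          gcongr
          simp only [← ofReal_norm]
          exact ENNReal.ofReal_le_ofReal (x.norm_coe_le_norm _)
      _ < ∞ := by simp [ENNReal.mul_lt_top_iff]
  have hmeasI : ∀ d : ℝ → X, StronglyMeasurable d →
      Measurable fun ω => ∫⁻ s, ‖ξ s ω - d s‖ₑ ^ 2 ∂μ := fun d hd =>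
    Measurable.lintegral_prod_left
      ((h.meas.sub (hd.comp_measurable measurable_fst)).enorm.pow_const 2)
  have hmeas0 : Measurable fun ω => ∫⁻ s, ‖ξ s ω‖ₑ ^ 2 ∂μ := by
    simpa using hmeasI 0 stronglyMeasurable_zero
  have hiff : ∀ ω, MemLp (fun s => ξ s ω) 2 μ ↔ ∫⁻ s, ‖ξ s ω‖ₑ ^ 2 ∂μ < ∞ := by
    intro ω
    rw [MemLp, lintegral_eq_eLpNorm_rpow, ENNReal.rpow_lt_top_iff_of_pos (by norm_num)]
    exact and_iff_right (hm ω).aestronglyMeasurable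
  have hset : MeasurableSet {ω | MemLp (fun s => ξ s ω) 2 μ} := by
    simp_rw [hiff]
    exact measurableSet_lt hmeas0 measurable_const
  -- Paths outside L² are replaced by 0; they form a measurable null set.
  let Ξ : Ω → Lp X 2 μ := fun ω => if hω : MemLp (fun s => ξ s ω) 2 μ then hω.toLp else 0
  have hΞ : ∀ ω, MemLp (fun s => ξ s ω) 2 μ → (fun s => ξ s ω) =ᵐ[μ] Ξ ω := by
    intro ω hω
    simp only [Ξ, dif_pos hω]
    exact hω.coeFn_toLp.symm
  have hΞm : ∀ d, Measurable fun ω => dist (Ξ ω) d := by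
    intro d
    have e : (fun ω => dist (Ξ ω) d) = fun ω => if MemLp (fun s => ξ s ω) 2 μ then
        ((∫⁻ s, ‖ξ s ω - d s‖ₑ ^ 2 ∂μ) ^ (1 / 2 : ℝ)).toReal else dist 0 d := by
      ext ω
      split_ifs with hω
      · rw [dist_eq_norm, Lp.norm_def, ← lintegral_eq_eLpNorm_rpow]
        congr 1
        refine eLpNorm_congr_ae ?_
        filter_upwards [hΞ ω hω, Lp.coeFn_sub (Ξ ω) d] with s h1 h2
        rw [h2, Pi.sub_apply, h1]
      · simp only [Ξ, dif_neg hω]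
    rw [e]
    exact Measurable.ite hset
      (((hmeasI d (Lp.stronglyMeasurable d)).pow_const _).ennreal_toReal) measurable_const
  have : Fact ((2 : ℝ≥0∞) ≠ ∞) := ⟨by simp⟩
  have hsm : StronglyMeasurable Ξ := by
    borelize ↥(Lp X 2 μ)
    exact (measurable_of_measurable_dist hΞm).stronglyMeasurable
  have hae : ∀ᵐ ω ∂P, MemLp (fun s => ξ s ω) 2 μ := by
    filter_upwards [ae_lt_top hmeas0 hI.ne] with ω hω
    exact (hiff ω).2 hω
  refine ⟨Ξ, ⟨hsm.aestronglyMeasurable, ?_⟩, hae.mono hΞ⟩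
  rw [lintegral_eq_eLpNorm_rpow, ENNReal.rpow_lt_top_iff_of_pos (by norm_num)]
  refine lt_of_eq_of_lt (lintegral_congr_ae ?_) hI
  filter_upwards [hae] with ω hω
  rw [Lp.enorm_def, ← eLpNorm_congr_ae (hΞ ω hω), eLpNorm_two_sq]

variable {hrb : -r ≤ b} {f : ℝ → C(Icc (-r) 0, X) → X} {Cf : ℝ}

/-- The delay term along the paths of a mean square continuous process, as a square integrable
random element of `L²`. -/
lemma DelayHyp.exists_isDelayTerm_path [NormedSpace ℝ X] [CompleteSpace X]
    [TopologicalSpace.SeparableSpace X] [IsFiniteMeasure P] (hb : 0 ≤ b)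
    (hf : DelayHyp hrb f Cf) (x : C(Icc (-r) b, Lp X 2 P)) :
    ∃ (ξ : ℝ → Ω → X) (G : Lp (Lp X 2 (volume.restrict (Icc (0 : ℝ) b))) 2 P),
      IsModification ξ x ∧ ∀ᵐ ω ∂P, IsDelayTerm hrb f (fun s => ξ s ω) (G ω) := by
  obtain ⟨ξ, hξ⟩ := exists_isModification hrb x
  obtain ⟨Ξ, hΞ, hΞξ⟩ := hξ.exists_path hrb
  -- `F` is the extension of the delay map to L². Its Lipschitz continuity gives measurability and
  -- square integrability of the composition with the random path.
  choose F hF using fun u : Lp X 2 (volume.restrict (Icc (-r) b)) =>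
    hf.exists_isDelayTerm hb (Lp.memLp u)
  set L : ℝ≥0 := (ENNReal.ofReal Cf ^ (1 / 2 : ℝ)).toNNReal
  have hL : (L : ℝ≥0∞) = ENNReal.ofReal Cf ^ (1 / 2 : ℝ) :=
    ENNReal.coe_toNNReal (ENNReal.rpow_ne_top_of_nonneg (by norm_num) (by simp))
  have hlip : LipschitzWith L F := by
    intro u v
    rw [edist_eq_enorm_sub, edist_eq_enorm_sub, Lp.enorm_def, Lp.enorm_def,
      eLpNorm_congr_ae (Lp.coeFn_sub _ _), eLpNorm_congr_ae (Lp.coeFn_sub _ _), hL]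
    exact (hF u).eLpNorm_diff_le hf (hF v) ⟨hb, le_rfl⟩
  have hG : MemLp (fun ω => F (Ξ ω)) 2 P := by
    have h1 : MemLp (fun ω => F (Ξ ω) - F 0) 2 P := by
      refine MemLp.of_le_mul (c := L) hΞ
        ((hlip.continuous.comp_aestronglyMeasurable hΞ.1).sub aestronglyMeasurable_const)
        (Eventually.of_forall fun ω => ?_)
      simpa [dist_eq_norm] using hlip.dist_le_mul (Ξ ω) 0
    convert h1.add (memLp_const (F 0)) using 1
    ext1 ω
    simp
  refine ⟨ξ, hG.toLp, hξ, ?_⟩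
  filter_upwards [hΞξ, hG.coeFn_toLp] with ω h1 h2
  rw [h2]
  exact (hF (Ξ ω)).congr_left h1.symm

/-- The delay terms of two processes differ in mean square by at most the integrated distance. -/
lemma IsModification.lintegral_delay_sub_le [SFinite P] (hf : DelayHyp hrb f Cf)
    {ξ ξ' : ℝ → Ω → X} {x x' : C(Icc (-r) b, Lp X 2 P)} (h : IsModification ξ x)
    (h' : IsModification ξ' x') {g g' : Ω → ℝ → X}
    (hg : ∀ᵐ ω ∂P, IsDelayTerm hrb f (fun s => ξ s ω) (g ω))
    (hg' : ∀ᵐ ω ∂P, IsDelayTerm hrb f (fun s => ξ' s ω) (g' ω)) {t : ℝ} (ht : t ∈ Icc 0 b) :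
    ∫⁻ ω, eLpNorm (fun s => g ω s - g' ω s) 2 (volume.restrict (Icc 0 t)) ^ 2 ∂P ≤
      ENNReal.ofReal Cf * ∫⁻ s in Icc (-r) t,
        ‖x (projIcc (-r) b hrb s) - x' (projIcc (-r) b hrb s)‖ₑ ^ 2 := by
  rw [← h.lintegral_lintegral_sub h' ht.2, ← lintegral_const_mul' _ _ (by simp)]
  refine lintegral_mono_ae ?_
  filter_upwards [hg, hg'] with ω h1 h2
  refine (pow_le_pow_left₀ zero_le (h1.eLpNorm_diff_le hf h2 ht) 2).trans (le_of_eq ?_)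
  rw [mul_pow, eLpNorm_two_sq, ← ENNReal.rpow_natCast, ← ENNReal.rpow_mul]
  norm_num

/-- The delay term does not depend on the modification. -/
lemma IsModification.delay_ae_eq [SFinite P] (hb : 0 ≤ b) (hf : DelayHyp hrb f Cf)
    {ξ ξ' : ℝ → Ω → X} {x : C(Icc (-r) b, Lp X 2 P)} (h : IsModification ξ x)
    (h' : IsModification ξ' x) {g g' : Ω → ℝ → X}
    (hg : ∀ᵐ ω ∂P, IsDelayTerm hrb f (fun s => ξ s ω) (g ω))
    (hg' : ∀ᵐ ω ∂P, IsDelayTerm hrb f (fun s => ξ' s ω) (g' ω)) :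
    ∀ᵐ ω ∂P, g ω =ᵐ[volume.restrict (Icc 0 b)] g' ω := by
  have h1 := h.lintegral_lintegral_sub (hrb := hrb) h' le_rfl
  simp only [sub_self, enorm_zero, ne_eq, OfNat.ofNat_ne_zero, not_false_eq_true, zero_pow,
    lintegral_zero] at h1
  have hm : Measurable fun ω => ∫⁻ s in Icc (-r) b, ‖ξ s ω - ξ' s ω‖ₑ ^ 2 :=
    Measurable.lintegral_prod_left ((h.meas.sub h'.meas).enorm.pow_const 2)
  rw [lintegral_eq_zero_iff hm] at h1
  filter_upwards [h1, hg, hg'] with ω h2 h3 h4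
  have h5 := h3.eLpNorm_diff_le hf h4 ⟨hb, le_rfl⟩
  rw [lintegral_eq_eLpNorm_rpow (fun s => ξ s ω - ξ' s ω), h2, Pi.zero_apply,
    ENNReal.zero_rpow_of_pos (by norm_num), mul_zero, nonpos_iff_eq_zero] at h5
  filter_upwards [(eLpNorm_eq_zero_iff (h3.2.1.1.sub h4.2.1.1) (by simp)).1 h5] with s hs
  exact sub_eq_zero.1 hs

end Modification

/-! ### Fixed points of Volterra type maps -/

section Volterra

lemma lintegral_Icc_pow_div_factorial {r t : ℝ} (hrt : -r ≤ t) {C : ℝ} (hC : 0 ≤ C) (n : ℕ) :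
    ENNReal.ofReal C * ∫⁻ s in Icc (-r) t, ENNReal.ofReal ((C * (s + r)) ^ n / n.factorial) =
      ENNReal.ofReal ((C * (t + r)) ^ (n + 1) / (n + 1).factorial) := by
  have hcont : Continuous fun s : ℝ => (C * (s + r)) ^ n / (n.factorial : ℝ) := by fun_prop
  rw [← ofReal_integral_eq_lintegral_ofReal
    (hcont.continuousOn.integrableOn_compact isCompact_Icc), ← ENNReal.ofReal_mul hC,
    integral_Icc_eq_integral_Ioc, ← intervalIntegral.integral_of_le hrt]
  · congr 1
    simp only [mul_pow, div_eq_mul_inv, mul_assoc]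
    rw [intervalIntegral.integral_const_mul, intervalIntegral.integral_mul_const,
      intervalIntegral.integral_comp_add_right (fun s => s ^ n), integral_pow, Nat.factorial_succ]
    have : (n.factorial : ℝ) ≠ 0 := by positivity
    push_cast
    field_simp
    ring
  · filter_upwards [ae_restrict_mem measurableSet_Icc] with s hs
    have : 0 ≤ s + r := by linarith [hs.1]
    positivity

/-- A map on `C([-r,b]; E)` that is Lipschitz in the integrated sense of a Volterra equation has
exactly one fixed point. -/
lemma existsUnique_fixedPoint_of_volterra {E : Type*} [NormedAddCommGroup E] [CompleteSpace E]
    {r b : ℝ} (hrb : -r ≤ b) {C : ℝ} (hC : 0 ≤ C) (Ψ : C(Icc (-r) b, E) → C(Icc (-r) b, E))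
    (hΨ : ∀ x y (t : Icc (-r) b), ‖Ψ x t - Ψ y t‖ₑ ^ 2 ≤ ENNReal.ofReal C *
      ∫⁻ s in Icc (-r) (t : ℝ), ‖x (projIcc (-r) b hrb s) - y (projIcc (-r) b hrb s)‖ₑ ^ 2) :
    ∃! x, Ψ x = x := by
  -- Each application integrates the previous bound once more, producing the terms of the
  -- exponential series.
  have key : ∀ (n : ℕ) x y (t : Icc (-r) b), ‖Ψ^[n] x t - Ψ^[n] y t‖ₑ ^ 2 ≤
      ENNReal.ofReal ((C * (t + r)) ^ n / n.factorial) * ‖x - y‖ₑ ^ 2 := by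
    intro n x y
    induction n with
    | zero =>
      intro t
      simp only [Function.iterate_zero, id_eq, pow_zero, Nat.factorial_zero, Nat.cast_one,
        div_one, ENNReal.ofReal_one, one_mul]
      gcongr
      simp only [← ofReal_norm]
      exact ENNReal.ofReal_le_ofReal ((x - y).norm_coe_le_norm t)
    | succ n ih =>
      intro t
      rw [Function.iterate_succ_apply', Function.iterate_succ_apply',
        ← lintegral_Icc_pow_div_factorial t.2.1 hC, mul_assoc,
        ← lintegral_mul_const' _ _ (by finiteness)]
      refine (hΨ _ _ t).trans ?_
      gcongr 1
      refine setLIntegral_mono' measurableSet_Icc fun s hs => ?_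
      have hs' : s ∈ Icc (-r) b := ⟨hs.1, hs.2.trans t.2.2⟩
      rw [projIcc_of_mem hrb hs']
      exact ih ⟨s, hs'⟩
  -- The estimate concerns squared norms, so 1/4 yields the contraction constant 1/2.
  obtain ⟨n, hn⟩ := ((FloorSemiring.tendsto_pow_div_factorial_atTop (C * (b + r))).eventually
    (gt_mem_nhds (show (0 : ℝ) < 1 / 4 by norm_num))).exists
  have hcon : ContractingWith (1 / 2) Ψ^[n] := by
    refine ⟨by rw [← NNReal.coe_lt_coe]; norm_num, LipschitzWith.of_dist_le_mul fun x y => ?_⟩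
    have : Nonempty (Icc (-r) b) := ⟨⟨b, hrb, le_rfl⟩⟩
    rw [ContinuousMap.dist_le_iff_of_nonempty]
    intro t
    have h1 := key n x y t
    simp only [← ofReal_norm] at h1
    have h0 : 0 ≤ C * (t + r) := mul_nonneg hC (by linarith [t.2.1])
    rw [← ENNReal.ofReal_pow (norm_nonneg _), ← ENNReal.ofReal_pow (norm_nonneg _),
      ← ENNReal.ofReal_mul (by positivity), ENNReal.ofReal_le_ofReal_iff (by positivity)] at h1
    have h2 : (C * (t + r)) ^ n / n.factorial ≤ 1 / 4 := by
      refine le_trans ?_ hn.le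
      gcongr
      exact t.2.2
    rw [dist_eq_norm, dist_eq_norm]
    refine le_of_sq_le_sq ?_ (by positivity)
    rw [mul_pow]
    refine (h1.trans (mul_le_mul_of_nonneg_right h2 (sq_nonneg _))).trans (le_of_eq ?_)
    norm_num
  -- The unique fixed point of the iterate is fixed by `Ψ` itself, and any fixed point of `Ψ` is
  -- fixed by the iterate.
  refine ⟨ContractingWith.fixedPoint _ hcon, hcon.isFixedPt_fixedPoint_iterate, fun y hy => ?_⟩
  exact hcon.fixedPoint_unique (Function.IsFixedPt.iterate hy n)

end Volterra

/-! ### The terms of the mild solution formula -/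

section Terms

variable {X Y Ω ι : Type*} [NormedAddCommGroup X] [InnerProductSpace ℝ X]
  [NormedAddCommGroup Y] [InnerProductSpace ℝ Y] [MeasurableSpace Ω] {P : Measure Ω}
  {α b H : ℝ} {T : ℝ → X →L[ℝ] X}

/-- The point s = t is left out: there `singKernel` is 0, whereas 0^(α-1) = 1 when α = 1. -/
lemma convFun_singKernel_ae_eq {S : ℝ → X →L[ℝ] X}
    (hS : ∀ t ∈ Icc 0 b, ∀ η, S t η = opS T α t η) (v : ℝ → X) {t : ℝ} (ht : t ≤ b) :
    ∀ᵐ s ∂volume.restrict (Icc 0 t), convFun S (singKernel α b) v t s =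
      (t - s) ^ (α - 1) • opS T α (t - s) (v s) ∧ t - s ∈ Icc 0 b := by
  filter_upwards [ae_restrict_mem measurableSet_Icc, (Measure.ae_ne (volume.restrict (Icc 0 t)) t)]
    with s hs hst
  have h1 : t - s ∈ Ioc 0 b :=
    ⟨sub_pos.2 (lt_of_le_of_ne hs.2 hst), by linarith [hs.1]⟩
  have h2 : t - s ∈ Icc 0 b := ⟨h1.1.le, h1.2⟩
  exact ⟨by rw [convFun, singKernel, indicator_of_mem h1, hS _ h2], h2⟩

/-- A mild solution only asserts that some stochastic integral exists; uniqueness identifies it with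
the constructed one. -/
lemma IsStochIntegral.unique [CompleteSpace X] [IsProbabilityMeasure P] (hH : 1 / 2 < H)
    (hH1 : H < 1) {e : HilbertBasis ι ℝ Y} {lam : ι → ℝ} {β : ι → ℝ≥0 → Ω → ℝ}
    (hβ : ∀ n, IsFBM H (β n) P) {t : ℝ} {Φ : ℝ → Y → X} {I I' : Lp X 2 P}
    (hI : IsStochIntegral H e lam β t Φ I) (hI' : IsStochIntegral H e lam β t Φ I') : I = I' := by
  obtain ⟨J, hJ, hs⟩ := hI
  obtain ⟨J', hJ', hs'⟩ := hI'
  have : J = J' := funext fun n => (hβ n).isWienerIntegral_unique hH hH1 (hJ n) (hJ' n)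
  exact hs.unique (this ▸ hs')

lemma qHSNorm_rpow (e : HilbertBasis ι ℝ Y) (lam : ι → ℝ) (A : Y →L[ℝ] X) (p : ℝ) :
    qHSNorm e lam A ^ (2 * p) = (∑' n, ‖Real.sqrt (lam n) • A (e n)‖ₑ ^ 2) ^ p := by
  rw [qHSNorm, ← ENNReal.rpow_mul]
  congr 1
  ring

/-- The stochastic convolution is mean square continuous. -/
lemma exists_continuous_isStochIntegral [CompleteSpace X] [IsProbabilityMeasure P] [Countable ι]
    (hH : 1 / 2 < H) {e : HilbertBasis ι ℝ Y} {lam : ι → ℝ} {β : ι → ℝ≥0 → Ω → ℝ}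
    (hβ : ∀ n, IsFBM H (β n) P) (hind : iIndepFun (fun n ω (t : ℝ≥0) => β n t ω) P)
    (hb : 0 ≤ b) (hα : 1 / 2 < α) (hα1 : α ≤ 1) {p : ℝ} (hp : 1 / (2 * α - 1) < p)
    {S : ℝ → X →L[ℝ] X} (hS : ∀ t ∈ Icc 0 b, ∀ η, S t η = opS T α t η)
    (hSc : ∀ η, Continuous fun t => S t η) {C : ℝ≥0} (hC : ∀ t, ‖S t‖ ≤ C) {h : ℝ → Y →L[ℝ] X}
    (hmeas : ∀ y : Y, AEStronglyMeasurable (fun s => h s y) (volume.restrict (Icc 0 b)))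
    (hint : ∫⁻ s in Icc 0 b, qHSNorm e lam (h s) ^ (2 * p) < ∞) :
    ∃ I : Icc 0 b → Lp X 2 P, Continuous I ∧ I ⟨0, le_rfl, hb⟩ = 0 ∧
      ∀ t : Icc 0 b, IsStochIntegral H e lam β t
        (fun s y => (t - s) ^ (α - 1) • opS T α (t - s) (h s y)) (I t) := by
  simp_rw [qHSNorm_rpow] at hint
  obtain ⟨J, I, hI, hI0, hJ⟩ := exists_stochConv hH hβ hind hb hα hα1 hp hSc hC
    (v := fun n s => Real.sqrt (lam n) • h s (e n)) (fun n => (hmeas (e n)).const_smul _) hint.ne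
  refine ⟨I, hI, hI0, fun t => ⟨J t, fun n => ?_, (hJ t).1⟩⟩
  refine (((hJ t).2 n).congr ?_).isWienerIntegral hH t.2.1
  filter_upwards [convFun_singKernel_ae_eq hS (fun s => Real.sqrt (lam n) • h s (e n)) t.2.2]
    with s hs
  rw [hs.1, ← hS _ hs.2, ← hS _ hs.2, map_smul, smul_comm]

/-- The deterministic convolution as a strongly continuous family of operators on `L²`. -/
lemma exists_drift_family_opS [CompleteSpace X] (hb : 0 ≤ b) (hα : 1 / 2 < α)
    {S : ℝ → X →L[ℝ] X} (hS : ∀ t ∈ Icc 0 b, ∀ η, S t η = opS T α t η)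
    (hSc : ∀ η, Continuous fun t => S t η) {C : ℝ≥0} (hC : ∀ t, ‖S t‖ ≤ C) :
    ∃ (K : ℝ → Lp X 2 (volume.restrict (Icc (0 : ℝ) b)) →L[ℝ] X) (D : ℝ≥0),
      (∀ t ∈ Icc 0 b, ∀ (g : Lp X 2 (volume.restrict (Icc (0 : ℝ) b))) (g' : ℝ → X),
        g' =ᵐ[volume.restrict (Icc 0 b)] g →
        ∫ s in (0 : ℝ)..t, (t - s) ^ (α - 1) • opS T α (t - s) (g' s) = K t g) ∧
      (∀ g, Continuous fun t => K t g) ∧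
      (∀ t ≤ b, ∀ g, ‖K t g‖ₑ ≤ D * eLpNorm g 2 (volume.restrict (Icc 0 t))) ∧
      ∀ t, ‖K t‖ ≤ D := by
  have hk0 : ∀ x ≤ 0, singKernel α b x = 0 := fun x hx =>
    indicator_of_notMem (fun h => not_lt.2 hx h.1) _
  obtain ⟨K, D, hK, hKc, hKD, hKn⟩ := exists_drift_family hSc hC (measurable_singKernel α b)
    (memLp_singKernel hb (q := 2) (by simp) (by simp) (by simp; linarith)) hk0 b
  refine ⟨K, D, fun t ht g g' hg => ?_, hKc, hKD, hKn⟩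
  have hsub : Icc 0 t ⊆ Icc 0 b := Icc_subset_Icc_right ht.2
  rw [hK, intervalIntegral.integral_of_le ht.1, ← integral_Icc_eq_integral_Ioc,
    setIntegral_eq_of_subset_of_forall_sdiff_eq_zero measurableSet_Icc hsub]
  · refine integral_congr_ae ?_
    filter_upwards [convFun_singKernel_ae_eq hS g ht.2,
      ae_mono (Measure.restrict_mono hsub le_rfl) hg] with s hs hgs
    rw [hs.1, hgs]
  · intro s hs
    have : t - s ≤ 0 := by
      by_contra! h
      exact hs.2 ⟨hs.1.1, by linarith⟩
    simp [convFun, hk0 _ this]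

end Terms
/-! ### The fixed point formulation -/

section Mild

variable {X Y Ω ι : Type*} [NormedAddCommGroup X] [InnerProductSpace ℝ X]
  [NormedAddCommGroup Y] [InnerProductSpace ℝ Y] [MeasurableSpace Ω] {P : Measure Ω}
  {r b α H : ℝ} {T : ℝ → X →L[ℝ] X}

/-- If the three terms of the mild solution formula are given by mean square continuous processes,
a process is a mild solution exactly when it solves the corresponding fixed point equation. -/
lemma isMildSolution_iff [SFinite P] (hr : 0 < r) (hb : 0 < b) {hrb : -r ≤ b}
    {f : ℝ → C(Icc (-r) 0, X) → X} {Cf : ℝ} (hf : DelayHyp hrb f Cf) {h : ℝ → Y →L[ℝ] X}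
    {e : HilbertBasis ι ℝ Y} {lam : ι → ℝ} {β : ι → ℝ≥0 → Ω → ℝ}
    {φ : C(Icc (-r) 0, Lp X 2 P)} {S : ℝ → X →L[ℝ] X}
    (hS : ∀ t ∈ Icc 0 b, ∀ η, S t η = opT T α t η)
    {K : ℝ → Lp X 2 (volume.restrict (Icc (0 : ℝ) b)) →L[ℝ] X}
    (hK : ∀ t ∈ Icc 0 b, ∀ (g : Lp X 2 (volume.restrict (Icc (0 : ℝ) b))) (g' : ℝ → X),
      g' =ᵐ[volume.restrict (Icc 0 b)] g →
      ∫ s in (0 : ℝ)..t, (t - s) ^ (α - 1) • opS T α (t - s) (g' s) = K t g)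
    {I : Icc 0 b → Lp X 2 P}
    (hI : ∀ t : Icc 0 b, IsStochIntegral H e lam β t
      (fun s y => (t - s) ^ (α - 1) • opS T α (t - s) (h s y)) (I t))
    (hIu : ∀ (t : Icc 0 b) I', IsStochIntegral H e lam β t
      (fun s y => (t - s) ^ (α - 1) • opS T α (t - s) (h s y)) I' → I' = I t)
    {x : C(Icc (-r) b, Lp X 2 P)} {ξ : ℝ → Ω → X} (hξ : IsModification ξ x)
    {G : Lp (Lp X 2 (volume.restrict (Icc (0 : ℝ) b))) 2 P}
    (hG : ∀ᵐ ω ∂P, IsDelayTerm hrb f (fun s => ξ s ω) (G ω)) :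
    IsMildSolution hr hb α H T f h e lam β φ x ↔
      (∀ (t : ℝ) (ht : t ∈ Icc (-r) 0), x ⟨t, ht.1, ht.2.trans hb.le⟩ = φ ⟨t, ht⟩) ∧
      ∀ (t : ℝ) (ht : t ∈ Icc 0 b), x ⟨t, by linarith [ht.1], ht.2⟩ =
        (S t).compLp (φ ⟨0, by linarith, le_rfl⟩) + (K t).compLp G + I ⟨t, ht⟩ := by
  refine and_congr_right fun _ => ⟨?_, fun hx => ?_⟩
  · rintro ⟨ξ', g, hξ', hξx, hg, hsol⟩ t ht
    obtain ⟨I', hI', hx⟩ := hsol t ht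
    obtain rfl := hIu ⟨t, ht⟩ I' hI'
    refine Lp.ext ?_
    -- The modification and delay term of the given solution are arbitrary, but its delay term
    -- agrees almost surely with `G`, so the drift integrals coincide.
    filter_upwards [hx, IsModification.delay_ae_eq hb.le hf ⟨hξ', hξx⟩ hξ hg hG,
      Lp.coeFn_add ((S t).compLp (φ ⟨0, by linarith, le_rfl⟩) + (K t).compLp G) (I ⟨t, ht⟩),
      Lp.coeFn_add ((S t).compLp (φ ⟨0, by linarith, le_rfl⟩)) ((K t).compLp G),
      (S t).coeFn_compLp (φ ⟨0, by linarith, le_rfl⟩), (K t).coeFn_compLp G]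
      with ω h1 h2 h3 h4 h5 h6
    rw [h1, h3, Pi.add_apply, h4, Pi.add_apply, h5, h6, hS t ht, hK t ht _ _ h2]
  · refine ⟨ξ, fun ω => G ω, hξ.meas, hξ.ae_eq, hG, fun t ht => ⟨I ⟨t, ht⟩, hI ⟨t, ht⟩, ?_⟩⟩
    rw [hx t ht]
    filter_upwards [
      Lp.coeFn_add ((S t).compLp (φ ⟨0, by linarith, le_rfl⟩) + (K t).compLp G) (I ⟨t, ht⟩),
      Lp.coeFn_add ((S t).compLp (φ ⟨0, by linarith, le_rfl⟩)) ((K t).compLp G),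
      (S t).coeFn_compLp (φ ⟨0, by linarith, le_rfl⟩), (K t).coeFn_compLp G]
      with ω h3 h4 h5 h6
    rw [h3, Pi.add_apply, h4, Pi.add_apply, h5, h6, hS t ht, hK t ht _ _ (ae_eq_refl _)]

/-- Existence and uniqueness of the solution of the fixed point equation. -/
lemma existsUnique_solution [CompleteSpace X] [SFinite P]
    (hr : 0 < r) (hb : 0 < b) {hrb : -r ≤ b} {f : ℝ → C(Icc (-r) 0, X) → X} {Cf : ℝ}
    (hf : DelayHyp hrb f Cf) {φ : C(Icc (-r) 0, Lp X 2 P)} {S : ℝ → X →L[ℝ] X}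
    (hS0 : ∀ η, S 0 η = η) (hSc : ∀ η, Continuous fun t => S t η) {C : ℝ≥0}
    (hC : ∀ t, ‖S t‖ ≤ C)
    {K : ℝ → Lp X 2 (volume.restrict (Icc (0 : ℝ) b)) →L[ℝ] X} {D : ℝ≥0}
    (hKc : ∀ g, Continuous fun t => K t g)
    (hKD : ∀ t ≤ b, ∀ g, ‖K t g‖ₑ ≤ D * eLpNorm g 2 (volume.restrict (Icc 0 t)))
    (hKn : ∀ t, ‖K t‖ ≤ D) {I : Icc 0 b → Lp X 2 P} (hI : Continuous I)
    (hI0 : I ⟨0, le_rfl, hb.le⟩ = 0) {ξ : C(Icc (-r) b, Lp X 2 P) → ℝ → Ω → X}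
    (hξ : ∀ x, IsModification (ξ x) x)
    {G : C(Icc (-r) b, Lp X 2 P) → Lp (Lp X 2 (volume.restrict (Icc (0 : ℝ) b))) 2 P}
    (hG : ∀ x, ∀ᵐ ω ∂P, IsDelayTerm hrb f (fun s => ξ x s ω) (G x ω)) :
    ∃! x : C(Icc (-r) b, Lp X 2 P),
      (∀ (t : ℝ) (ht : t ∈ Icc (-r) 0), x ⟨t, ht.1, ht.2.trans hb.le⟩ = φ ⟨t, ht⟩) ∧
      ∀ (t : ℝ) (ht : t ∈ Icc 0 b), x ⟨t, by linarith [ht.1], ht.2⟩ =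
        (S t).compLp (φ ⟨0, by linarith, le_rfl⟩) + (K t).compLp (G x) + I ⟨t, ht⟩ := by
  have hr0 : -r ≤ 0 := by linarith
  set φ0 := φ ⟨0, by linarith, le_rfl⟩ with hφ0
  have hS0' : (S 0).compLp φ0 = φ0 := by
    refine Lp.ext ?_
    filter_upwards [(S 0).coeFn_compLp φ0] with ω hω
    rw [hω, hS0]
  have hK0 : ∀ G : Lp (Lp X 2 (volume.restrict (Icc (0 : ℝ) b))) 2 P, (K 0).compLp G = 0 := by
    intro G
    refine Lp.ext ?_
    filter_upwards [(K 0).coeFn_compLp G, Lp.coeFn_zero X 2 P] with ω h1 h2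
    have := hKD 0 hb.le (G ω)
    rw [h1, h2, Pi.zero_apply, ← enorm_eq_zero]
    simpa using this
  -- One formula covers both intervals and is visibly continuous: on [-r,0] the bracket is frozen at
  -- its value `φ0` at time 0, and on [0,b] the difference in front vanishes.
  let Ψ : C(Icc (-r) b, Lp X 2 P) → C(Icc (-r) b, Lp X 2 P) := fun x =>
    ⟨fun t => φ (projIcc (-r) 0 hr0 t) - φ0 + ((S (max t 0)).compLp φ0 +
      (K (max t 0)).compLp (G x) + I (projIcc 0 b hb.le t)), by
        have h1 := continuous_compLp hSc hC φ0
        have h2 := continuous_compLp hKc hKn (G x)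
        have h3 : Continuous fun t : Icc (-r) b => max (t : ℝ) 0 := by fun_prop
        have h4 : Continuous fun t : Icc (-r) b => projIcc (-r) 0 hr0 (t : ℝ) := by fun_prop
        have h5 : Continuous fun t : Icc (-r) b => projIcc 0 b hb.le (t : ℝ) := by fun_prop
        exact ((φ.continuous.comp h4).sub continuous_const).add
          (((h1.comp h3).add (h2.comp h3)).add (hI.comp h5))⟩
  have hΨneg : ∀ x (t : ℝ) (ht : t ∈ Icc (-r) 0),
      Ψ x ⟨t, ht.1, ht.2.trans hb.le⟩ = φ ⟨t, ht⟩ := by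
    intro x t ht
    change φ (projIcc (-r) 0 hr0 t) - φ0 + ((S (max t 0)).compLp φ0 +
      (K (max t 0)).compLp (G x) + I (projIcc 0 b hb.le t)) = _
    rw [max_eq_right ht.2, hS0', hK0, projIcc_of_le_left hb.le ht.2, hI0, projIcc_of_mem hr0 ht]
    abel
  have hΨpos : ∀ x (t : ℝ) (ht : t ∈ Icc 0 b), Ψ x ⟨t, by linarith [ht.1], ht.2⟩ =
      (S t).compLp φ0 + (K t).compLp (G x) + I ⟨t, ht⟩ := by
    intro x t ht
    change φ (projIcc (-r) 0 hr0 t) - φ0 + ((S (max t 0)).compLp φ0 +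
      (K (max t 0)).compLp (G x) + I (projIcc 0 b hb.le t)) = _
    rw [max_eq_left ht.1, projIcc_of_mem hb.le ht, projIcc_of_right_le hr0 ht.1, hφ0, sub_self,
      zero_add]
  have hfix : ∀ x, Ψ x = x ↔
      (∀ (t : ℝ) (ht : t ∈ Icc (-r) 0), x ⟨t, ht.1, ht.2.trans hb.le⟩ = φ ⟨t, ht⟩) ∧
      ∀ (t : ℝ) (ht : t ∈ Icc 0 b), x ⟨t, by linarith [ht.1], ht.2⟩ =
        (S t).compLp φ0 + (K t).compLp (G x) + I ⟨t, ht⟩ := by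
    refine fun x => ⟨fun h => ⟨fun t ht => ?_, fun t ht => ?_⟩, fun h => ?_⟩
    · rw [← hΨneg x t ht, h]
    · rw [← hΨpos x t ht, h]
    · ext1 ⟨t, ht⟩
      rcases le_total t 0 with h0 | h0
      · rw [hΨneg x t ⟨ht.1, h0⟩, h.1 t ⟨ht.1, h0⟩]
      · rw [hΨpos x t ⟨h0, ht.2⟩, h.2 t ⟨h0, ht.2⟩]
  -- The factor D² comes from the drift operators and the rest from the Lipschitz constant,
  -- truncated at 0 because `DelayHyp` fixes no sign for it.
  have hvol := existsUnique_fixedPoint_of_volterra hrb (C := D ^ 2 * max Cf 0) (by positivity) Ψ ?_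
  · simpa only [hfix] using hvol
  rintro x y ⟨t, ht⟩
  rcases le_total t 0 with h0 | h0
  · rw [hΨneg x t ⟨ht.1, h0⟩, hΨneg y t ⟨ht.1, h0⟩]
    simp
  have ht0 : t ∈ Icc 0 b := ⟨h0, ht.2⟩
  -- The initial and noise terms cancel; only the difference of the drift terms is left.
  rw [hΨpos x t ht0, hΨpos y t ht0, add_sub_add_right_eq_sub, add_sub_add_left_eq_sub,
    ENNReal.ofReal_mul (by positivity), mul_assoc, Lp.enorm_def, eLpNorm_two_sq]
  have hmax : ENNReal.ofReal (max Cf 0) = ENNReal.ofReal Cf := by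
    simp [ENNReal.ofReal_max]
  rw [hmax]
  refine le_trans ?_ (mul_le_mul_right (IsModification.lintegral_delay_sub_le hf (hξ x) (hξ y)
    (hG x) (hG y) ht0) _)
  rw [← lintegral_const_mul' _ _ (by simp)]
  refine lintegral_mono_ae ?_
  filter_upwards [Lp.coeFn_sub ((K t).compLp (G x)) ((K t).compLp (G y)),
    (K t).coeFn_compLp (G x), (K t).coeFn_compLp (G y)] with ω h1 h2 h3
  rw [h1, Pi.sub_apply, h2, h3, ← map_sub]
  refine (pow_le_pow_left₀ zero_le (hKD t ht.2 _) 2).trans (le_of_eq ?_)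
  rw [mul_pow, ENNReal.ofReal_pow D.coe_nonneg, ENNReal.ofReal_coe_nnreal]
  congr 2
  refine eLpNorm_congr_ae ?_
  exact ae_mono (Measure.restrict_mono (Icc_subset_Icc_right ht.2) le_rfl)
    (Lp.coeFn_sub (G x ω) (G y ω))

end Mild
end FracDelay

end

/-! ### Existence and uniqueness of the mild solution -/

theorem theorem3p3
    {X Y Ω ι : Type*}
    [NormedAddCommGroup X] [InnerProductSpace ℝ X] [CompleteSpace X]
    [TopologicalSpace.SeparableSpace X]
    [NormedAddCommGroup Y] [InnerProductSpace ℝ Y] [CompleteSpace Y]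
    [TopologicalSpace.SeparableSpace Y]
    [Countable ι]
    [MeasurableSpace Ω] (P : Measure Ω) [IsProbabilityMeasure P]
    {r b α H : ℝ} (hr : 0 < r) (hb : 0 < b)
    (hα : α ∈ Ioc (1 / 2 : ℝ) 1) (hH : H ∈ Ioo (1 / 2 : ℝ) 1)
    -- the `Q`-fractional Brownian motion
    (Q : Y →L[ℝ] Y) (e : HilbertBasis ι ℝ Y) (lam : ι → ℝ)
    (β : ι → ℝ≥0 → Ω → ℝ) (B : ℝ≥0 → Ω → Y)
    (hB : FracDelay.IsQFBM H Q e lam β B P)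
    -- the generator and its semigroup
    (A : X →ₗ.[ℝ] X) (T : ℝ → X →L[ℝ] X)
    (hT : FracDelay.IsC0Semigroup T) (hA : FracDelay.IsGenerator A T)
    (M ω : ℝ) (hM : 1 ≤ M) (hω : 0 ≤ ω)
    (hbound : ∀ t : ℝ, 0 ≤ t → ‖T t‖ ≤ M * Real.exp (ω * t))
    -- the delay nonlinearity: measurability (also of the integrand in the Lipschitz condition),
    -- integrated Lipschitz condition, square integrability at zero
    (f : ℝ → C(Icc (-r) 0, X) → X)
    (hf1 : ∀ ζ : C(Icc (-r) 0, X),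
      AEStronglyMeasurable (fun s => f s ζ) (volume.restrict (Icc 0 b)))
    (hf1' : ∀ x : C(Icc (-r) b, X),
      AEStronglyMeasurable (fun s => f s (FracDelay.segment (by linarith) x s))
        (volume.restrict (Icc 0 b)))
    (Cf : ℝ) (hCf : 0 < Cf)
    (hf2 : ∀ x y : C(Icc (-r) b, X), ∀ t ∈ Icc 0 b,
      ∫⁻ s in Icc 0 t, ‖f s (FracDelay.segment (by linarith) x s)
          - f s (FracDelay.segment (by linarith) y s)‖ₑ ^ 2
        ≤ ENNReal.ofReal Cf * ∫⁻ s in Icc (-r) t,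
          ‖x (projIcc (-r) b (by linarith) s) - y (projIcc (-r) b (by linarith) s)‖ₑ ^ 2)
    (hf3 : ∫⁻ s in Icc 0 b, ‖f s 0‖ₑ ^ 2 < ∞)
    -- the noise coefficient
    (h : ℝ → Y →L[ℝ] X) (p : ℝ) (hp : 1 / (2 * α - 1) < p)
    (hmeas : ∀ y : Y, AEStronglyMeasurable (fun s => h s y) (volume.restrict (Icc 0 b)))
    (hint : ∫⁻ s in Icc 0 b, FracDelay.qHSNorm e lam (h s) ^ (2 * p) < ∞)
    (φ : C(Icc (-r) 0, Lp X 2 P)) :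
    ∃! x : C(Icc (-r) b, Lp X 2 P),
      FracDelay.IsMildSolution hr hb α H T f h e lam β φ x := by
  have hrb : -r ≤ b := by linarith
  have hf : FracDelay.DelayHyp hrb f Cf := ⟨hf1', hf2, hf3⟩
  have hα0 : 0 < α := by linarith [hα.1]
  obtain ⟨S₁, hS₁, hS₁c, C₁, hC₁, hS₁n⟩ :=
    FracDelay.exists_opT_family hT hM hω hbound hα0 hα.2 hb.le
  obtain ⟨S₂, hS₂, hS₂c, C₂, hC₂, hS₂n⟩ :=
    FracDelay.exists_opS_family hT hM hω hbound hα0 hα.2 hb.le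
  lift C₁ to ℝ≥0 using hC₁
  lift C₂ to ℝ≥0 using hC₂
  obtain ⟨K, D, hK, hKc, hKD, hKn⟩ :=
    FracDelay.exists_drift_family_opS hb.le hα.1 hS₂ hS₂c hS₂n
  obtain ⟨I, hIc, hI0, hI⟩ := FracDelay.exists_continuous_isStochIntegral hH.1 hB.fbm hB.indep
    hb.le hα.1 hα.2 hp hS₂ hS₂c hS₂n hmeas hint
  -- A modification and a delay term are fixed for every candidate x, so that the fixed point map is
  -- a genuine function of x.
  choose ξ G hξ hG using fun x : C(Icc (-r) b, Lp X 2 P) => hf.exists_isDelayTerm_path hb.le x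
  have hS₁0 : ∀ η, S₁ 0 η = η := fun η =>
    (hS₁ 0 ⟨le_rfl, hb.le⟩ η).trans (FracDelay.opT_zero hT hα0 hα.2 η)
  refine (existsUnique_congr fun x => FracDelay.isMildSolution_iff hr hb hf hS₁ hK hI
    (fun t I' hI' => hI'.unique hH.1 hH.2 hB.fbm (hI t)) (hξ x) (hG x)).2 ?_
  exact FracDelay.existsUnique_solution hr hb hf hS₁0 hS₁c hS₁n hKc hKD hKn hIc hI0 hξ hG
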